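/- Graphs are finite undirected multigraphs (parallel edges and loops allowed) with $n\ge 1$ vertices and $m$ edges, and $\log$ is the natural logarithm. For $A\subseteq E(G)$ let $\kappa(A)$ be the number of connected components of $(V(G),A)$, and let $$T(G;x,y)=\sum_{A\subseteq E(G)}(x-1)^{\kappa(A)-\kappa(E(G))}(y-1)^{|A|+\kappa(A)-n}$$ be the Tutte polynomial (with $0^0=1$). Put $$\Delta T(G;x,y)=\frac{y^m}{(y-1)^{n-1}}-T(G;x,y).$$ The edge connectivity of $G$ is greater than $c$ if, for every vertex set $S$ with $\emptyset\ne S\ne V(G)$, more than $c$ edges have exactly one end in $S$. **Theorem.** Let $x$ and $y$ be fixed real numbers with $y>1$. There is a constant $C>0$, depending only on $x$ and $y$, such that on the class of all graphs with edge connectivity greater than $c(n)=C\log n$ there is a fully polynomial randomized approximation scheme (FPRAS) for $\Delta T(G;x,y)$, and on the same class there is also an FPRAS for $T(G;x,y)$. Here an FPRAS for a function $f$ on a class of graphs is a single randomized program (which may depend on $x$ and $y$) that, given a graph $G$ of the class (as $n$, $m$ and the list of its edges) and the integer $\lceil 1/\varepsilon\rceil$ for a real $\varepsilon>0$, outputs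 a rational number $Z$ with $\Pr\bigl[\,|Z-f(G)|\le\varepsilon|f(G)|\,\bigr]\ge 3/4$, in time that, on every run, is at most a fixed polynomial in $n$, $m$ and $1/\varepsilon$. Programs run on a random access machine on integers with arithmetic $+,-,\times$, division with remainder, comparison, conditionals, loops and fair coin flips; time is bit cost (each operation is charged the bit lengths of its operands and results). The real parameters are accessible through $k\mapsto\lfloor 2^kx\rfloor$ and $k\mapsto\lfloor 2^ky\rfloor$, each access being charged $k$ in addition. -/

import Mathlib

/-! ### Graphs and the Tutte polynomial -/

/-- A finite undirected multigraph with vertex set `Fin n` and edges indexed by `Fin m`.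
Parallel edges and self-loops are allowed; the order of the two ends of an edge is irrelevant. -/
structure Multigraph where
  n : ℕ
  m : ℕ
  ends : Fin m → Fin n × Fin n

namespace Multigraph

/-- The (simple) graph on the vertices of `G` in which two distinct vertices are adjacent
if an edge from the set `A` joins them. -/
def spanning (G : Multigraph) (A : Finset (Fin G.m)) : SimpleGraph (Fin G.n) :=
  SimpleGraph.fromRel fun u v => ∃ j ∈ A, G.ends j = (u, v)

/-- The number `κ(A)` of connected components of the spanning subgraph with edge set `A`. -/
noncomputable def numComponents (G : Multigraph) (A : Finset (Fin G.m)) : ℕ :=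
  Nat.card (G.spanning A).ConnectedComponent

/-- The Tutte polynomial
`T(G; x, y) = ∑_{A ⊆ E} (x - 1) ^ (κ(A) - κ(E)) * (y - 1) ^ (|A| + κ(A) - n)`.
Both exponents are nonnegative, so that the subtractions of natural numbers do not truncate. -/
noncomputable def tutte (G : Multigraph) (x y : ℝ) : ℝ :=
  ∑ A : Finset (Fin G.m),
    (x - 1) ^ (G.numComponents A - G.numComponents Finset.univ) *
      (y - 1) ^ (A.card + G.numComponents A - G.n)

/-- `ΔT(G; x, y) = y ^ m / (y - 1) ^ (n - 1) - T(G; x, y)`, used for graphs with `1 ≤ n`. -/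
noncomputable def deltaTutte (G : Multigraph) (x y : ℝ) : ℝ :=
  y ^ G.m / (y - 1) ^ (G.n - 1) - G.tutte x y

/-- The value of the cut `(S, V \ S)`: the number of edges with exactly one end in `S`. -/
def cutValue (G : Multigraph) (S : Finset (Fin G.n)) : ℕ :=
  (Finset.univ.filter fun j : Fin G.m => ¬((G.ends j).1 ∈ S ↔ (G.ends j).2 ∈ S)).card

/-- The edge connectivity of `G` is greater than `c`: every cut into two nonempty sides has
value greater than `c`. -/
def EdgeConnectivityGT (G : Multigraph) (c : ℝ) : Prop :=
  ∀ S : Finset (Fin G.n), S.Nonempty → S ≠ Finset.univ → c < (G.cutValue S : ℝ)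

end Multigraph

/-! ### Randomized programs with bit cost

A random access machine on integers with the logarithmic (bit) cost criterion, fair coin flips
and structured control.  The memory consists of arrays of integers.  The loop count is evaluated
on entry, so that all programs halt; for polynomial running times this is no restriction, since a
polynomially bounded computation can be run under a polynomial clock.  Two fixed real parameters
are available through their binary expansions. -/

/-- `s a i` is the content of cell `i` of array `a`. -/
abbrev Memory : Type := ℕ → ℤ → ℤ

/-- Store `v` in cell `i` of array `a`. -/
def Memory.set (s : Memory) (a : ℕ) (i v : ℤ) : Memory :=
  fun a' i' => if a' = a ∧ i' = i then v else s a' i'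

/-- Length of the binary representation of an integer, with its sign. -/
def bitLen (z : ℤ) : ℕ := z.natAbs.size + 1

/-- Integer expressions. -/
inductive Expr : Type
  /-- An integer literal. -/
  | lit (z : ℤ)
  /-- The content of a cell of array `a`. -/
  | read (a : ℕ) (i : Expr)
  | add (e f : Expr)
  | sub (e f : Expr)
  | mul (e f : Expr)
  /-- Division with remainder (quotient `0` if the divisor is `0`). -/
  | div (e f : Expr)
  /-- `1` if `e < f`, otherwise `0`. -/
  | lt (e f : Expr)
  /-- `⌊2 ^ k * x⌋`, the first real parameter to `k` binary places. -/
  | paramX (k : Expr)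
  /-- `⌊2 ^ k * y⌋`, the second real parameter to `k` binary places. -/
  | paramY (k : Expr)

namespace Expr

/-- The value of an expression in the memory `s`, with real parameters `x` and `y`. -/
noncomputable def val (x y : ℝ) (s : Memory) : Expr → ℤ
  | lit z => z
  | read a i => s a (i.val x y s)
  | add e f => e.val x y s + f.val x y s
  | sub e f => e.val x y s - f.val x y s
  | mul e f => e.val x y s * f.val x y s
  | div e f => e.val x y s / f.val x y s
  | lt e f => if e.val x y s < f.val x y s then 1 else 0
  | paramX k => ⌊(2 : ℝ) ^ (k.val x y s).toNat * x⌋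
  | paramY k => ⌊(2 : ℝ) ^ (k.val x y s).toNat * y⌋

/-- The cost of evaluating an expression: the total bit length of the values of all its
subexpressions (thus of all operands, addresses and results), and in addition `k` for every
access to a real parameter with `k` binary places. -/
noncomputable def cost (x y : ℝ) (s : Memory) : Expr → ℕ
  | lit z => bitLen z
  | read a i => i.cost x y s + bitLen ((read a i).val x y s)
  | add e f => e.cost x y s + f.cost x y s + bitLen ((add e f).val x y s)
  | sub e f => e.cost x y s + f.cost x y s + bitLen ((sub e f).val x y s)
  | mul e f => e.cost x y s + f.cost x y s + bitLen ((mul e f).val x y s)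
  | div e f => e.cost x y s + f.cost x y s + bitLen ((div e f).val x y s)
  | lt e f => e.cost x y s + f.cost x y s + bitLen ((lt e f).val x y s)
  | paramX k => k.cost x y s + (k.val x y s).toNat + bitLen ((paramX k).val x y s)
  | paramY k => k.cost x y s + (k.val x y s).toNat + bitLen ((paramY k).val x y s)

end Expr

/-- Randomized programs. -/
inductive Prog : Type
  | skip
  /-- Store the value of `e` in cell `i` of array `a`. -/
  | write (a : ℕ) (i e : Expr)
  /-- Store a fair random bit in cell `i` of array `a`. -/
  | flip (a : ℕ) (i : Expr)
  | seq (c d : Prog)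
  /-- Run `c` if the value of `e` is not `0`, otherwise run `d`. -/
  | ite (e : Expr) (c d : Prog)
  /-- Evaluate `e` once and run `c` that many times (not at all if the value is negative). -/
  | loop (e : Expr) (c : Prog)

namespace Prog

/-- Increase the cost recorded in an outcome (final memory, cost) by `t`. -/
noncomputable def charge (t : ℕ) (μ : PMF (Memory × ℕ)) : PMF (Memory × ℕ) :=
  μ.map fun o => (o.1, o.2 + t)

/-- Sequential composition: the costs add up. -/
noncomputable def andThen (μ : PMF (Memory × ℕ)) (f : Memory → PMF (Memory × ℕ)) :
    PMF (Memory × ℕ) :=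
  μ.bind fun o => charge o.2 (f o.1)

/-- Run `f` the given number of times; every iteration costs `1` in addition to the cost of
`f`. -/
noncomputable def iter (f : Memory → PMF (Memory × ℕ)) : ℕ → Memory → PMF (Memory × ℕ)
  | 0, s => PMF.pure (s, 0)
  | k + 1, s => andThen (charge 1 (f s)) (iter f k)

/-- The joint distribution of the final memory and of the cost of a run started in `s`. -/
noncomputable def run (x y : ℝ) : Prog → Memory → PMF (Memory × ℕ)
  | skip, s => PMF.pure (s, 1)
  | write a i e, s =>
      PMF.pure (s.set a (i.val x y s) (e.val x y s), i.cost x y s + e.cost x y s + 1)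
  | flip a i, s =>
      (PMF.uniformOfFintype Bool).map fun b =>
        (s.set a (i.val x y s) (if b then 1 else 0), i.cost x y s + 1)
  | seq c d, s => andThen (c.run x y s) (d.run x y)
  | ite e c d, s =>
      charge (e.cost x y s + 1) (if e.val x y s ≠ 0 then c.run x y s else d.run x y s)
  | loop e c, s => charge (e.cost x y s + 1) (iter (c.run x y) (e.val x y s).toNat s)

end Prog

/-! ### Approximation schemes -/

/-- The initial memory for the graph `G` and the accuracy parameter `k` (required relative error
`1 / k`): array `0` starts with `n, m, k`, the arrays `1` and `2` list the two ends of each edge,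
and all other cells hold `0`. -/
def inputMemory (G : Multigraph) (k : ℕ) : Memory := fun a i =>
  if a = 0 then
    if i = 0 then (G.n : ℤ) else if i = 1 then (G.m : ℤ) else if i = 2 then (k : ℤ) else 0
  else if h : 0 ≤ i ∧ i.toNat < G.m then
    if a = 1 then (((G.ends ⟨i.toNat, h.2⟩).1 : ℕ) : ℤ)
    else if a = 2 then (((G.ends ⟨i.toNat, h.2⟩).2 : ℕ) : ℤ)
    else 0
  else 0

/-- The rational number that a run leaves as its output: numerator and denominator are the
cells `0` and `1` of array `3`. -/
def outputValue (s : Memory) : ℚ := (s 3 0 : ℚ) / (s 3 1 : ℚ)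

/-- `f` has a fully polynomial randomized approximation scheme on the graphs in the class `𝒢`:
one program which, for every graph `G` of the class and every error `ε > 0`, outputs an
approximation of `f G` with relative error at most `ε` with probability at least `3 / 4`, and whose
bit cost is always bounded by a fixed polynomial in the numbers of vertices and edges and in
`1 / ε`.  The program may access the real parameters `x` and `y`. -/
def HasFPRAS (x y : ℝ) (𝒢 : Set Multigraph) (f : Multigraph → ℝ) : Prop :=
  ∃ (P : Prog) (A d : ℕ), ∀ G ∈ 𝒢, ∀ ε : ℝ, 0 < ε →
    (∀ o ∈ (P.run x y (inputMemory G ⌈1 / ε⌉₊)).support,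
      (o.2 : ℝ) ≤ A * ((G.n : ℝ) + G.m + 1 / ε) ^ d) ∧
    3 / 4 ≤ (P.run x y (inputMemory G ⌈1 / ε⌉₊)).toOuterMeasure
      {o | |(outputValue o.1 : ℝ) - f G| ≤ ε * |f G|}

/-- The graphs with at least one vertex and edge connectivity greater than `C * log n`. -/
def logConnected (C : ℝ) : Set Multigraph :=
  {G | 1 ≤ G.n ∧ G.EdgeConnectivityGT (C * Real.log G.n)}

/-! Put q = 1/y and Q = (x-1)(y-1), and let A be the random edge set from which each edge is absent
independently with probability q. For connected G, T(G;x,y) is the explicit factor y^m/(y-1)^(n-1)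
times E[Q^(κ(A)-1)] (`tutte_eq`), so ΔT is this factor times the defect E[1 - Q^(κ(A)-1)]
(`deltaTutte_eq`). Only disconnected A contribute to the defect. Hence the problem is to estimate,
with small relative error, an expectation that lives on an event of possibly exponentially small
probability.

Let c be the minimum cut. The components of (V,B), if there are r ≥ 2 of them, are sides of cuts, so
at least cr/2 edges run between them (`mul_numComponents_le`). With Russo's formula this becomes a
differential inequality in the failure probability, whose integral is E binom(κ(A),k) ≤ q^(ck/2)
binom(n,k) for k ≥ 2 (`perc_choose_le`). If c > C log n with C large, n q^(c/2) is small, and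
configurations with three or more components are negligible. The defect is then (1-Q) P(κ ≥ 2) up to
a third-order term, and P(κ ≥ 2) ≥ q^c because a single minimum cut may fail. So, if Q ≠ 1, |defect|
≥ a q^c with a = |1-Q|/2 (`le_abs_defect`), which matches the upper bound for E binom(κ,2) up to a
polynomial factor.

The estimator is multilevel splitting. A is revealed in L levels; in each level every edge is added
with probability 2^(-s), so that finally it is absent with probability (1 - 2^(-s))^L, approximately
q. A population of disconnected subgraphs is kept: members that become connected are dropped, and
before each level the survivors are replicated, a nonempty population to a size between N/2 and N.
The weighted sum is unbiased (`exp_level`). The potential ρ^(ci) binom(κ,2), where ρ = 1 - 2^(-s)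
and i is the number of levels left, is a supermartingale that dominates the conditional
expectations, so a level increases the relative second moment only by a factor 1 + O(n²/N)
(`exp_levels`). Chebyshev's inequality finishes (`exp_levels_deviation`). Since the defect is at
most 1/2 in absolute value, an approximation of it also approximates 1 - defect, hence T.

The same number s is the number of binary places for x and y, the exponent of the coins, and the
number of components above which the contribution is truncated. All three errors are small relative
to q^c (`abs_perc_truncatedGap_sub_defect_le`), and the explicit factor has small relative error
(`prefactor_rounding`).

On the machine side, runs are finite coin-flip trees. Assigned expressions contain no
multiplication, so a unit of work enlarges entries by boundedly many bits, and polynomial work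
implies polynomial bit cost (`workTree_withinBudget`). The predicates `Det` and `Simulates` relate
the program to the abstract splitting process (`simulates_scheme`). -/

/-! ### Coin-flip trees -/

/-- A randomized computation with finitely many fair coin flips. -/
inductive CoinTree (α : Type*) where
  | ret (a : α) : CoinTree α
  | node (f : Bool → CoinTree α) : CoinTree α

namespace CoinTree

variable {α β γ : Type*}

/-- Sequential composition. -/
def bind : CoinTree α → (α → CoinTree β) → CoinTree β
  | ret a, g => g a
  | node f, g => node fun b => (f b).bind g

/-- The expectation of `φ`. -/
noncomputable def exp : CoinTree α → (α → ℝ) → ℝ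
  | ret a, φ => φ a
  | node f, φ => ((f true).exp φ + (f false).exp φ) / 2

/-- The distribution of the outcome. -/
noncomputable def pmf : CoinTree α → PMF α
  | ret a => PMF.pure a
  | node f => (PMF.uniformOfFintype Bool).bind fun b => (f b).pmf

/-- All outcomes satisfy `p`. -/
def All (p : α → Prop) : CoinTree α → Prop
  | ret a => p a
  | node f => ∀ b, (f b).All p

/-- Two trees of the same shape with pairwise related outcomes. -/
inductive Rel (R : α → β → Prop) : CoinTree α → CoinTree β → Prop
  | ret {a b} : R a b → Rel R (ret a) (ret b)
  | node {f g} : (∀ b, Rel R (f b) (g b)) → Rel R (node f) (node g)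

/-- `k`-fold iteration of a randomized step. -/
def iter (f : β → CoinTree β) : ℕ → β → CoinTree β
  | 0, b => ret b
  | k + 1, b => (f b).bind (iter f k)

@[simp] theorem ret_bind (a : α) (g : α → CoinTree β) : (ret a).bind g = g a := rfl

@[simp] theorem bind_ret (t : CoinTree α) : t.bind ret = t := by
  induction t with
  | ret a => rfl
  | node f ih => simp only [bind, ih]

theorem bind_bind (t : CoinTree α) (g : α → CoinTree β) (h : β → CoinTree γ) :
    (t.bind g).bind h = t.bind fun a => (g a).bind h := by
  induction t with
  | ret a => rfl
  | node f ih => simp only [bind, ih]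

@[simp] theorem exp_ret (a : α) (φ : α → ℝ) : (ret a).exp φ = φ a := rfl

theorem exp_bind (t : CoinTree α) (g : α → CoinTree β) (φ : β → ℝ) :
    (t.bind g).exp φ = t.exp fun a => (g a).exp φ := by
  induction t with
  | ret a => rfl
  | node f ih => simp only [bind, exp, ih]

theorem exp_add (t : CoinTree α) (φ ψ : α → ℝ) :
    (t.exp fun a => φ a + ψ a) = t.exp φ + t.exp ψ := by
  induction t with
  | ret a => rfl
  | node f ih => simp only [exp, ih]; ring

theorem exp_mul_left (t : CoinTree α) (r : ℝ) (φ : α → ℝ) :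
    (t.exp fun a => r * φ a) = r * t.exp φ := by
  induction t with
  | ret a => rfl
  | node f ih => simp only [exp, ih]; ring

@[simp] theorem exp_const (t : CoinTree α) (r : ℝ) : (t.exp fun _ => r) = r := by
  induction t with
  | ret a => rfl
  | node f ih => simp only [exp, ih]; ring

theorem exp_le_exp {t : CoinTree α} {φ ψ : α → ℝ} (h : t.All fun a => φ a ≤ ψ a) :
    t.exp φ ≤ t.exp ψ := by
  induction t with
  | ret a => exact h
  | node f ih =>
    have h1 := ih true (h true)
    have h2 := ih false (h false)
    simp only [exp]; linarith

theorem All.mono {t : CoinTree α} {p q : α → Prop} (h : t.All p) (hpq : ∀ a, p a → q a) : t.All q := by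
  induction t with
  | ret a => exact hpq _ h
  | node f ih => exact fun b => ih b (h b)

theorem All.of_forall (t : CoinTree α) {p : α → Prop} (h : ∀ a, p a) : t.All p := by
  induction t with
  | ret a => exact h a
  | node f ih => exact fun b => ih b

theorem exp_mono (t : CoinTree α) {φ ψ : α → ℝ} (h : ∀ a, φ a ≤ ψ a) : t.exp φ ≤ t.exp ψ :=
  exp_le_exp (All.of_forall t h)

theorem exp_congr {t : CoinTree α} {φ ψ : α → ℝ} (h : t.All fun a => φ a = ψ a) :
    t.exp φ = t.exp ψ :=
  le_antisymm (exp_le_exp (h.mono fun _ h => h.le)) (exp_le_exp (h.mono fun _ h => h.ge))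

theorem All.bind {t : CoinTree α} {g : α → CoinTree β} {p : α → Prop} {r : β → Prop} (ht : t.All p)
    (hg : ∀ a, p a → (g a).All r) : (t.bind g).All r := by
  induction t with
  | ret a => exact hg a ht
  | node f ih => exact fun b => ih b (ht b)

theorem All.iter {f : β → CoinTree β} {p : β → Prop} (hf : ∀ b, p b → (f b).All p) (k : ℕ) :
    ∀ b, p b → (iter f k b).All p := by
  induction k with
  | zero => exact fun b hb => hb
  | succ k ih => exact fun b hb => (hf b hb).bind ih

theorem Rel.bind {R : α → β → Prop} {α' β' : Type*} {R' : α' → β' → Prop} {t : CoinTree α} {u : CoinTree β}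
    {g : α → CoinTree α'} {h : β → CoinTree β'} (htu : Rel R t u)
    (hgh : ∀ a b, R a b → Rel R' (g a) (h b)) : Rel R' (t.bind g) (u.bind h) := by
  induction htu with
  | ret hab => exact hgh _ _ hab
  | node _ ih => exact Rel.node ih

theorem Rel.mono {R R' : α → β → Prop} {t : CoinTree α} {u : CoinTree β} (h : Rel R t u)
    (hR : ∀ a b, R a b → R' a b) : Rel R' t u := by
  induction h with
  | ret hab => exact .ret (hR _ _ hab)
  | node _ ih => exact .node ih

theorem Rel.and_left {R : α → β → Prop} {p : α → Prop} {t : CoinTree α} {u : CoinTree β} (h : Rel R t u)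
    (hp : t.All p) : Rel (fun a b => R a b ∧ p a) t u := by
  induction h with
  | ret hab => exact .ret ⟨hab, hp⟩
  | node _ ih => exact .node fun b => ih b (hp b)

theorem Rel.and_right {R : α → β → Prop} {p : β → Prop} {t : CoinTree α} {u : CoinTree β} (h : Rel R t u)
    (hp : u.All p) : Rel (fun a b => R a b ∧ p b) t u := by
  induction h with
  | ret hab => exact .ret ⟨hab, hp⟩
  | node _ ih => exact .node fun b => ih b (hp b)

theorem Rel.all_right {R : α → β → Prop} {p : α → Prop} {r : β → Prop} {t : CoinTree α} {u : CoinTree β}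
    (h : Rel R t u) (hp : t.All p) (hR : ∀ a b, R a b → p a → r b) : u.All r := by
  induction h with
  | ret hab => exact hR _ _ hab hp
  | node _ ih => exact fun b => ih b (hp b)

theorem Rel.all_left {R : α → β → Prop} {p : α → Prop} {t : CoinTree α} {u : CoinTree β}
    (h : Rel R t u) (hR : ∀ a b, R a b → p a) : t.All p := by
  induction h with
  | ret hab => exact hR _ _ hab
  | node _ ih => exact fun b => ih b

theorem Rel.exp_le {R : α → β → Prop} {φ : α → ℝ} {ψ : β → ℝ} {t : CoinTree α} {u : CoinTree β}
    (h : Rel R t u) (hR : ∀ a b, R a b → ψ b ≤ φ a) : u.exp ψ ≤ t.exp φ := by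
  induction h with
  | ret hab => exact hR _ _ hab
  | node _ ih => simp only [exp]; linarith [ih true, ih false]

theorem pmf_bind (t : CoinTree α) (g : α → CoinTree β) :
    (t.bind g).pmf = t.pmf.bind fun a => (g a).pmf := by
  induction t with
  | ret a => simp [bind, pmf]
  | node f ih => simp only [bind, pmf, ih, PMF.bind_bind]

theorem All.of_mem_support {t : CoinTree α} {p : α → Prop} (h : t.All p) {a : α}
    (ha : a ∈ t.pmf.support) : p a := by
  induction t with
  | ret b =>
    simp only [pmf, PMF.support_pure, Set.mem_singleton_iff] at ha
    subst ha; exact h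
  | node f ih =>
    simp only [pmf, PMF.mem_support_bind_iff] at ha
    obtain ⟨b, -, hb⟩ := ha
    exact ih b (h b) hb

open Classical in
theorem toOuterMeasure_pmf (t : CoinTree α) (S : Set α) :
    t.pmf.toOuterMeasure S = ENNReal.ofReal (t.exp fun a => if a ∈ S then 1 else 0) := by
  induction t with
  | ret a =>
    simp only [pmf, exp, PMF.toOuterMeasure_pure_apply]
    split_ifs <;> simp
  | node f ih =>
    have h0 : ∀ u : CoinTree α, 0 ≤ u.exp fun a => if a ∈ S then (1 : ℝ) else 0 := fun u => by
      have := u.exp_mono (φ := fun _ => 0) (ψ := fun a => if a ∈ S then (1 : ℝ) else 0)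
        (fun a => by split_ifs <;> norm_num)
      simpa using this
    simp only [pmf, exp, PMF.toOuterMeasure_bind_apply, tsum_fintype, Fintype.sum_bool, ih,
      PMF.uniformOfFintype_apply, Fintype.card_bool]
    rw [← mul_add, ← ENNReal.ofReal_add (h0 _) (h0 _), div_eq_mul_inv, mul_comm,
      ENNReal.ofReal_mul (add_nonneg (h0 _) (h0 _))]
    congr 1
    rw [ENNReal.ofReal_inv_of_pos (by norm_num)]
    norm_num

end CoinTree

/-! ### Programs as coin-flip trees -/

namespace Prog

/-- The outcome (final memory, cost) of a run, as a coin-flip tree. -/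
noncomputable def costTree (x y : ℝ) : Prog → Memory → CoinTree (Memory × ℕ)
  | skip, s => .ret (s, 1)
  | write a i e, s =>
      .ret (s.set a (i.val x y s) (e.val x y s), i.cost x y s + e.cost x y s + 1)
  | flip a i, s =>
      .node fun b => .ret (s.set a (i.val x y s) (if b then 1 else 0), i.cost x y s + 1)
  | seq c d, s =>
      (c.costTree x y s).bind fun o => (d.costTree x y o.1).bind fun o' => .ret (o'.1, o'.2 + o.2)
  | ite e c d, s =>
      (if e.val x y s ≠ 0 then c.costTree x y s else d.costTree x y s).bind fun o =>
        .ret (o.1, o.2 + (e.cost x y s + 1))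
  | loop e c, s =>
      (CoinTree.iter (fun o => (c.costTree x y o.1).bind fun o' => .ret (o'.1, o'.2 + 1 + o.2))
        (e.val x y s).toNat (s, 0)).bind fun o => .ret (o.1, o.2 + (e.cost x y s + 1))

theorem charge_pmf (t : ℕ) (u : CoinTree (Memory × ℕ)) :
    charge t u.pmf = (u.bind fun o => .ret (o.1, o.2 + t)).pmf := by
  rw [charge, CoinTree.pmf_bind, ← PMF.bind_pure_comp]
  rfl

/-- `run` adds the cost of earlier iterations from outside, whereas the tree carries it in the
state. The arbitrary starting cost `t` is what makes the induction go through. -/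
theorem iter_pmf (f : Memory → CoinTree (Memory × ℕ)) (g : Memory → PMF (Memory × ℕ))
    (hfg : ∀ s, g s = (f s).pmf) (k : ℕ) : ∀ (s : Memory) (t : ℕ),
    charge t (iter g k s) =
      (CoinTree.iter (fun o : Memory × ℕ => (f o.1).bind fun o' => .ret (o'.1, o'.2 + 1 + o.2))
        k (s, t)).pmf := by
  induction k with
  | zero => intro s t; simp [iter, CoinTree.iter, CoinTree.pmf, charge, PMF.pure_map]
  | succ k ih =>
    intro s t
    rw [iter, andThen, hfg, charge_pmf, CoinTree.iter, CoinTree.bind_bind, CoinTree.pmf_bind,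
      CoinTree.pmf_bind, PMF.bind_bind, charge, PMF.map_bind]
    congr 1
    funext o
    simp only [CoinTree.ret_bind, CoinTree.pmf, PMF.pure_bind]
    rw [← ih, charge, charge, PMF.map_comp]
    congr 1
    funext p
    simp; omega

theorem run_eq_pmf (x y : ℝ) (P : Prog) (s : Memory) : P.run x y s = (P.costTree x y s).pmf := by
  induction P generalizing s with
  | skip => rfl
  | write a i e => rfl
  | flip a i =>
    simp only [run, costTree, CoinTree.pmf, ← PMF.bind_pure_comp]
    rfl
  | seq c d ihc ihd =>
    simp only [run, costTree, andThen, ihc, ihd, charge_pmf, CoinTree.pmf_bind (c.costTree x y s)]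
  | ite e c d ihc ihd =>
    simp only [run, costTree]
    split_ifs <;> simp only [ihc, ihd, charge_pmf]
  | loop e c ih =>
    have h := iter_pmf (c.costTree x y) (c.run x y) ih (e.val x y s).toNat s 0
    simp only [run, costTree]
    rw [← charge_pmf, ← h]
    congr 1
    simp only [charge, Nat.add_zero]
    exact (PMF.map_id _).symm

end Prog

/-! ### Work and cost -/

/-- An expression without access to the parameters. -/
def Expr.ParamFree : Expr → Prop
  | .lit _ => True
  | .read _ i => i.ParamFree
  | .add e f => e.ParamFree ∧ f.ParamFree
  | .sub e f => e.ParamFree ∧ f.ParamFree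
  | .mul e f => e.ParamFree ∧ f.ParamFree
  | .div e f => e.ParamFree ∧ f.ParamFree
  | .lt e f => e.ParamFree ∧ f.ParamFree
  | .paramX _ => False
  | .paramY _ => False

/-- A parameter-free expression without multiplication, outside of addresses. -/
def Expr.Gentle : Expr → Prop
  | .lit _ => True
  | .read _ i => i.ParamFree
  | .add e f => e.Gentle ∧ f.Gentle
  | .sub e f => e.Gentle ∧ f.Gentle
  | .mul _ _ => False
  | .div e f => e.Gentle ∧ f.ParamFree
  | .lt e f => e.ParamFree ∧ f.ParamFree
  | .paramX _ => False
  | .paramY _ => False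

/-- A bound for the size of values and costs, in units of the memory size. -/
def Expr.coef : Expr → ℕ
  | .lit z => bitLen z
  | .read _ i => i.coef + 1
  | .add e f => 2 * (e.coef + f.coef) + 1
  | .sub e f => 2 * (e.coef + f.coef) + 1
  | .mul e f => 2 * (e.coef + f.coef) + 1
  | .div e f => 2 * (e.coef + f.coef) + 1
  | .lt e f => (e.coef + f.coef) + 2
  | .paramX k => k.coef
  | .paramY k => k.coef

/-- An expression that is gentle, or a parameter to a number of places given by a
parameter-free expression. -/
def Expr.Assignable : Expr → Prop
  | .paramX k => k.ParamFree
  | .paramY k => k.ParamFree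
  | e => e.Gentle

/-- The number of binary places of a parameter that is read. -/
noncomputable def Expr.places (x y : ℝ) (s : Memory) : Expr → ℕ
  | .paramX k => (k.val x y s).toNat
  | .paramY k => (k.val x y s).toNat
  | _ => 0

theorem bitLen_le_of_natAbs_le {a b : ℤ} (h : a.natAbs ≤ b.natAbs) : bitLen a ≤ bitLen b :=
  Nat.add_le_add_right (Nat.size_le_size h) 1

theorem bitLen_le_iff {a : ℤ} {k : ℕ} : bitLen a ≤ k + 1 ↔ a.natAbs < 2 ^ k := by
  rw [bitLen, Nat.add_le_add_iff_right, Nat.size_le]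

theorem one_le_bitLen (a : ℤ) : 1 ≤ bitLen a := by simp [bitLen]

theorem bitLen_le_of_natAbs_le_add {a b c : ℤ} {W : ℕ} (hb : bitLen b ≤ W) (hc : bitLen c ≤ W)
    (h : a.natAbs ≤ b.natAbs + c.natAbs) : bitLen a ≤ W + 1 := by
  obtain ⟨k, rfl⟩ : ∃ k, W = k + 1 := ⟨W - 1, by have := one_le_bitLen b; omega⟩
  rw [bitLen_le_iff] at hb hc ⊢
  rw [pow_succ]; omega

theorem bitLen_mul_le (a b : ℤ) : bitLen (a * b) ≤ bitLen a + bitLen b := by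
  have ha := bitLen_le_iff (a := a) (k := a.natAbs.size)
  have hb := bitLen_le_iff (a := b) (k := b.natAbs.size)
  have h1 : a.natAbs < 2 ^ a.natAbs.size := Nat.lt_size_self _
  have h2 : b.natAbs < 2 ^ b.natAbs.size := Nat.lt_size_self _
  have : bitLen (a * b) ≤ (a.natAbs.size + b.natAbs.size) + 1 := by
    rw [bitLen_le_iff, Int.natAbs_mul, pow_add]
    exact Nat.mul_lt_mul'' h1 h2
  simp only [bitLen] at *
  omega

theorem natAbs_ediv_le (a b : ℤ) : (a / b).natAbs ≤ a.natAbs := Int.natAbs_ediv_le_natAbs a b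

theorem bitLen_ite (p : Prop) [Decidable p] : bitLen (if p then 1 else 0) ≤ 2 := by
  split_ifs <;> simp [bitLen]

theorem bitLen_natCast_le (n : ℕ) : bitLen (n : ℤ) ≤ n + 1 := by
  rw [bitLen_le_iff, Int.natAbs_natCast]; exact Nat.lt_two_pow_self

/-! ### Size and cost of expressions. -/

namespace Expr

variable {x y : ℝ} {s : Memory} {W : ℕ}

/-- Under products sizes add up, so the bound is a multiple of the memory size. This suffices for
costs and addresses, but as a bound for stored values it would compound exponentially. -/
theorem val_cost_le (hs : ∀ a i, bitLen (s a i) ≤ W) {e : Expr} (he : e.ParamFree) :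
    bitLen (e.val x y s) ≤ e.coef * (W + 1) ∧ e.cost x y s ≤ e.coef * (W + 1) := by
  -- The first alternative covers sums and differences, the second products and quotients. `key2`
  -- then pays for both operands and the result, hence the doubled coefficients.
  have key : ∀ (p q : ℕ) (a b c : ℤ), bitLen a ≤ p * (W + 1) → bitLen b ≤ q * (W + 1) →
      bitLen c ≤ max (bitLen a) (bitLen b) + 1 ∨ bitLen c ≤ bitLen a + bitLen b →
      bitLen c ≤ (p + q + 1) * (W + 1) := by
    intro p q a b c ha hb hc
    have : (p + q + 1) * (W + 1) = p * (W + 1) + q * (W + 1) + (W + 1) := by ring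
    rcases hc with hc | hc
    · have := max_le_add_of_nonneg (Nat.zero_le (bitLen a)) (Nat.zero_le (bitLen b)); omega
    · omega
  have key2 : ∀ (p q cp cq : ℕ) (c : ℤ), cp ≤ p * (W + 1) → cq ≤ q * (W + 1) →
      bitLen c ≤ (p + q + 1) * (W + 1) → bitLen c ≤ (2 * (p + q) + 1) * (W + 1) ∧
        cp + cq + bitLen c ≤ (2 * (p + q) + 1) * (W + 1) := by
    intro p q cp cq c h1 h2 h3
    constructor <;> nlinarith
  have hmax : ∀ a b : ℤ, bitLen a ≤ max (bitLen a) (bitLen b) ∧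
      bitLen b ≤ max (bitLen a) (bitLen b) := fun a b => ⟨le_max_left _ _, le_max_right _ _⟩
  induction e with
  | lit z => exact ⟨Nat.le_mul_of_pos_right _ (by omega), Nat.le_mul_of_pos_right _ (by omega)⟩
  | read a i ih =>
    have h1 := (ih he).2
    have h2 := hs a (i.val x y s)
    simp only [coef, val, cost]
    constructor <;> nlinarith
  | add e f ihe ihf =>
    obtain ⟨⟨h1, h2⟩, ⟨h3, h4⟩⟩ := And.intro (ihe he.1) (ihf he.2)
    exact key2 _ _ _ _ _ h2 h4 (key _ _ _ _ _ h1 h3 (.inl (bitLen_le_of_natAbs_le_add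
      (hmax _ _).1 (hmax _ _).2 (Int.natAbs_add_le _ _))))
  | sub e f ihe ihf =>
    obtain ⟨⟨h1, h2⟩, ⟨h3, h4⟩⟩ := And.intro (ihe he.1) (ihf he.2)
    exact key2 _ _ _ _ _ h2 h4 (key _ _ _ _ _ h1 h3 (.inl (bitLen_le_of_natAbs_le_add
      (hmax _ _).1 (hmax _ _).2 (Int.natAbs_sub_le _ _))))
  | mul e f ihe ihf =>
    obtain ⟨⟨h1, h2⟩, ⟨h3, h4⟩⟩ := And.intro (ihe he.1) (ihf he.2)
    exact key2 _ _ _ _ _ h2 h4 (key _ _ _ _ _ h1 h3 (.inr (bitLen_mul_le _ _)))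
  | div e f ihe ihf =>
    obtain ⟨⟨h1, h2⟩, ⟨h3, h4⟩⟩ := And.intro (ihe he.1) (ihf he.2)
    exact key2 _ _ _ _ _ h2 h4 (key _ _ _ _ _ h1 h3 (.inr
      ((bitLen_le_of_natAbs_le (natAbs_ediv_le _ _)).trans (Nat.le_add_right _ _))))
  | lt e f ihe ihf =>
    obtain ⟨⟨h1, h2⟩, ⟨h3, h4⟩⟩ := And.intro (ihe he.1) (ihf he.2)
    have h5 : bitLen ((lt e f).val x y s) ≤ 2 := bitLen_ite _
    simp only [coef, cost]
    constructor <;> nlinarith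
  | paramX k => exact he.elim
  | paramY k => exact he.elim

/-- Sums add one bit, quotients are no longer than the dividend, and comparisons are bits. The
growth is therefore additive, which keeps entries of polynomial length after polynomially many
assignments. -/
theorem bitLen_val_le_of_gentle (hs : ∀ a i, bitLen (s a i) ≤ W) {e : Expr} (he : e.Gentle) :
    bitLen (e.val x y s) ≤ W + e.coef := by
  induction e with
  | lit z => exact Nat.le_add_left _ _
  | read a i ih => exact (hs _ _).trans (Nat.le_add_right _ _)
  | add e f ihe ihf =>
    have h1 := ihe he.1
    have h2 := ihf he.2
    have := bitLen_le_of_natAbs_le_add (h1.trans (by omega : _ ≤ W + (e.coef + f.coef)))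
      (h2.trans (by omega : _ ≤ W + (e.coef + f.coef))) (Int.natAbs_add_le _ _)
    simp only [val, coef]; omega
  | sub e f ihe ihf =>
    have h1 := ihe he.1
    have h2 := ihf he.2
    have := bitLen_le_of_natAbs_le_add (h1.trans (by omega : _ ≤ W + (e.coef + f.coef)))
      (h2.trans (by omega : _ ≤ W + (e.coef + f.coef))) (Int.natAbs_sub_le _ _)
    simp only [val, coef]; omega
  | mul e f => exact he.elim
  | div e f ihe ihf =>
    have h1 := ihe he.1
    have := bitLen_le_of_natAbs_le (natAbs_ediv_le (e.val x y s) (f.val x y s))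
    simp only [val, coef]; omega
  | lt e f ihe ihf =>
    have h5 : bitLen ((lt e f).val x y s) ≤ 2 := bitLen_ite _
    simp only [coef]; omega
  | paramX k => exact he.elim
  | paramY k => exact he.elim

theorem Gentle.paramFree {e : Expr} (he : e.Gentle) : e.ParamFree := by
  induction e with
  | lit z => trivial
  | read a i ih => exact he
  | add e f ihe ihf => exact ⟨ihe he.1, ihf he.2⟩
  | sub e f ihe ihf => exact ⟨ihe he.1, ihf he.2⟩
  | mul e f => exact he.elim
  | div e f ihe ihf => exact ⟨ihe he.1, he.2⟩
  | lt e f ihe ihf => exact he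
  | paramX k => exact he.elim
  | paramY k => exact he.elim

theorem bitLen_floor_two_pow_mul_le (k : ℕ) (z : ℝ) :
    bitLen ⌊(2 : ℝ) ^ k * z⌋ ≤ k + (⌈|z|⌉₊ + 2) := by
  rw [show k + (⌈|z|⌉₊ + 2) = (k + (⌈|z|⌉₊ + 1)) + 1 by ring, bitLen_le_iff]
  have h1 : |((⌊(2 : ℝ) ^ k * z⌋ : ℤ) : ℝ)| ≤ 2 ^ k * |z| + 1 := by
    have h2 := Int.floor_le ((2 : ℝ) ^ k * z)
    have h3 := Int.lt_floor_add_one ((2 : ℝ) ^ k * z)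
    have h4 : |(2 : ℝ) ^ k * z| = 2 ^ k * |z| := by rw [abs_mul, abs_of_pos (by positivity)]
    rw [← h4]
    rw [abs_le]
    constructor
    · linarith [neg_abs_le ((2 : ℝ) ^ k * z)]
    · linarith [le_abs_self ((2 : ℝ) ^ k * z)]
  have h5 : |z| ≤ ⌈|z|⌉₊ := Nat.le_ceil _
  have h6 : ((⌈|z|⌉₊ : ℕ) : ℝ) + 1 ≤ 2 ^ ⌈|z|⌉₊ := by exact_mod_cast Nat.lt_two_pow_self
  have h7 : (1 : ℝ) ≤ 2 ^ k := one_le_pow₀ (by norm_num)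
  have h8 : ((⌊(2 : ℝ) ^ k * z⌋.natAbs : ℕ) : ℝ) < ((2 ^ (k + (⌈|z|⌉₊ + 1)) : ℕ) : ℝ) := by
    rw [Nat.cast_natAbs, Int.cast_abs]
    push_cast
    rw [pow_add, pow_succ]
    refine h1.trans_lt ?_
    have : (2 : ℝ) ^ k * |z| + 1 ≤ 2 ^ k * (⌈|z|⌉₊ + 1) := by nlinarith
    have h9 : (0 : ℝ) < 2 ^ k := by positivity
    nlinarith
  exact_mod_cast h8

/-- Reading a parameter to k places creates about k new bits; this is why the places are counted as
work. -/
theorem assignable_le (hs : ∀ a i, bitLen (s a i) ≤ W) {e : Expr} (he : e.Assignable) :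
    bitLen (e.val x y s) ≤ W + (e.coef + e.places x y s + (⌈|x|⌉₊ + ⌈|y|⌉₊ + 2)) ∧
      e.cost x y s ≤ (e.coef + 2 * e.places x y s + (⌈|x|⌉₊ + ⌈|y|⌉₊ + 2)) * (W + 1) := by
  have gen : ∀ e : Expr, e.Gentle →
      bitLen (e.val x y s) ≤ W + (e.coef + e.places x y s + (⌈|x|⌉₊ + ⌈|y|⌉₊ + 2)) ∧
      e.cost x y s ≤ (e.coef + 2 * e.places x y s + (⌈|x|⌉₊ + ⌈|y|⌉₊ + 2)) * (W + 1) := by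
    intro e he
    have h1 := bitLen_val_le_of_gentle (x := x) (y := y) hs he
    have h2 := (val_cost_le (x := x) (y := y) hs he.paramFree).2
    exact ⟨by omega, h2.trans (Nat.mul_le_mul_right _ (by omega))⟩
  cases e with
  | paramX k =>
    have h1 := (val_cost_le (x := x) (y := y) hs he).2
    have h2 := bitLen_floor_two_pow_mul_le (k.val x y s).toNat x
    simp only [val, places, cost, coef]
    refine ⟨by omega, ?_⟩
    nlinarith
  | paramY k =>
    have h1 := (val_cost_le (x := x) (y := y) hs he).2
    have h2 := bitLen_floor_two_pow_mul_le (k.val x y s).toNat y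
    simp only [val, places, cost, coef]
    refine ⟨by omega, ?_⟩
    nlinarith
  | _ => exact gen _ he

end Expr

/-! ### Bit cost of a gentle run in terms of its work. -/

namespace Prog

/-- The outcome (final memory, work) of a run; the work counts the executed commands, and the
number of binary places for a parameter. -/
noncomputable def workTree (x y : ℝ) : Prog → Memory → CoinTree (Memory × ℕ)
  | skip, s => .ret (s, 1)
  | write a i e, s => .ret (s.set a (i.val x y s) (e.val x y s), e.places x y s + 1)
  | flip a i, s => .node fun b => .ret (s.set a (i.val x y s) (if b then 1 else 0), 1)
  | seq c d, s =>
      (c.workTree x y s).bind fun o => (d.workTree x y o.1).bind fun o' => .ret (o'.1, o'.2 + o.2)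
  | ite e c d, s =>
      (if e.val x y s ≠ 0 then c.workTree x y s else d.workTree x y s).bind fun o =>
        .ret (o.1, o.2 + 1)
  | loop e c, s =>
      (CoinTree.iter (fun o => (c.workTree x y o.1).bind fun o' => .ret (o'.1, o'.2 + 1 + o.2))
        (e.val x y s).toNat (s, 0)).bind fun o => .ret (o.1, o.2 + 1)

/-- A program all of whose assignments are gentle. -/
def Gentle : Prog → Prop
  | skip => True
  | write _ i e => i.ParamFree ∧ e.Assignable
  | flip _ i => i.ParamFree
  | seq c d => c.Gentle ∧ d.Gentle
  | ite e c d => e.ParamFree ∧ c.Gentle ∧ d.Gentle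
  | loop e c => e.ParamFree ∧ c.Gentle

/-- A bound for the cost of one unit of work, in units of the memory size. -/
def coef : Prog → ℕ
  | skip => 1
  | write _ i e => i.coef + e.coef + 5
  | flip _ i => i.coef + 5
  | seq c d => c.coef + d.coef
  | ite e c d => e.coef + c.coef + d.coef + 1
  | loop e c => e.coef + c.coef + 1

/-- After `w` units of work, starting with entries of at most `W` bits. -/
def WithinBudget (a W : ℕ) (o o' : Memory × ℕ) : Prop :=
  o.1 = o'.1 ∧ (∀ b i, bitLen (o.1 b i) ≤ W + a * o.2) ∧ o'.2 ≤ a * o.2 * (W + a * o.2 + 1)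

theorem bitLen_set_le {s : Memory} {W : ℕ} (hs : ∀ a i, bitLen (s a i) ≤ W) {v : ℤ} {W' : ℕ}
    (hW : W ≤ W') (hv : bitLen v ≤ W') (a : ℕ) (i : ℤ) (b : ℕ) (j : ℤ) :
    bitLen (s.set a i v b j) ≤ W' := by
  unfold Memory.set
  split_ifs
  · exact hv
  · exact (hs _ _).trans hW

/-- The budget is superadditive along a run: the second piece starts with entries of W + a w bits,
the size after the first piece. -/
theorem withinBudget_combine {a W w c w' c' : ℕ} (h1 : c ≤ a * w * (W + a * w + 1))
    (h2 : c' ≤ a * w' * ((W + a * w) + a * w' + 1)) :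
    c' + c ≤ a * (w' + w) * (W + a * (w' + w) + 1) := by
  have e : W + a * w + a * w' + 1 = W + a * (w' + w) + 1 := by ring
  rw [e] at h2
  have h3 : a * w * (W + a * w + 1) ≤ a * w * (W + a * (w' + w) + 1) :=
    Nat.mul_le_mul_left _ (by nlinarith)
  have h4 : a * (w' + w) * (W + a * (w' + w) + 1) =
    a * w' * (W + a * (w' + w) + 1) + a * w * (W + a * (w' + w) + 1) := by ring
  omega

theorem withinBudget_one {a W c p e : ℕ} (h : c ≤ (e + 2 * p) * (W + 1) + 1) (ha : e + 2 ≤ a)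
    : c ≤ a * (p + 1) * (W + a * (p + 1) + 1) := by
  have h1 : e + 2 * p + 1 ≤ a * (p + 1) := by nlinarith
  have h2 : (e + 2 * p) * (W + 1) + 1 ≤ (e + 2 * p + 1) * (W + 1) := by nlinarith
  have h3 : (e + 2 * p + 1) * (W + 1) ≤ a * (p + 1) * (W + a * (p + 1) + 1) :=
    Nat.mul_le_mul h1 (by omega)
  omega

theorem withinBudget_unit {a W W' c e : ℕ} (h : c ≤ e * (W + 1)) (hW : W ≤ W') (ha : e + 2 ≤ a) :
    c + 1 ≤ a * 1 * (W' + a * 1 + 1) := by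
  refine withinBudget_one (p := 0) (e := e) (W := W') ?_ ha
  have : e * (W + 1) ≤ e * (W' + 1) := Nat.mul_le_mul_left _ (by omega)
  simp only [Nat.mul_zero, Nat.add_zero]
  omega

/-- The two trees branch identically, since both follow the same control flow. Each unit of work
lengthens entries by at most `a` bits and costs at most `a` times the current entry length (plus
one), so the cost is quadratic in the work. -/
theorem workTree_withinBudget (x y : ℝ) {a : ℕ} (P : Prog) (hP : P.Gentle)
    (ha : P.coef + (⌈|x|⌉₊ + ⌈|y|⌉₊ + 2) ≤ a) (W : ℕ) (s : Memory)
    (hs : ∀ a i, bitLen (s a i) ≤ W) :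
    CoinTree.Rel (WithinBudget a W) (P.workTree x y s) (P.costTree x y s) := by
  induction P generalizing W s with
  | skip =>
    refine .ret ⟨rfl, fun b i => (hs b i).trans (by simp), ?_⟩
    simp only [coef] at ha ⊢; nlinarith
  | write b i e =>
    obtain ⟨hi, he⟩ := hP
    obtain ⟨h1, h2⟩ := Expr.assignable_le (x := x) (y := y) hs he
    have h3 := (Expr.val_cost_le (x := x) (y := y) hs hi).2
    simp only [coef] at ha
    refine .ret ⟨rfl, bitLen_set_le hs (Nat.le_add_right _ _) (h1.trans ?_) _ _, ?_⟩
    · simp only; nlinarith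
    · simp only
      refine withinBudget_one (e := i.coef + e.coef + (⌈|x|⌉₊ + ⌈|y|⌉₊ + 2)) ?_ (by omega)
      nlinarith
  | flip b i =>
    have h3 := (Expr.val_cost_le (x := x) (y := y) hs hP).2
    simp only [coef] at ha
    refine .node fun c => .ret ⟨rfl, bitLen_set_le hs (Nat.le_add_right _ _) ?_ _ _, ?_⟩
    · refine (bitLen_ite _).trans ?_; simp only; omega
    · exact withinBudget_unit (e := i.coef) h3 le_rfl (by omega)
  | seq c d ihc ihd =>
    simp only [coef] at ha
    refine (ihc hP.1 (by omega) W s hs).bind ?_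
    rintro ⟨s', w⟩ ⟨s'', c'⟩ ⟨h1, h2, h3⟩
    simp only at h1 h2 h3; subst h1
    refine (ihd hP.2 (by omega) _ s' h2).bind ?_
    rintro ⟨t, w'⟩ ⟨t', c''⟩ ⟨h4, h5, h6⟩
    simp only at h4 h5 h6; subst h4
    refine .ret ⟨rfl, fun b i => (h5 b i).trans_eq ?_, withinBudget_combine h3 h6⟩
    simp only; ring
  | ite e c d ihc ihd =>
    simp only [coef] at ha
    have h0 := (Expr.val_cost_le (x := x) (y := y) hs hP.1).2
    have main : ∀ t u : CoinTree (Memory × ℕ), CoinTree.Rel (WithinBudget a W) t u →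
        CoinTree.Rel (WithinBudget a W) (t.bind fun o => .ret (o.1, o.2 + 1))
          (u.bind fun o => .ret (o.1, o.2 + (e.cost x y s + 1))) := by
      intro t u htu
      refine htu.bind ?_
      rintro ⟨s', w⟩ ⟨s'', c'⟩ ⟨h1, h2, h3⟩
      simp only at h1 h2 h3; subst h1
      refine .ret ⟨rfl, fun b i => (h2 b i).trans (by simp only; nlinarith), ?_⟩
      simp only
      rw [add_comm c', add_comm w]
      refine withinBudget_combine h3 ?_
      exact withinBudget_unit (e := e.coef) h0 (Nat.le_add_right _ _) (by omega)
    simp only [workTree, costTree]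
    split_ifs
    · exact main _ _ (ihc hP.2.1 (by omega) W s hs)
    · exact main _ _ (ihd hP.2.2 (by omega) W s hs)
  | loop e c ih =>
    simp only [coef] at ha
    have h0 := (Expr.val_cost_le (x := x) (y := y) hs hP.1).2
    have main : ∀ (k : ℕ) (o o' : Memory × ℕ), WithinBudget a W o o' →
        CoinTree.Rel (WithinBudget a W)
          (CoinTree.iter (fun o => (c.workTree x y o.1).bind fun o' => .ret (o'.1, o'.2 + 1 + o.2))
            k o)
          (CoinTree.iter (fun o => (c.costTree x y o.1).bind fun o' => .ret (o'.1, o'.2 + 1 + o.2))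
            k o') := by
      intro k
      induction k with
      | zero => exact fun o o' h => .ret h
      | succ k ihk =>
        rintro ⟨t, w⟩ ⟨t', c'⟩ ⟨h1, h2, h3⟩
        simp only at h1 h2 h3; subst h1
        simp only [CoinTree.iter]
        refine CoinTree.Rel.bind (R := WithinBudget a W) ?_ fun o o' h => ihk o o' h
        refine (ih hP.2 (by omega) _ t h2).bind ?_
        rintro ⟨u, w'⟩ ⟨u', c''⟩ ⟨h4, h5, h6⟩
        simp only at h4 h5 h6; subst h4
        refine .ret ⟨rfl, fun b i => (h5 b i).trans ?_, ?_⟩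
        · simp only; nlinarith
        · simp only
          refine withinBudget_combine h3 ?_
          rw [add_comm c'', add_comm w']
          rw [add_comm 1 c'', add_comm 1 w', add_comm c'', add_comm w']
          refine (withinBudget_combine (w := w') (w' := 1) (c := c'') (c' := 1) h6 ?_)
          exact withinBudget_one (p := 0) (e := 0) (by omega) (by omega)
    simp only [workTree, costTree]
    refine (main _ (s, 0) (s, 0) ⟨rfl, by simpa using hs, by simp⟩).bind ?_
    rintro ⟨s', w⟩ ⟨s'', c'⟩ ⟨h1, h2, h3⟩
    simp only at h1 h2 h3; subst h1
    refine .ret ⟨rfl, fun b i => (h2 b i).trans (by simp only; nlinarith), ?_⟩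
    simp only
    rw [add_comm c', add_comm w]
    refine withinBudget_combine h3 ?_
    exact withinBudget_unit (e := e.coef) h0 (Nat.le_add_right _ _) (by omega)

end Prog

/-! ### A program logic -/

namespace Prog

/-- The arrays to which a program may write. -/
def writes : Prog → List ℕ
  | skip => []
  | write a _ _ => [a]
  | flip a _ => [a]
  | seq c d => c.writes ++ d.writes
  | ite _ c d => c.writes ++ d.writes
  | loop _ c => c.writes

/-- `s'` differs from `s` at most in the arrays to which `P` may write. -/
def Frame (P : Prog) (s s' : Memory) : Prop := ∀ a, a ∉ P.writes → s' a = s a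

theorem Frame.refl (P : Prog) (s : Memory) : Frame P s s := fun _ _ => rfl

theorem set_of_ne {s : Memory} {a b : ℕ} (h : b ≠ a) (i v : ℤ) : s.set a i v b = s b := by
  funext j; simp [Memory.set, h]

@[simp] theorem set_apply (s : Memory) (a : ℕ) (i v : ℤ) (b : ℕ) (j : ℤ) :
    s.set a i v b j = if b = a ∧ j = i then v else s b j := rfl

/-- This frame rule allows specifications to mention only what changes; untouched arrays are
recovered by deciding membership in a list of numbers. -/
theorem workTree_frame (x y : ℝ) (P : Prog) (s : Memory) :
    (P.workTree x y s).All fun o => Frame P s o.1 := by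
  induction P generalizing s with
  | skip => exact Frame.refl _ _
  | write a i e => exact fun b hb => set_of_ne (by simpa [writes] using hb) _ _
  | flip a i => exact fun c b hb => set_of_ne (by simpa [writes] using hb) _ _
  | seq c d ihc ihd =>
    refine (ihc s).bind fun o ho => (ihd o.1).bind fun o' ho' => ?_
    intro a ha
    simp only [writes, List.mem_append, not_or] at ha
    rw [ho' a ha.2, ho a ha.1]
  | ite e c d ihc ihd =>
    simp only [workTree]
    have h : ∀ a, a ∉ (ite e c d).writes → a ∉ c.writes ∧ a ∉ d.writes := by
      simp [writes]
    split_ifs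
    · exact (ihc s).bind fun o ho a ha => ho a (h a ha).1
    · exact (ihd s).bind fun o ho a ha => ho a (h a ha).2
  | loop e c ih =>
    refine CoinTree.All.bind (p := fun o : Memory × ℕ => Frame c s o.1) ?_ fun o ho => ho
    refine CoinTree.All.iter ?_ _ _ (Frame.refl _ _)
    exact fun o ho => (ih o.1).bind fun o' ho' a ha => (ho' a ha).trans (ho a ha)

variable {x y : ℝ}

/-- Started in `s`, the program flips no coins, does at most `w` units of work, and stops in a
memory that satisfies `Q`. -/
def Det (x y : ℝ) (P : Prog) (s : Memory) (Q : Memory → Prop) (w : ℕ) : Prop :=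
  ∃ s' w', P.workTree x y s = .ret (s', w') ∧ Q s' ∧ w' ≤ w

/-- Started in `s`, the program does at most `w` units of work and simulates `t`, such that the
final memory and the outcome of `t` are related by `R`. -/
def Simulates {β : Type*} (x y : ℝ) (P : Prog) (s : Memory) (t : CoinTree β)
    (R : Memory → β → Prop) (w : ℕ) : Prop :=
  CoinTree.Rel (fun o b => R o.1 b ∧ o.2 ≤ w) (P.workTree x y s) t

/-! ### Rules for runs without coin flips. -/

section Det

variable {P c d : Prog} {s : Memory} {Q Q' : Memory → Prop} {w w' : ℕ}

theorem Det.weaken (h : Det x y P s Q w) (hw : w ≤ w') : Det x y P s Q w' := by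
  obtain ⟨s', v, h1, h2, h3⟩ := h
  exact ⟨s', v, h1, h2, h3.trans hw⟩

theorem Det.frame (h : Det x y P s Q w) : Det x y P s (fun s' => Q s' ∧ Frame P s s') w := by
  obtain ⟨s', v, h1, h2, h3⟩ := h
  have := workTree_frame x y P s
  rw [h1] at this
  exact ⟨s', v, h1, ⟨h2, this⟩, h3⟩

theorem Det.mono (h : Det x y P s Q w) (hQ : ∀ s', Q s' → Frame P s s' → Q' s') :
    Det x y P s Q' w := by
  obtain ⟨s', v, h1, h2, h3⟩ := h.frame
  exact ⟨s', v, h1, hQ _ h2.1 h2.2, h3⟩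

theorem Det.skip (h : Q s) : Det x y .skip s Q 1 := ⟨s, 1, rfl, h, le_rfl⟩

theorem Det.write {a : ℕ} {i e : Expr} (h : Q (s.set a (i.val x y s) (e.val x y s)))
    (he : e.places x y s = 0 := by rfl) : Det x y (.write a i e) s Q 1 :=
  ⟨_, _, rfl, h, by simp [he]⟩

theorem Det.write_param {a : ℕ} {i e : Expr} (h : Q (s.set a (i.val x y s) (e.val x y s))) :
    Det x y (.write a i e) s Q (e.places x y s + 1) :=
  ⟨_, _, rfl, h, le_rfl⟩

theorem Det.seq (hc : Det x y c s Q w) (hd : ∀ s', Q s' → Frame c s s' → Det x y d s' Q' w') :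
    Det x y (.seq c d) s Q' (w + w') := by
  obtain ⟨s', v, h1, ⟨h2, h2'⟩, h3⟩ := hc.frame
  obtain ⟨t, u, h4, h5, h6⟩ := hd s' h2 h2'
  exact ⟨t, u + v, by simp [workTree, h1, h4], h5, by omega⟩

theorem Det.ite {e : Expr} (hc : e.val x y s ≠ 0 → Det x y c s Q w)
    (hd : e.val x y s = 0 → Det x y d s Q w) : Det x y (.ite e c d) s Q (w + 1) := by
  by_cases h : e.val x y s = 0
  · obtain ⟨s', v, h1, h2, h3⟩ := hd h
    exact ⟨s', v + 1, by simp [workTree, h1, h], h2, by omega⟩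
  · obtain ⟨s', v, h1, h2, h3⟩ := hc h
    exact ⟨s', v + 1, by simp [workTree, h1, h], h2, by omega⟩

theorem Det.loop {e : Expr} (I : ℕ → Memory → Prop) (n : ℕ) (hn : (e.val x y s).toNat = n)
    (h0 : I 0 s)
    (hc : ∀ i < n, ∀ s', Frame c s s' → I i s' → Det x y c s' (I (i + 1)) w) :
    Det x y (.loop e c) s (I n) (n * (w + 1) + 1) := by
  -- Here `k` iterations remain, `j` are done, and `v` is the work spent on them.
  have main : ∀ k j s' v, j + k = n → Frame c s s' → I j s' → v ≤ j * (w + 1) →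
      ∃ s'' v', CoinTree.iter (fun o : Memory × ℕ =>
        (c.workTree x y o.1).bind fun o' => .ret (o'.1, o'.2 + 1 + o.2)) k (s', v) =
          .ret (s'', v') ∧ I n s'' ∧ v' ≤ n * (w + 1) := by
    intro k
    induction k with
    | zero => intro j s' v hj _ hI hv; obtain rfl : j = n := by omega
              exact ⟨s', v, rfl, hI, hv⟩
    | succ k ih =>
      intro j s' v hj hf hI hv
      obtain ⟨t, u, h1, ⟨h2, h2'⟩, h3⟩ := (hc j (by omega) s' hf hI).frame
      obtain ⟨s'', v', h4, h5⟩ := ih (j + 1) t (u + 1 + v) (by omega)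
        (fun a ha => (h2' a ha).trans (hf a ha)) h2 (by nlinarith)
      exact ⟨s'', v', by simpa [CoinTree.iter, h1] using h4, h5⟩
  obtain ⟨s'', v', h1, h2, h3⟩ := main n 0 s 0 (by omega) (Frame.refl _ _) h0 (by omega)
  exact ⟨s'', v' + 1, by simp [workTree, hn, h1], h2, by omega⟩

end Det

/-! ### Rules for runs that simulate a coin-flip tree. -/

section Simulates

variable {β γ : Type*} {P c d : Prog} {s : Memory} {t : CoinTree β} {R R' : Memory → β → Prop}
  {w w' : ℕ}

theorem Simulates.weaken (h : Simulates x y P s t R w) (hw : w ≤ w') :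
    Simulates x y P s t R w' :=
  CoinTree.Rel.mono h fun _ _ h => ⟨h.1, h.2.trans hw⟩

theorem Simulates.frame (h : Simulates x y P s t R w) :
    Simulates x y P s t (fun s' b => R s' b ∧ Frame P s s') w :=
  (CoinTree.Rel.and_left h (workTree_frame x y P s)).mono fun _ _ h => ⟨⟨h.1.1, h.2⟩, h.1.2⟩

theorem Simulates.mono (h : Simulates x y P s t R w)
    (hR : ∀ s' b, R s' b → Frame P s s' → R' s' b) : Simulates x y P s t R' w :=
  CoinTree.Rel.mono h.frame fun _ _ h => ⟨hR _ _ h.1.1 h.1.2, h.2⟩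

theorem Det.simulates {Q : Memory → Prop} (b : β) (h : Det x y P s Q w)
    (hR : ∀ s', Q s' → Frame P s s' → R s' b) : Simulates x y P s (.ret b) R w := by
  obtain ⟨s', v, h1, ⟨h2, h2'⟩, h3⟩ := h.frame
  rw [Simulates, h1]
  exact .ret ⟨hR _ h2 h2', h3⟩

theorem Simulates.seq {f : β → CoinTree γ} {R' : Memory → γ → Prop} (hc : Simulates x y c s t R w)
    (hd : ∀ s' b, R s' b → Frame c s s' → Simulates x y d s' (f b) R' w') :
    Simulates x y (.seq c d) s (t.bind f) R' (w + w') := by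
  refine CoinTree.Rel.bind hc.frame ?_
  rintro ⟨s', v⟩ b ⟨⟨h1, h2⟩, h3⟩
  simp only at h1 h2 h3
  -- The program tree ends with a step that adds up the work; appending `ret` gives the abstract
  -- tree a matching step.
  rw [← CoinTree.bind_ret (f b)]
  refine CoinTree.Rel.bind (hd s' b h1 h2) ?_
  rintro ⟨s'', v'⟩ b' ⟨h4, h5⟩
  exact .ret ⟨h4, by simp only at h5 ⊢; omega⟩

theorem Simulates.det_seq {Q : Memory → Prop} (hc : Det x y c s Q w)
    (hd : ∀ s', Q s' → Frame c s s' → Simulates x y d s' t R w') :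
    Simulates x y (.seq c d) s t R (w + w') := by
  have := Simulates.seq (f := fun _ : Unit => t) (R' := R) (w' := w')
    (hc.simulates (R := fun s' _ => Q s' ∧ Frame c s s') () fun s' h h' => ⟨h, h'⟩)
    (fun s' _ h _ => hd s' h.1 h.2)
  exact this

theorem Simulates.seq_det (hc : Simulates x y c s t R w)
    (hd : ∀ s' b, R s' b → Frame c s s' → Det x y d s' (fun s'' => R' s'' b) w') :
    Simulates x y (.seq c d) s t R' (w + w') := by
  have := Simulates.seq (f := CoinTree.ret) (R' := R') (w' := w') hc
    (fun s' b h h' => (hd s' b h h').simulates b fun _ h _ => h)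
  rwa [CoinTree.bind_ret] at this

theorem Simulates.loop {e : Expr} {f : β → CoinTree β} (I : ℕ → Memory → β → Prop) (n : ℕ)
    (hn : (e.val x y s).toNat = n) (b₀ : β) (h0 : I 0 s b₀)
    (hc : ∀ i < n, ∀ s' b, Frame c s s' → I i s' b → Simulates x y c s' (f b) (I (i + 1)) w) :
    Simulates x y (.loop e c) s (CoinTree.iter f n b₀) (I n) (n * (w + 1) + 1) := by
  have main : ∀ k j s' v b, j + k = n → Frame c s s' → I j s' b → v ≤ j * (w + 1) →
      CoinTree.Rel (fun (o : Memory × ℕ) b => I n o.1 b ∧ o.2 ≤ n * (w + 1))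
        (CoinTree.iter (fun o : Memory × ℕ =>
          (c.workTree x y o.1).bind fun o' => .ret (o'.1, o'.2 + 1 + o.2)) k (s', v))
        (CoinTree.iter f k b) := by
    intro k
    induction k with
    | zero => intro j s' v b hj _ hI hv; obtain rfl : j = n := by omega
              exact .ret ⟨hI, hv⟩
    | succ k ih =>
      intro j s' v b hj hf hI hv
      rw [CoinTree.iter, CoinTree.iter, CoinTree.bind_bind]
      refine CoinTree.Rel.bind (hc j (by omega) s' b hf hI).frame ?_
      rintro ⟨t, u⟩ b' ⟨⟨h2, h2'⟩, h3⟩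
      exact ih (j + 1) t (u + 1 + v) b' (by omega)
        (fun a ha => (h2' a ha).trans (hf a ha)) h2 (by simp only at h3; nlinarith)
  rw [Simulates, workTree, hn, ← CoinTree.bind_ret (CoinTree.iter f n b₀)]
  refine CoinTree.Rel.bind (main n 0 s 0 b₀ (by omega) (Frame.refl _ _) h0 (by omega)) ?_
  rintro ⟨s', v⟩ b ⟨h1, h2⟩
  exact .ret ⟨h1, by simp only at h2 ⊢; omega⟩

end Simulates

/-! ### Derived commands -/

/-- The scalar variable stored in cell `0` of array `a`. -/
abbrev var (a : ℕ) : Expr := .read a (.lit 0)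

/-- Assign `e` to the variable `a`. -/
abbrev assign (a : ℕ) (e : Expr) : Prog := .write a (.lit 0) e

/-- Run `c` for the values `0, 1, …, e - 1` of the variable `i`. -/
def forLoop (i : ℕ) (e : Expr) (c : Prog) : Prog :=
  .seq (assign i (.lit 0)) (.loop e (.seq c (assign i (.add (var i) (.lit 1)))))

/-- The counter is incremented after the body, so the body has to preserve it and to establish the
next invariant in the memory with the counter already advanced. -/
theorem Det.forLoop {i : ℕ} {e : Expr} {c : Prog} {s : Memory} {w : ℕ} (I : ℕ → Memory → Prop)
    (n : ℕ) (hn : (e.val x y (s.set i 0 0)).toNat = n) (h0 : I 0 (s.set i 0 0))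
    (hc : ∀ k < n, ∀ s', Frame (.seq (assign i (.lit 0)) c) s s' → s' i 0 = k → I k s' →
      Det x y c s' (fun t => t i 0 = k ∧ I (k + 1) (t.set i 0 (k + 1))) w) :
    Det x y (Prog.forLoop i e c) s (I n) (n * (w + 2) + 2) := by
  have h1 : Det x y (assign i (.lit 0)) s (fun s' => s' = s.set i 0 0) 1 := .write rfl
  refine (h1.seq (w' := n * (w + 2) + 1) ?_).weaken (by omega)
  rintro s' rfl -
  refine (Det.loop (fun k t => t i 0 = k ∧ I k t) n hn ⟨by simp, h0⟩ (w := w + 1) ?_).mono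
    fun _ h _ => h.2
  rintro k hk t hf ⟨ht, hI⟩
  refine (hc k hk t ?_ ht hI).seq (w' := 1) ?_
  · intro a ha
    simp only [writes, List.cons_append, List.nil_append, List.mem_cons, not_or] at ha
    rw [hf a (by simp [writes, ha]), set_of_ne ha.1]
  · rintro t' ⟨h2, h3⟩ -
    refine .write ?_
    simp only [Expr.val, h2]
    refine ⟨by simp, h3⟩

theorem Simulates.forLoop {β : Type*} {i : ℕ} {e : Expr} {c : Prog} {s : Memory} {w : ℕ}
    {f : β → CoinTree β} (I : ℕ → Memory → β → Prop)
    (n : ℕ) (hn : (e.val x y (s.set i 0 0)).toNat = n) (b₀ : β) (h0 : I 0 (s.set i 0 0) b₀)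
    (hc : ∀ k < n, ∀ s' b, Frame (.seq (assign i (.lit 0)) c) s s' → s' i 0 = k → I k s' b →
      Simulates x y c s' (f b) (fun t b => t i 0 = k ∧ I (k + 1) (t.set i 0 (k + 1)) b) w) :
    Simulates x y (Prog.forLoop i e c) s (CoinTree.iter f n b₀) (I n) (n * (w + 2) + 2) := by
  have h1 : Det x y (assign i (.lit 0)) s (fun s' => s' = s.set i 0 0) 1 := .write rfl
  refine (Simulates.det_seq h1 (w' := n * (w + 2) + 1) ?_).weaken (by omega)
  rintro s' rfl -
  refine (Simulates.loop (fun k t b => t i 0 = k ∧ I k t b) n hn b₀ ⟨by simp, h0⟩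
    (w := w + 1) ?_).mono fun _ _ h _ => h.2
  rintro k hk t b hf ⟨ht, hI⟩
  refine (hc k hk t b ?_ ht hI).seq_det (w' := 1) ?_
  · intro a ha
    simp only [writes, List.cons_append, List.nil_append, List.mem_cons, not_or] at ha
    rw [hf a (by simp [writes, ha]), set_of_ne ha.1]
  · rintro t' b' ⟨h2, h3⟩ -
    refine .write ?_
    simp only [Expr.val, h2]
    refine ⟨by simp, h3⟩

/-- Multiply the variable `a` by `e`, by repeated addition. -/
def mulBy (a : ℕ) (e : Expr) : Prog :=
  .seq (assign 12 (.lit 0)) <|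
  .seq (.loop e (assign 12 (.add (var 12) (var a)))) <|
  .seq (.loop (.sub (.lit 0) e) (assign 12 (.sub (var 12) (var a)))) <|
  assign a (var 12)

/-- Repeated addition keeps the assignment gentle, at the price of work linear in |v|. The
multiplicand may be huge, only the multiplier has to be polynomially bounded. There is one loop for
each sign of `v`, at least one of them empty; array 12 is scratch space, so `e` must not depend on
its cell 0. -/
theorem Det.mulBy {a : ℕ} {e : Expr} {s : Memory} (v : ℤ) (Z : ℕ) (ha : a ≠ 12)
    (he : ∀ r : ℤ, e.val x y (s.set 12 0 r) = v) (hv : v.natAbs ≤ Z) :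
    Det x y (Prog.mulBy a e) s (fun s' => s' a 0 = s a 0 * v) (4 * Z + 4) := by
  have h0 : Det x y (assign 12 (.lit 0)) s (fun t => t = s.set 12 0 0) 1 := .write rfl
  refine (h0.seq (w' := 4 * Z + 3) ?_).weaken (by omega)
  rintro s' rfl -
  have h1 : Det x y (.loop e (assign 12 (.add (var 12) (var a)))) (s.set 12 0 0)
      (fun t => t = s.set 12 0 (v.toNat * s a 0)) (2 * v.toNat + 1) := by
    refine (Det.loop (fun k t => t = s.set 12 0 (k * s a 0)) v.toNat (by rw [he])
      (by simp) (w := 1) ?_).weaken (by omega)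
    rintro i hi s' - rfl
    refine .write ?_
    funext b j
    simp only [Expr.val, set_apply]
    split_ifs <;> simp_all
    ring
  refine (h1.seq (w' := 2 * (-v).toNat + 2) ?_).weaken (by omega)
  rintro s' rfl -
  have h2 : Det x y (.loop (.sub (.lit 0) e) (assign 12 (.sub (var 12) (var a))))
      (s.set 12 0 (v.toNat * s a 0))
      (fun t => t = s.set 12 0 (v * s a 0)) (2 * (-v).toNat + 1) := by
    refine ((Det.loop (fun k t => t = s.set 12 0 ((v.toNat - k) * s a 0)) (-v).toNat
      (by simp [Expr.val, he]) (by simp) (w := 1) ?_).weaken (by omega)).mono ?_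
    · rintro i hi s' - rfl
      refine .write ?_
      funext b j
      simp only [Expr.val, set_apply]
      split_ifs <;> simp_all
      ring
    · rintro s' rfl -
      rw [Int.toNat_sub_toNat_neg]
  refine (h2.seq (w' := 1) ?_)
  rintro s' rfl -
  refine .write ?_
  simp [Expr.val, mul_comm]

end Prog

/-! ### Components of spanning subgraphs -/

namespace Multigraph

variable {G : Multigraph}

theorem spanning_adj {A : Finset (Fin G.m)} {u v : Fin G.n} :
    (G.spanning A).Adj u v ↔ u ≠ v ∧ ∃ j ∈ A, G.ends j = (u, v) ∨ G.ends j = (v, u) := by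
  simp only [spanning, SimpleGraph.fromRel_adj]
  constructor
  · rintro ⟨h, ⟨j, hj, h1⟩ | ⟨j, hj, h1⟩⟩
    exacts [⟨h, j, hj, .inl h1⟩, ⟨h, j, hj, .inr h1⟩]
  · rintro ⟨h, j, hj, h1 | h1⟩
    exacts [⟨h, .inl ⟨j, hj, h1⟩⟩, ⟨h, .inr ⟨j, hj, h1⟩⟩]

theorem spanning_mono {A B : Finset (Fin G.m)} (h : A ⊆ B) : G.spanning A ≤ G.spanning B := by
  intro u v
  simp only [spanning_adj]
  rintro ⟨h1, j, hj, h2⟩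
  exact ⟨h1, j, h hj, h2⟩

theorem reachable_ends {A : Finset (Fin G.m)} {j : Fin G.m} (hj : j ∈ A) :
    (G.spanning A).Reachable (G.ends j).1 (G.ends j).2 := by
  by_cases h : (G.ends j).1 = (G.ends j).2
  · rw [h]
  · exact SimpleGraph.Adj.reachable (spanning_adj.2 ⟨h, j, hj, .inl rfl⟩)

/-- A property shared by the ends of the edges in `A` is shared by connected vertices. -/
theorem eq_of_reachable {A : Finset (Fin G.m)} {α : Type*} (f : Fin G.n → α)
    (hf : ∀ j ∈ A, f (G.ends j).1 = f (G.ends j).2) {u v : Fin G.n}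
    (h : (G.spanning A).Reachable u v) : f u = f v := by
  obtain ⟨p⟩ := h
  induction p with
  | nil => rfl
  | cons hadj _ ih =>
    rw [← ih]
    obtain ⟨-, j, hj, h | h⟩ := spanning_adj.1 hadj
    · simpa [h] using hf j hj
    · simpa [h] using (hf j hj).symm

/-- `ℓ` maps each vertex to a representative of its component in `(V, B)`. -/
def Labels (G : Multigraph) (B : Finset (Fin G.m)) (ℓ : Fin G.n → Fin G.n) : Prop :=
  (∀ u v, ℓ u = ℓ v ↔ (G.spanning B).Reachable u v) ∧ ∀ u, ℓ (ℓ u) = ℓ u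

/-- The labels after the addition of the edge `j`. -/
def mergeLabels (G : Multigraph) (j : Fin G.m) (ℓ : Fin G.n → Fin G.n) : Fin G.n → Fin G.n :=
  fun v => if ℓ v = ℓ (G.ends j).1 then ℓ (G.ends j).2 else ℓ v

theorem labels_empty : G.Labels ∅ id := by
  refine ⟨fun u v => ⟨fun h => ?_, fun h => eq_of_reachable id (by simp) h⟩, fun _ => rfl⟩
  rw [show u = v from h]

theorem Labels.insert {B : Finset (Fin G.m)} {ℓ : Fin G.n → Fin G.n} (h : G.Labels B ℓ)
    (j : Fin G.m) : G.Labels (insert j B) (G.mergeLabels j ℓ) := by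
  obtain ⟨h1, h2⟩ := h
  have hmono : ∀ {u v}, ℓ u = ℓ v → (G.spanning (Insert.insert j B)).Reachable u v := fun h =>
    ((h1 _ _).1 h).mono (spanning_mono (Finset.subset_insert _ _))
  have hj := reachable_ends (G := G) (Finset.mem_insert_self j B)
  refine ⟨fun u v => ⟨fun h => ?_, fun h => eq_of_reachable _ ?_ h⟩, fun u => ?_⟩
  · simp only [mergeLabels] at h
    split_ifs at h with hu hv hv
    · exact hmono (hu.trans hv.symm)
    · exact ((hmono hu).trans hj).trans (hmono h)
    · exact (hmono h).trans (hj.symm.trans (hmono hv.symm))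
    · exact hmono h
  · intro i hi
    rcases Finset.mem_insert.1 hi with rfl | hi
    · simp [mergeLabels]
    · simp only [mergeLabels, (h1 _ _).2 (reachable_ends hi)]
  · clear h1 hmono hj
    simp only [mergeLabels]
    split_ifs <;> simp_all

theorem exists_labels (G : Multigraph) (B : Finset (Fin G.m)) : ∃ ℓ, G.Labels B ℓ := by
  induction B using Finset.induction with
  | empty => exact ⟨_, labels_empty⟩
  | insert j B _ ih =>
    obtain ⟨ℓ, h⟩ := ih
    exact ⟨_, h.insert j⟩

/-- The labelling is idempotent and constant exactly on components, so every component has one fixed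
point. This is how the program counts components. -/
theorem Labels.numComponents_eq {B : Finset (Fin G.m)} {ℓ : Fin G.n → Fin G.n}
    (h : G.Labels B ℓ) : G.numComponents B = (Finset.univ.filter fun u => ℓ u = u).card := by
  have e : (G.spanning B).ConnectedComponent ≃ {u // ℓ u = u} :=
    { toFun := fun c => c.lift (fun v => ⟨ℓ v, h.2 v⟩)
        (fun u v p _ => Subtype.ext ((h.1 u v).2 ⟨p⟩))
      invFun := fun u => (G.spanning B).connectedComponentMk u
      left_inv := fun c => by
        induction c using SimpleGraph.ConnectedComponent.ind with
        | h v => exact SimpleGraph.ConnectedComponent.sound ((h.1 _ _).1 (h.2 v))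
      right_inv := fun u => Subtype.ext u.2 }
  rw [numComponents, Nat.card_congr e, Nat.card_eq_fintype_card, Fintype.card_subtype]

/-- The ends of the edge `j` lie in different components of `(V, B)`. -/
def Crosses (G : Multigraph) (B : Finset (Fin G.m)) (j : Fin G.m) : Prop :=
  ¬(G.spanning B).Reachable (G.ends j).1 (G.ends j).2

theorem numComponents_insert_of_not_crosses {B : Finset (Fin G.m)} {j : Fin G.m}
    (hj : ¬G.Crosses B j) : G.numComponents (insert j B) = G.numComponents B := by
  obtain ⟨ℓ, h⟩ := G.exists_labels B
  rw [h.numComponents_eq, (h.insert j).numComponents_eq]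
  have h1 : ℓ (G.ends j).1 = ℓ (G.ends j).2 := (h.1 _ _).2 (not_not.1 hj)
  congr 1
  ext u
  rw [Finset.mem_filter, Finset.mem_filter]
  simp only [mergeLabels, Finset.mem_univ, true_and]
  split_ifs with h2
  · rw [← h1, h2]
  · rfl

theorem numComponents_insert_of_crosses {B : Finset (Fin G.m)} {j : Fin G.m}
    (hj : G.Crosses B j) : G.numComponents (insert j B) + 1 = G.numComponents B := by
  obtain ⟨ℓ, h⟩ := G.exists_labels B
  rw [h.numComponents_eq, (h.insert j).numComponents_eq]
  have h1 : ℓ (G.ends j).1 ≠ ℓ (G.ends j).2 := fun h' => hj ((h.1 _ _).1 h')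
  -- The merger relabels the component of the first end, so exactly its representative stops being a
  -- fixed point.
  have h2 : (Finset.univ.filter fun u => G.mergeLabels j ℓ u = u) =
      (Finset.univ.filter fun u => ℓ u = u).erase (ℓ (G.ends j).1) := by
    ext u
    rw [Finset.mem_erase, Finset.mem_filter, Finset.mem_filter]
    simp only [mergeLabels, Finset.mem_univ, true_and]
    split_ifs with h3
    · constructor
      · rintro rfl
        exact absurd (h3.symm.trans (h.2 _)) h1
      · rintro ⟨h4, h5⟩
        exact absurd (h5.symm.trans h3) h4
    · refine ⟨fun h4 => ⟨?_, h4⟩, fun h4 => h4.2⟩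
      rintro rfl
      exact h3 (h.2 _)
  rw [h2, Finset.card_erase_add_one]
  simp [h.2]

theorem numComponents_empty (G : Multigraph) : G.numComponents ∅ = G.n := by
  rw [labels_empty.numComponents_eq]; simp

theorem not_crosses_of_mem {B : Finset (Fin G.m)} {j : Fin G.m} (hj : j ∈ B) : ¬G.Crosses B j :=
  not_not.2 (reachable_ends hj)

theorem numComponents_insert_le (B : Finset (Fin G.m)) (j : Fin G.m) :
    G.numComponents (insert j B) ≤ G.numComponents B ∧
      G.numComponents B ≤ G.numComponents (insert j B) + 1 := by
  by_cases h : G.Crosses B j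
  · have := numComponents_insert_of_crosses h; omega
  · have := numComponents_insert_of_not_crosses h; omega

theorem n_le_card_add_numComponents (A : Finset (Fin G.m)) :
    G.n ≤ A.card + G.numComponents A := by
  induction A using Finset.induction with
  | empty => simp [numComponents_empty]
  | insert j B hj ih =>
    have := numComponents_insert_le B j
    rw [Finset.card_insert_of_notMem hj]; omega

theorem numComponents_le (A : Finset (Fin G.m)) : G.numComponents A ≤ G.n := by
  induction A using Finset.induction with
  | empty => simp [numComponents_empty]
  | insert j B hj ih => exact (numComponents_insert_le B j).1.trans ih

theorem numComponents_pos (hn : 1 ≤ G.n) (A : Finset (Fin G.m)) : 1 ≤ G.numComponents A := by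
  obtain ⟨ℓ, h⟩ := G.exists_labels A
  rw [h.numComponents_eq]
  exact Finset.card_pos.2 ⟨ℓ ⟨0, hn⟩, by simp [h.2]⟩

theorem one_lt_numComponents_of_not_reachable {A : Finset (Fin G.m)} {u v : Fin G.n}
    (h : ¬(G.spanning A).Reachable u v) : 1 < G.numComponents A := by
  obtain ⟨ℓ, hℓ⟩ := G.exists_labels A
  rw [hℓ.numComponents_eq, Finset.one_lt_card]
  exact ⟨ℓ u, by simp [hℓ.2], ℓ v, by simp [hℓ.2], fun h' => h ((hℓ.1 _ _).1 h')⟩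

/-! ### Cuts and components. -/

/-- The edges with exactly one end in `S`. -/
def cut (G : Multigraph) (S : Finset (Fin G.n)) : Finset (Fin G.m) :=
  Finset.univ.filter fun j => ¬((G.ends j).1 ∈ S ↔ (G.ends j).2 ∈ S)

theorem card_cut (S : Finset (Fin G.n)) : (G.cut S).card = G.cutValue S := rfl

theorem one_lt_numComponents_of_disjoint_cut {A : Finset (Fin G.m)} {S : Finset (Fin G.n)}
    (hS : S.Nonempty) (hS' : S ≠ Finset.univ) (hA : Disjoint A (G.cut S)) :
    1 < G.numComponents A := by
  obtain ⟨u, hu⟩ := hS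
  obtain ⟨v, hv⟩ : ∃ v, v ∉ S := by
    by_contra! h
    exact hS' (Finset.eq_univ_iff_forall.2 h)
  refine one_lt_numComponents_of_not_reachable (u := u) (v := v) fun h => ?_
  have := eq_of_reachable (fun w => w ∈ S) (fun j hj => ?_) h
  · exact hv (this ▸ hu)
  · by_contra h'
    exact Finset.disjoint_left.1 hA hj (by simpa [cut] using h')

open Classical in
/-- If all cuts have value at least `c`, then a spanning subgraph with `r ≥ 2` components
misses at least `c r / 2` edges between different components. -/
theorem mul_numComponents_le {c : ℕ} (hc : ∀ S : Finset (Fin G.n), S.Nonempty →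
    S ≠ Finset.univ → c ≤ G.cutValue S) {B : Finset (Fin G.m)} (hB : 1 < G.numComponents B) :
    c * G.numComponents B ≤ 2 * (Finset.univ.filter fun j => G.Crosses B j).card := by
  obtain ⟨ℓ, h⟩ := G.exists_labels B
  rw [h.numComponents_eq] at hB ⊢
  set F := Finset.univ.filter fun u => ℓ u = u with hF
  have h1 : ∀ r ∈ F, c ≤ G.cutValue (Finset.univ.filter fun v => ℓ v = r) := by
    intro r hr
    have hr' : ℓ r = r := by simpa [hF] using hr
    refine hc _ ⟨r, by simpa using hr'⟩ fun hu => ?_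
    obtain ⟨r', hr1, hr2⟩ := Finset.exists_mem_ne hB r
    have h3 : r' ∈ Finset.univ.filter fun v => ℓ v = r := by rw [hu]; exact Finset.mem_univ _
    have h4 : ℓ r' = r' := by simpa [hF] using hr1
    have h5 : ℓ r' = r := by simpa using h3
    exact hr2 (h4.symm.trans h5)
  -- Double counting: the cut around each component has at least `c` edges, and an edge lies in at
  -- most two of these cuts, and in none if its ends are in the same component.
  calc c * F.card = ∑ r ∈ F, c := by rw [Finset.sum_const, smul_eq_mul, mul_comm]
    _ ≤ ∑ r ∈ F, G.cutValue (Finset.univ.filter fun v => ℓ v = r) := Finset.sum_le_sum h1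
    _ = ∑ r ∈ F, ∑ j : Fin G.m,
        if ¬(ℓ (G.ends j).1 = r ↔ ℓ (G.ends j).2 = r) then 1 else 0 := by
      refine Finset.sum_congr rfl fun r _ => ?_
      rw [cutValue, Finset.card_filter]
      simp
    _ = ∑ j : Fin G.m, ∑ r ∈ F,
        if ¬(ℓ (G.ends j).1 = r ↔ ℓ (G.ends j).2 = r) then 1 else 0 := Finset.sum_comm
    _ ≤ ∑ j : Fin G.m, if G.Crosses B j then 2 else 0 := by
      refine Finset.sum_le_sum fun j _ => ?_
      split_ifs with hj
      · rw [← Finset.card_filter]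
        refine (Finset.card_le_card (t := {ℓ (G.ends j).1, ℓ (G.ends j).2}) ?_).trans
          Finset.card_le_two
        intro r hr
        simp only [Finset.mem_filter] at hr
        simp only [Finset.mem_insert, Finset.mem_singleton]
        tauto
      · have h6 : ℓ (G.ends j).1 = ℓ (G.ends j).2 := (h.1 _ _).2 (not_not.1 hj)
        simp [h6]
    _ = 2 * (Finset.univ.filter fun j => G.Crosses B j).card := by
      rw [← Finset.sum_filter, Finset.sum_const, smul_eq_mul, mul_comm]

/-- No edge of G crosses between components of G itself, so the lower bound for crossing edges
excludes two components. -/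
theorem numComponents_univ (hn : 1 ≤ G.n) {c : ℕ} (hc0 : 0 < c)
    (hc : ∀ S : Finset (Fin G.n), S.Nonempty → S ≠ Finset.univ → c ≤ G.cutValue S) :
    G.numComponents Finset.univ = 1 := by
  classical
  by_contra h
  have h1 := numComponents_pos hn (Finset.univ : Finset (Fin G.m))
  have h2 := mul_numComponents_le hc (B := Finset.univ) (by omega)
  rw [Finset.filter_false_of_mem (fun j _ => not_crosses_of_mem (Finset.mem_univ j))] at h2
  simp at h2
  omega

end Multigraph

/-! ### Random spanning subgraphs -/

namespace Multigraph

variable {G : Multigraph}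

/-- The expectation of `φ (B ∪ R)`, where `R` contains each edge in the list independently with
probability `1 - ρ`. -/
def perc (ρ : ℝ) : List (Fin G.m) → (Finset (Fin G.m) → ℝ) → Finset (Fin G.m) → ℝ
  | [], φ => φ
  | j :: l, φ => fun B => ρ * perc ρ l φ B + (1 - ρ) * perc ρ l φ (insert j B)

theorem perc_add (ρ : ℝ) (l : List (Fin G.m)) (φ ψ : Finset (Fin G.m) → ℝ)
    (B : Finset (Fin G.m)) :
    perc ρ l (fun A => φ A + ψ A) B = perc ρ l φ B + perc ρ l ψ B := by
  induction l generalizing B with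
  | nil => rfl
  | cons j l ih => simp only [perc, ih]; ring

theorem perc_mul_left (ρ : ℝ) (l : List (Fin G.m)) (r : ℝ) (φ : Finset (Fin G.m) → ℝ)
    (B : Finset (Fin G.m)) : perc ρ l (fun A => r * φ A) B = r * perc ρ l φ B := by
  induction l generalizing B with
  | nil => rfl
  | cons j l ih => simp only [perc, ih]; ring

theorem perc_sub (ρ : ℝ) (l : List (Fin G.m)) (φ ψ : Finset (Fin G.m) → ℝ)
    (B : Finset (Fin G.m)) :
    perc ρ l (fun A => φ A - ψ A) B = perc ρ l φ B - perc ρ l ψ B := by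
  induction l generalizing B with
  | nil => rfl
  | cons j l ih => simp only [perc, ih]; ring

theorem perc_sum {ι : Type*} (ρ : ℝ) (l : List (Fin G.m)) (s : Finset ι)
    (φ : ι → Finset (Fin G.m) → ℝ) (B : Finset (Fin G.m)) :
    perc ρ l (fun A => ∑ i ∈ s, φ i A) B = ∑ i ∈ s, perc ρ l (φ i) B := by
  induction l generalizing B with
  | nil => rfl
  | cons j l ih => simp only [perc, ih, Finset.mul_sum, Finset.sum_add_distrib]

theorem perc_mono {ρ : ℝ} (h0 : 0 ≤ ρ) (h1 : ρ ≤ 1) (l : List (Fin G.m))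
    {φ ψ : Finset (Fin G.m) → ℝ} (h : ∀ A, φ A ≤ ψ A) (B : Finset (Fin G.m)) :
    perc ρ l φ B ≤ perc ρ l ψ B := by
  induction l generalizing B with
  | nil => exact h B
  | cons j l ih =>
    simp only [perc]
    have := sub_nonneg.2 h1
    gcongr <;> exact ih _

theorem perc_const (ρ r : ℝ) (l : List (Fin G.m)) (B : Finset (Fin G.m)) :
    perc ρ l (fun _ => r) B = r := by
  induction l generalizing B with
  | nil => rfl
  | cons j l ih => simp only [perc, ih]; ring

theorem perc_one (l : List (Fin G.m)) (φ : Finset (Fin G.m) → ℝ) : perc 1 l φ = φ := by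
  induction l with
  | nil => rfl
  | cons j l ih => funext B; simp only [perc, ih]; ring

theorem perc_nonneg {ρ : ℝ} (h0 : 0 ≤ ρ) (h1 : ρ ≤ 1) (l : List (Fin G.m))
    {φ : Finset (Fin G.m) → ℝ} (h : ∀ A, 0 ≤ φ A) (B : Finset (Fin G.m)) :
    0 ≤ perc ρ l φ B := by
  have := perc_mono h0 h1 l h B
  rwa [perc_const] at this

theorem abs_perc_le {ρ : ℝ} (h0 : 0 ≤ ρ) (h1 : ρ ≤ 1) (l : List (Fin G.m))
    {φ ψ : Finset (Fin G.m) → ℝ} (h : ∀ A, |φ A| ≤ ψ A) (B : Finset (Fin G.m)) :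
    |perc ρ l φ B| ≤ perc ρ l ψ B := by
  rw [abs_le]
  constructor
  · have := perc_mono h0 h1 l (fun A => (abs_le.1 (h A)).1) B
    have e := perc_mul_left ρ l (-1) ψ B
    simp only [neg_one_mul] at e
    rwa [e] at this
  · exact perc_mono h0 h1 l (fun A => (abs_le.1 (h A)).2) B

theorem perc_insert (ρ : ℝ) (l : List (Fin G.m)) (φ : Finset (Fin G.m) → ℝ) (j : Fin G.m)
    (B : Finset (Fin G.m)) : perc ρ l (fun A => φ (insert j A)) B = perc ρ l φ (insert j B) := by
  induction l generalizing B with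
  | nil => rfl
  | cons i l ih => simp only [perc, ih, Finset.insert_comm i j]

/-- An edge is absent after two independent rounds if it is absent from both, so failure
probabilities multiply. Consequently several splitting levels amount to one percolation. -/
theorem perc_perc (ρ ρ' : ℝ) (l : List (Fin G.m)) (φ : Finset (Fin G.m) → ℝ) :
    perc ρ l (perc ρ' l φ) = perc (ρ * ρ') l φ := by
  induction l with
  | nil => rfl
  | cons j l ih =>
    funext B
    have h : ∀ A, perc ρ l (fun B => ρ' * perc ρ' l φ B + (1 - ρ') * perc ρ' l φ (insert j B)) A =
        ρ' * perc (ρ * ρ') l φ A + (1 - ρ') * perc (ρ * ρ') l φ (insert j A) := by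
      intro A
      rw [perc_add, perc_mul_left, perc_mul_left, perc_insert, ih]
    simp only [perc, h, Finset.insert_idem]
    ring

theorem perc_eq_sum (ρ : ℝ) (l : List (Fin G.m)) (hl : l.Nodup) (φ : Finset (Fin G.m) → ℝ)
    (B : Finset (Fin G.m)) : perc ρ l φ B = ∑ R ∈ l.toFinset.powerset,
      ρ ^ (l.length - R.card) * (1 - ρ) ^ R.card * φ (B ∪ R) := by
  induction l generalizing B with
  | nil => simp [perc]
  | cons j l ih =>
    rw [List.nodup_cons] at hl
    have hj : j ∉ l.toFinset := by simpa using hl.1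
    have hcard : ∀ R ∈ l.toFinset.powerset, R.card ≤ l.length := fun R hR =>
      (Finset.card_le_card (Finset.mem_powerset.1 hR)).trans (List.toFinset_card_le l)
    simp only [perc, ih hl.2, List.toFinset_cons, Finset.sum_powerset_insert hj, Finset.mul_sum]
    congr 1 <;> refine Finset.sum_congr rfl fun R hR => ?_
    · rw [List.length_cons, Nat.succ_sub (hcard R hR), pow_succ]; ring
    · have hjR : j ∉ R := fun h => hj (Finset.mem_powerset.1 hR h)
      rw [List.length_cons, Finset.card_insert_of_notMem hjR, Nat.add_sub_add_right, pow_succ,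
        Finset.insert_union, Finset.union_insert]
      ring

theorem perc_empty_eq_sum (ρ : ℝ) (φ : Finset (Fin G.m) → ℝ) :
    perc ρ (List.finRange G.m) φ ∅ = ∑ A : Finset (Fin G.m),
      ρ ^ (G.m - A.card) * (1 - ρ) ^ A.card * φ A := by
  rw [perc_eq_sum _ _ (List.nodup_finRange _), List.toFinset_finRange, Finset.powerset_univ,
    List.length_finRange]
  simp

/-- Russo's formula. -/
theorem hasDerivAt_perc {ρ : ℝ} (hρ : ρ ≠ 0) (l : List (Fin G.m)) (φ : Finset (Fin G.m) → ℝ)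
    (B : Finset (Fin G.m)) : HasDerivAt (fun ρ => perc ρ l φ B)
      (perc ρ l (fun A => (l.map fun j => φ A - φ (insert j A)).sum) B / ρ) ρ := by
  induction l generalizing B with
  | nil => simpa [perc] using hasDerivAt_const ρ (φ B)
  | cons j l ih =>
    have h := ((hasDerivAt_id ρ).mul (ih B)).add
      (((hasDerivAt_id ρ).const_sub 1).mul (ih (insert j B)))
    refine h.congr_deriv ?_
    -- When `j` is already present its difference vanishes (`Finset.insert_idem`). Only the event
    -- that `j` is absent, of probability ρ, contributes, hence the division by ρ.
    simp only [perc, List.map_cons, List.sum_cons, perc_add, perc_sub, perc_insert, id,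
      Finset.insert_idem]
    field_simp
    ring

/-! ### Numbers of components under percolation. -/

/-- The number of `k`-sets of components. -/
noncomputable def choose (k : ℕ) (B : Finset (Fin G.m)) : ℝ := ((G.numComponents B).choose k : ℝ)

/-- With κ components, a crossing edge lowers binom(κ,k) by binom(κ-1,k-1) = (k/κ) binom(κ,k), and
there are at least cκ/2 crossing edges when κ ≥ 2. If κ ≤ 1, everything vanishes because k ≥ 2. -/
theorem mul_choose_le_sum {c : ℕ} (hc : ∀ S : Finset (Fin G.n), S.Nonempty →
    S ≠ Finset.univ → c ≤ G.cutValue S) {k : ℕ} (hk : 2 ≤ k) (B : Finset (Fin G.m)) :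
    (k * c / 2 : ℝ) * choose k B ≤
      ((List.finRange G.m).map fun j => choose k B - choose k (insert j B)).sum := by
  classical
  rw [← List.ofFn_eq_map, List.sum_ofFn]
  by_cases hB : 1 < G.numComponents B
  · obtain ⟨r, hr⟩ : ∃ r, G.numComponents B = r + 1 := ⟨_, (Nat.sub_add_cancel hB.le).symm⟩
    obtain ⟨i, rfl⟩ : ∃ i, k = i + 1 := ⟨k - 1, by omega⟩
    have h1 := mul_numComponents_le hc hB
    have h2 : ∀ j : Fin G.m, choose (i + 1) B - choose (i + 1) (insert j B) =
        if G.Crosses B j then (r.choose i : ℝ) else 0 := by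
      intro j
      simp only [choose]
      split_ifs with h
      · have h3 := numComponents_insert_of_crosses h
        rw [hr, show G.numComponents (insert j B) = r by omega, Nat.choose_succ_succ]
        push_cast; ring
      · rw [numComponents_insert_of_not_crosses h]; ring
    simp only [h2]
    rw [← Finset.sum_filter, Finset.sum_const, nsmul_eq_mul]
    have h4 : ((r + 1 : ℕ) : ℝ) * (r.choose i) = ((r + 1).choose (i + 1) : ℝ) * (i + 1 : ℕ) := by
      exact_mod_cast Nat.add_one_mul_choose_eq r i
    have h5 : (c : ℝ) * (r + 1 : ℕ) ≤ 2 * ((Finset.univ.filter fun j => G.Crosses B j).card : ℝ) := by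
      rw [← hr]; exact_mod_cast h1
    rw [choose, hr]
    have h6 : (0 : ℝ) ≤ r.choose i := Nat.cast_nonneg _
    calc (((i + 1 : ℕ) : ℝ) * c / 2) * ((r + 1).choose (i + 1) : ℝ)
        = c / 2 * (((r + 1).choose (i + 1) : ℝ) * (i + 1 : ℕ)) := by ring
      _ = (c * (r + 1 : ℕ)) / 2 * r.choose i := by rw [← h4]; ring
      _ ≤ _ := by gcongr; linarith
  · have h1 : ∀ A : Finset (Fin G.m), G.numComponents A ≤ 1 → choose k A = 0 := fun A hA => by
      rw [choose, Nat.choose_eq_zero_of_lt (by omega), Nat.cast_zero]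
    rw [h1 B (by omega)]
    refine le_of_eq ?_
    rw [mul_zero]
    refine (Finset.sum_eq_zero fun j _ => ?_).symm
    rw [h1 _ ((numComponents_insert_le B j).1.trans (by omega)), sub_zero]

/-- The expected number of `k`-sets of components is at most what it is for a graph in which
all components have degree exactly `c`. -/
theorem perc_choose_le {c : ℕ} (hc : ∀ S : Finset (Fin G.n), S.Nonempty →
    S ≠ Finset.univ → c ≤ G.cutValue S) {k : ℕ} (hk : 2 ≤ k) {q : ℝ} (hq : 0 < q) (hq1 : q ≤ 1)
    (B : Finset (Fin G.m)) :
    perc q (List.finRange G.m) (choose k) B ≤ (q ^ ((c : ℝ) / 2)) ^ k * choose k B := by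
  set α : ℝ := k * c / 2 with hα
  set l := List.finRange G.m
  have hd : ∀ ρ : ℝ, 0 < ρ → HasDerivAt (fun ρ => ρ ^ (-α) * perc ρ l (choose k) B)
      (ρ ^ (-α) / ρ * (perc ρ l (fun A => (l.map fun j => choose k A - choose k (insert j A)).sum) B
        - α * perc ρ l (choose k) B)) ρ := by
    intro ρ hρ
    refine ((Real.hasDerivAt_rpow_const (.inl hρ.ne')).mul
      (hasDerivAt_perc hρ.ne' l (choose k) B)).congr_deriv ?_
    rw [Real.rpow_sub_one hρ.ne']
    field_simp
    ring
  -- Russo's formula and `mul_choose_le_sum` give E' ≥ (α/ρ) E for the expectation E at failure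
  -- probability ρ, so ρ^(-α) E increases. At ρ = 1 no edge is added and E is the value at `B`.
  have hmono : MonotoneOn (fun ρ => ρ ^ (-α) * perc ρ l (choose k) B) (Set.Icc q 1) := by
    refine monotoneOn_of_deriv_nonneg (convex_Icc q 1)
      (fun ρ hρ => (hd ρ (hq.trans_le hρ.1)).continuousAt.continuousWithinAt)
      (fun ρ hρ => ?_) fun ρ hρ => ?_
    · rw [interior_Icc] at hρ
      exact (hd ρ (hq.trans hρ.1)).differentiableAt.differentiableWithinAt
    · rw [interior_Icc] at hρ
      have h0 := hq.trans hρ.1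
      rw [(hd ρ h0).deriv]
      refine mul_nonneg (by positivity) (sub_nonneg.2 ?_)
      rw [← perc_mul_left]
      exact perc_mono h0.le hρ.2.le _ (mul_choose_le_sum hc hk) B
  have h := hmono (Set.left_mem_Icc.2 hq1) (Set.right_mem_Icc.2 hq1) hq1
  simp only [Real.one_rpow, one_mul, perc_one] at h
  have e : (q ^ ((c : ℝ) / 2)) ^ k = q ^ α := by
    rw [← Real.rpow_natCast, ← Real.rpow_mul hq.le, hα]
    congr 1; ring
  rw [Real.rpow_neg hq.le] at h
  rw [e]
  have hp : 0 < q ^ α := Real.rpow_pos_of_pos hq α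
  calc _ = q ^ α * ((q ^ α)⁻¹ * perc q l (choose k) B) := by field_simp
    _ ≤ _ := by gcongr

-- The term k = κ of the sum of R^k binom(κ,k) over k ≥ i is R^κ, so the sum dominates the truncated
-- power. Its terms have expectations at most (n R q^(c/2))^k, a geometric series of ratio at most
-- 1/2.
open Classical in
theorem perc_pow_numComponents_le {c : ℕ} (hc : ∀ S : Finset (Fin G.n), S.Nonempty →
    S ≠ Finset.univ → c ≤ G.cutValue S) {i : ℕ} (hi : 2 ≤ i) {q : ℝ} (hq : 0 < q) (hq1 : q ≤ 1)
    {R : ℝ} (hR : 0 ≤ R) (hs : G.n * R * q ^ ((c : ℝ) / 2) ≤ 1 / 2) :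
    perc q (List.finRange G.m)
      (fun A => if i ≤ G.numComponents A then R ^ G.numComponents A else 0) ∅ ≤
      2 * (G.n * R * q ^ ((c : ℝ) / 2)) ^ i := by
  have hz : 0 ≤ q ^ ((c : ℝ) / 2) := Real.rpow_nonneg hq.le _
  set z := q ^ ((c : ℝ) / 2)
  have hs0 : 0 ≤ G.n * R * z := by positivity
  calc _ ≤ perc q (List.finRange G.m)
        (fun A => ∑ k ∈ Finset.Ico i (G.n + 1), R ^ k * choose k A) ∅ := by
        refine perc_mono hq.le hq1 _ (fun A => ?_) ∅
        have h0 : ∀ k ∈ Finset.Ico i (G.n + 1), 0 ≤ R ^ k * choose k A := fun k _ =>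
          mul_nonneg (by positivity) (Nat.cast_nonneg _)
        split_ifs with h
        · refine le_trans ?_ (Finset.single_le_sum h0 (Finset.mem_Ico.2
            ⟨h, Nat.lt_succ_of_le (numComponents_le A)⟩))
          simp [choose]
        · exact Finset.sum_nonneg h0
    _ = ∑ k ∈ Finset.Ico i (G.n + 1), R ^ k * perc q (List.finRange G.m) (choose k) ∅ := by
        simp only [perc_sum, perc_mul_left]
    _ ≤ ∑ k ∈ Finset.Ico i (G.n + 1), (G.n * R * z) ^ k := by
        refine Finset.sum_le_sum fun k hk => ?_
        have h1 := perc_choose_le hc (hi.trans (Finset.mem_Ico.1 hk).1) hq hq1 ∅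
        have h2 : choose k (∅ : Finset (Fin G.m)) ≤ (G.n : ℝ) ^ k := by
          rw [choose, numComponents_empty]
          exact_mod_cast Nat.choose_le_pow _ _
        calc R ^ k * perc q (List.finRange G.m) (choose k) ∅ ≤ R ^ k * (z ^ k * G.n ^ k) := by
              gcongr
              exact h1.trans (by gcongr)
          _ = _ := by rw [mul_pow, mul_pow]; ring
    _ ≤ (G.n * R * z) ^ i / (1 - G.n * R * z) := geom_sum_Ico_le_of_lt_one hs0 (by linarith)
    _ ≤ 2 * (G.n * R * z) ^ i := by
        rw [div_le_iff₀ (by linarith)]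
        have : 0 ≤ (G.n * R * z) ^ i := by positivity
        nlinarith

open Classical in
/-- The graph becomes disconnected at least with the probability that a given cut fails. -/
theorem pow_cutValue_le_perc {S : Finset (Fin G.n)} (hS : S.Nonempty) (hS' : S ≠ Finset.univ)
    {q : ℝ} (hq : 0 ≤ q) (hq1 : q ≤ 1) :
    q ^ G.cutValue S ≤ perc q (List.finRange G.m)
      (fun A => if 2 ≤ G.numComponents A then 1 else 0) ∅ := by
  rw [perc_empty_eq_sum]
  set U := Finset.univ \ G.cut S with hU
  have hcard : U.card + G.cutValue S = G.m := by
    have := Finset.card_sdiff_add_card_eq_card (Finset.subset_univ (G.cut S))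
    rw [card_cut] at this
    rw [this]; simp
  -- The event that A avoids the cut: all cut edges fail, while the edges in `U` are arbitrary,
  -- which is the binomial expansion of 1.
  calc q ^ G.cutValue S = q ^ G.cutValue S * ((1 - q) + q) ^ U.card := by simp
    _ = ∑ A ∈ U.powerset, q ^ (G.m - A.card) * (1 - q) ^ A.card := by
        rw [← Finset.sum_pow_mul_eq_add_pow, Finset.mul_sum]
        refine Finset.sum_congr rfl fun A hA => ?_
        have := Finset.card_le_card (Finset.mem_powerset.1 hA)
        rw [show G.m - A.card = G.cutValue S + (U.card - A.card) by omega, pow_add]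
        ring
    _ ≤ _ := by
        have h1 := sub_nonneg.2 hq1
        refine le_trans (Finset.sum_le_sum fun A hA => ?_)
          (Finset.sum_le_sum_of_subset_of_nonneg (Finset.subset_univ U.powerset)
            fun A _ _ => ?_)
        · have h2 : 2 ≤ G.numComponents A := by
            refine one_lt_numComponents_of_disjoint_cut hS hS' ?_
            exact Finset.disjoint_of_subset_left (Finset.mem_powerset.1 hA) Finset.sdiff_disjoint
          rw [if_pos h2, mul_one]
        · positivity

end Multigraph

/-! ### Adaptive multilevel splitting -/

namespace Multigraph

open CoinTree

variable {G : Multigraph}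

/-- A coin that shows `true` with probability `2 ^ (-s)`. -/
def coin (s : ℕ) (b : Bool) : CoinTree Bool :=
  iter (fun b => .node fun b' => .ret (b && b')) s b

/-- Add the first edge in the list with probability `2 ^ (-s)`. -/
def edgeStep (s : ℕ) : List (Fin G.m) × Finset (Fin G.m) →
    CoinTree (List (Fin G.m) × Finset (Fin G.m))
  | ([], B) => .ret ([], B)
  | (j :: l, B) => (coin s true).bind fun b => .ret (l, if b then insert j B else B)

/-- Add each edge with probability `2 ^ (-s)`. -/
def mutate (s : ℕ) (B : Finset (Fin G.m)) : CoinTree (List (Fin G.m) × Finset (Fin G.m)) :=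
  iter (edgeStep s) G.m (List.finRange G.m, B)

open Classical in
/-- Mutate the first member of the population, and keep it if it remains disconnected. -/
noncomputable def popStep (s : ℕ) : List (Finset (Fin G.m)) × List (Finset (Fin G.m)) →
    CoinTree (List (Finset (Fin G.m)) × List (Finset (Fin G.m)))
  | ([], out) => .ret ([], out)
  | (B :: l, out) => (mutate s B).bind fun r =>
      .ret (l, if 2 ≤ G.numComponents r.2 then out ++ [r.2] else out)

/-- The number of copies of each member that a population of size `S` is replaced by. -/
def copies (N S : ℕ) : ℕ := N / max S 1

/-- The population after replication. -/
def replicated (N : ℕ) (pop : List (Finset (Fin G.m))) : List (Finset (Fin G.m)) :=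
  (List.replicate (copies N pop.length) pop).flatten

/-- One level: replicate the population to a size between `N / 2` and `N`, and mutate all members.
The second component is the inverse of the weight of the members. -/
noncomputable def level (s N : ℕ) (st : List (Finset (Fin G.m)) × ℕ) :
    CoinTree (List (Finset (Fin G.m)) × ℕ) :=
  (iter (popStep s) (replicated N st.1).length (replicated N st.1, [])).bind fun r =>
    .ret (r.2, st.2 * copies N st.1.length)

/-- The sum of `φ` over the population. -/
def popSum (φ : Finset (Fin G.m) → ℝ) (pop : List (Finset (Fin G.m))) : ℝ := (pop.map φ).sum

/-- The weighted sum of `φ` over the population. -/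
noncomputable def weighted (φ : Finset (Fin G.m) → ℝ) (st : List (Finset (Fin G.m)) × ℕ) : ℝ :=
  popSum φ st.1 / st.2

/-- The population has at most `N` members, all of them disconnected. -/
def Valid (N : ℕ) (st : List (Finset (Fin G.m)) × ℕ) : Prop :=
  st.1.length ≤ N ∧ 0 < st.2 ∧ ∀ B ∈ st.1, 2 ≤ G.numComponents B

theorem exp_coin (s : ℕ) (b : Bool) (φ : Bool → ℝ) : (coin s b).exp φ =
    (1 - (1 / 2) ^ s) * φ false + (1 / 2) ^ s * φ b := by
  induction s generalizing b with
  | zero => simp [coin, iter]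
  | succ s ih =>
    have h : coin (s + 1) b = .node fun b' => coin s (b && b') := rfl
    rw [h, exp, ih, ih, pow_succ]
    cases b <;> simp <;> ring

theorem exp_edgeSteps (s : ℕ) (l : List (Fin G.m)) (B : Finset (Fin G.m))
    (φ : Finset (Fin G.m) → ℝ) : (iter (edgeStep s) l.length (l, B)).exp (fun r => φ r.2) =
      perc (1 - (1 / 2) ^ s) l φ B := by
  induction l generalizing B with
  | nil => rfl
  | cons j l ih =>
    simp only [List.length_cons, iter, edgeStep, exp_bind, exp_coin, exp_ret, ih, perc]
    simp

theorem exp_mutate (s : ℕ) (B : Finset (Fin G.m)) (φ : Finset (Fin G.m) → ℝ) :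
    (mutate s B).exp (fun r => φ r.2) = perc (1 - (1 / 2) ^ s) (List.finRange G.m) φ B := by
  have := exp_edgeSteps s (List.finRange G.m) B φ
  rwa [List.length_finRange] at this

@[simp] theorem popSum_nil (φ : Finset (Fin G.m) → ℝ) : popSum φ [] = 0 := rfl

@[simp] theorem popSum_cons (φ : Finset (Fin G.m) → ℝ) (B : Finset (Fin G.m))
    (l : List (Finset (Fin G.m))) : popSum φ (B :: l) = φ B + popSum φ l := rfl

@[simp] theorem popSum_append (φ : Finset (Fin G.m) → ℝ) (l l' : List (Finset (Fin G.m))) :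
    popSum φ (l ++ l') = popSum φ l + popSum φ l' := by simp [popSum]

/-- Discarding connected members changes nothing for functions that vanish on them. -/
theorem popSum_keep {φ : Finset (Fin G.m) → ℝ} (hφ : ∀ A, G.numComponents A < 2 → φ A = 0)
    (out : List (Finset (Fin G.m))) (A : Finset (Fin G.m)) [Decidable (2 ≤ G.numComponents A)] :
    popSum φ (if 2 ≤ G.numComponents A then out ++ [A] else out) = popSum φ out + φ A := by
  split_ifs with h
  · simp
  · rw [hφ A (by omega), add_zero]

theorem popSum_mono {φ ψ : Finset (Fin G.m) → ℝ} {l : List (Finset (Fin G.m))}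
    (h : ∀ A ∈ l, φ A ≤ ψ A) : popSum φ l ≤ popSum ψ l :=
  List.sum_le_sum h

theorem popSum_mul_left (r : ℝ) (φ : Finset (Fin G.m) → ℝ) (l : List (Finset (Fin G.m))) :
    popSum (fun A => r * φ A) l = r * popSum φ l := List.sum_map_mul_left _ _ _

theorem popSum_nonneg {φ : Finset (Fin G.m) → ℝ} {l : List (Finset (Fin G.m))}
    (h : ∀ A ∈ l, 0 ≤ φ A) : 0 ≤ popSum φ l := by
  refine List.sum_nonneg fun r hr => ?_
  obtain ⟨A, hA, rfl⟩ := List.mem_map.1 hr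
  exact h A hA

theorem popSum_replicated (N : ℕ) (φ : Finset (Fin G.m) → ℝ) (l : List (Finset (Fin G.m))) :
    popSum φ (replicated N l) = copies N l.length * popSum φ l := by
  rw [replicated]
  induction copies N l.length with
  | zero => simp
  | succ a ih => rw [List.replicate_succ, List.flatten_cons, popSum_append, ih]; push_cast; ring

theorem length_replicated (N : ℕ) (l : List (Finset (Fin G.m))) :
    (replicated N l).length = copies N l.length * l.length := by
  simp [replicated, List.length_flatten]

theorem copies_mul_le (N S : ℕ) : copies N S * S ≤ N :=
  (Nat.mul_le_mul_left _ (le_max_left _ _)).trans (Nat.div_mul_le_self _ _)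

theorem copies_pos {N S : ℕ} (hN : 0 < N) (hS : S ≤ N) : 0 < copies N S :=
  Nat.div_pos (max_le hS hN) (by omega)

/-- Since N/S ≥ 1, rounding the quotient down loses less than a factor 2. -/
theorem le_two_mul_copies_mul {N S : ℕ} (hS : 0 < S) (hSN : S ≤ N) : N ≤ 2 * (copies N S * S) := by
  have h1 : copies N S = N / S := by rw [copies, max_eq_left (by omega)]
  have h2 := Nat.div_add_mod N S
  have h3 := Nat.mod_lt N hS
  have h4 : 1 ≤ N / S := Nat.div_pos hSN hS
  rw [h1]
  nlinarith

/-! ### First and second moments of one level. -/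

section Moments

variable {s : ℕ} {φ : Finset (Fin G.m) → ℝ} (hφ : ∀ A, G.numComponents A < 2 → φ A = 0)
include hφ

theorem exp_popSteps (l out : List (Finset (Fin G.m))) :
    (iter (popStep s) l.length (l, out)).exp (fun r => popSum φ r.2) =
      popSum φ out + popSum (perc (1 - (1 / 2) ^ s) (List.finRange G.m) φ) l := by
  induction l generalizing out with
  | nil => simp [iter]
  | cons B l ih =>
    simp only [List.length_cons, iter, popStep, bind_bind, ret_bind, exp_bind, ih,
      popSum_keep hφ, popSum_cons]
    rw [exp_mutate s B (fun A => popSum φ out + φ A +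
      popSum (perc (1 - (1 / 2) ^ s) (List.finRange G.m) φ) l), perc_add, perc_add, perc_const,
      perc_const]
    ring

/-- Given the population, its members (copies included) mutate independently, so the variances add
up. Each is bounded by the second moment. -/
theorem exp_popSteps_sq_le (l out : List (Finset (Fin G.m))) :
    (iter (popStep s) l.length (l, out)).exp (fun r => popSum φ r.2 ^ 2) ≤
      (popSum φ out + popSum (perc (1 - (1 / 2) ^ s) (List.finRange G.m) φ) l) ^ 2 +
        popSum (perc (1 - (1 / 2) ^ s) (List.finRange G.m) fun A => φ A ^ 2) l := by
  induction l generalizing out with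
  | nil => simp [iter]
  | cons B l ih =>
    simp only [List.length_cons, iter, popStep, bind_bind, ret_bind, exp_bind, popSum_cons]
    refine (exp_mono _ fun r => ih _).trans ?_
    simp only [popSum_keep hφ]
    set u := popSum (perc (1 - (1 / 2) ^ s) (List.finRange G.m) φ) l
    set v := popSum (perc (1 - (1 / 2) ^ s) (List.finRange G.m) fun A => φ A ^ 2) l
    rw [exp_mutate s B (fun A => (popSum φ out + φ A + u) ^ 2 + v)]
    have e : (fun A => (popSum φ out + φ A + u) ^ 2 + v) = fun A =>
        (2 * (popSum φ out + u)) * φ A + φ A ^ 2 + ((popSum φ out + u) ^ 2 + v) := by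
      funext A; ring
    rw [e, perc_add, perc_add, perc_mul_left, perc_const]
    nlinarith [sq_nonneg (perc (1 - (1 / 2) ^ s) (List.finRange G.m) φ B)]

/-- Replication by the factor `copies` is cancelled by the weight, so a level is unbiased. -/
theorem exp_level {N : ℕ} {st : List (Finset (Fin G.m)) × ℕ} (hst : Valid N st) (hN : 0 < N) :
    (level s N st).exp (weighted φ) =
      weighted (perc (1 - (1 / 2) ^ s) (List.finRange G.m) φ) st := by
  have ha : (0 : ℝ) < copies N st.1.length := by exact_mod_cast copies_pos hN hst.1
  have hD : (0 : ℝ) < st.2 := by exact_mod_cast hst.2.1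
  simp only [level, exp_bind, exp_ret, weighted, div_eq_inv_mul]
  rw [exp_mul_left, exp_popSteps hφ, popSum_nil, popSum_replicated]
  push_cast
  field_simp
  ring

theorem exp_level_sq_le {N : ℕ} {st : List (Finset (Fin G.m)) × ℕ} (hst : Valid N st)
    (hN : 0 < N) : (level s N st).exp (fun r => weighted φ r ^ 2) ≤
      weighted (perc (1 - (1 / 2) ^ s) (List.finRange G.m) φ) st ^ 2 +
        2 / N * (weighted (fun _ => 1) st *
          weighted (perc (1 - (1 / 2) ^ s) (List.finRange G.m) fun A => φ A ^ 2) st) := by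
  have ha : (0 : ℝ) < copies N st.1.length := by exact_mod_cast copies_pos hN hst.1
  have hD : (0 : ℝ) < st.2 := by exact_mod_cast hst.2.1
  have hN' : (0 : ℝ) < N := by exact_mod_cast hN
  have hρ1 : (1 - (1 / 2 : ℝ) ^ s) ≤ 1 := by simp
  have hρ0 : 0 ≤ (1 - (1 / 2 : ℝ) ^ s) :=
    sub_nonneg.2 (pow_le_one₀ (by norm_num) (by norm_num))
  have e : ∀ (l : List (Finset (Fin G.m))) (D : ℕ),
      weighted φ (l, D) ^ 2 = ((D : ℝ) ^ 2)⁻¹ * popSum φ l ^ 2 := fun l D => by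
    rw [weighted, div_pow, div_eq_inv_mul]
  simp only [level, exp_bind, exp_ret, e]
  rw [exp_mul_left]
  refine (mul_le_mul_of_nonneg_left (exp_popSteps_sq_le hφ _ _) (by positivity)).trans ?_
  rw [popSum_nil, popSum_replicated, popSum_replicated, zero_add]
  set v := popSum (perc (1 - (1 / 2) ^ s) (List.finRange G.m) fun A => φ A ^ 2) st.1
  have hv : 0 ≤ v := popSum_nonneg fun A _ => perc_nonneg hρ0 hρ1 _ (fun _ => sq_nonneg _) _
  set u := popSum (perc (1 - (1 / 2) ^ s) (List.finRange G.m) φ) st.1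
  have h1 : popSum (fun _ => (1 : ℝ)) st.1 = st.1.length := by simp [popSum]
  -- With a copies of each of S members the noise is a v / (a D)² = v / (a D²), and a S ≥ N/2 turns
  -- 1/a into at most 2S/N. An extinct population has v = 0.
  have key : v / (copies N st.1.length) ≤ 2 / N * st.1.length * v := by
    rcases Nat.eq_zero_or_pos st.1.length with h | h
    · have : v = 0 := by
        have : st.1 = [] := List.eq_nil_of_length_eq_zero h
        simp only [v, this, popSum_nil]
      simp [this]
    · rw [div_le_iff₀ ha]
      have h2 : (N : ℝ) ≤ 2 * (copies N st.1.length * st.1.length) := by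
        exact_mod_cast le_two_mul_copies_mul h hst.1
      have h3 : 1 ≤ 2 / N * st.1.length * (copies N st.1.length : ℝ) := by
        rw [div_mul_eq_mul_div, div_mul_eq_mul_div, le_div_iff₀ hN']; linarith
      calc v = 1 * v := (one_mul v).symm
        _ ≤ (2 / N * st.1.length * (copies N st.1.length : ℝ)) * v := by gcongr
        _ = _ := by ring
  push_cast
  calc _ = u ^ 2 / (st.2 : ℝ) ^ 2 + (v / (copies N st.1.length)) / (st.2 : ℝ) ^ 2 := by
        field_simp
    _ ≤ u ^ 2 / (st.2 : ℝ) ^ 2 + (2 / N * st.1.length * v) / (st.2 : ℝ) ^ 2 := by gcongr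
    _ = (u / st.2) ^ 2 + 2 / N * ((st.1.length / st.2) * (v / st.2)) := by field_simp
    _ = _ := by rw [← h1]; rfl

end Moments

theorem all_popSteps (s : ℕ) (l out : List (Finset (Fin G.m)))
    (hout : ∀ B ∈ out, 2 ≤ G.numComponents B) : (iter (popStep s) l.length (l, out)).All fun r =>
      r.2.length ≤ l.length + out.length ∧ ∀ B ∈ r.2, 2 ≤ G.numComponents B := by
  induction l generalizing out with
  | nil => exact ⟨by simp, hout⟩
  | cons B l ih =>
    simp only [List.length_cons, iter, popStep, bind_bind, ret_bind]
    refine CoinTree.All.bind (p := fun _ => True) (All.of_forall _ fun _ => trivial) fun r _ => ?_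
    split_ifs with h
    · refine (ih _ ?_).mono fun r hr => ⟨?_, hr.2⟩
      · intro A hA
        rcases List.mem_append.1 hA with hA | hA
        · exact hout A hA
        · rwa [List.mem_singleton.1 hA]
      · have := hr.1; simp only [List.length_append, List.length_singleton] at this; omega
    · exact (ih _ hout).mono fun r hr => ⟨by have := hr.1; omega, hr.2⟩

theorem all_level {s N : ℕ} (hN : 0 < N) {st : List (Finset (Fin G.m)) × ℕ} (hst : Valid N st) :
    (level s N st).All (Valid N) := by
  refine (all_popSteps s (replicated N st.1) [] (by simp)).bind fun r hr => ⟨?_, ?_, hr.2⟩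
  · refine hr.1.trans ?_
    rw [length_replicated]
    simpa using copies_mul_le N st.1.length
  · exact Nat.mul_pos hst.2.1 (copies_pos hN hst.1)

theorem weighted_mono {φ ψ : Finset (Fin G.m) → ℝ} {st : List (Finset (Fin G.m)) × ℕ}
    (h : ∀ A ∈ st.1, φ A ≤ ψ A) : weighted φ st ≤ weighted ψ st :=
  div_le_div_of_nonneg_right (popSum_mono h) (Nat.cast_nonneg _)

theorem weighted_mul_left (r : ℝ) (φ : Finset (Fin G.m) → ℝ)
    (st : List (Finset (Fin G.m)) × ℕ) :
    weighted (fun A => r * φ A) st = r * weighted φ st := by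
  rw [weighted, popSum_mul_left, mul_div_assoc, weighted]

theorem weighted_nonneg {φ : Finset (Fin G.m) → ℝ} {st : List (Finset (Fin G.m)) × ℕ}
    (h : ∀ A ∈ st.1, 0 ≤ φ A) : 0 ≤ weighted φ st :=
  div_nonneg (popSum_nonneg h) (Nat.cast_nonneg _)

/-! ### The second moment over all levels. -/

section Splitting

variable {c s N : ℕ} {M : ℝ} {f : Finset (Fin G.m) → ℝ}

/-- The conditional expectation of `f`, `i` levels before the last. -/
noncomputable def backward (s : ℕ) (f : Finset (Fin G.m) → ℝ) (i : ℕ) :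
    Finset (Fin G.m) → ℝ :=
  (perc (1 - (1 / 2) ^ s) (List.finRange G.m))^[i] f

/-- A bound for the probability of remaining disconnected during `i` levels. -/
noncomputable def importance (c s i : ℕ) (B : Finset (Fin G.m)) : ℝ :=
  ((1 - (1 / 2) ^ s) ^ c) ^ i * choose 2 B

theorem backward_succ (s : ℕ) (f : Finset (Fin G.m) → ℝ) (i : ℕ) :
    backward s f (i + 1) = perc (1 - (1 / 2) ^ s) (List.finRange G.m) (backward s f i) :=
  Function.iterate_succ_apply' _ _ _

theorem backward_eq_perc (s : ℕ) (f : Finset (Fin G.m) → ℝ) (i : ℕ) :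
    backward s f i = perc ((1 - (1 / 2) ^ s) ^ i) (List.finRange G.m) f := by
  induction i with
  | zero => rw [pow_zero, perc_one]; rfl
  | succ i ih => rw [backward_succ, ih, perc_perc, pow_succ']

theorem choose_two_eq_zero {A : Finset (Fin G.m)} (h : G.numComponents A < 2) :
    choose 2 A = 0 := by
  rw [choose, Nat.choose_eq_zero_of_lt h, Nat.cast_zero]

theorem one_le_choose_two {A : Finset (Fin G.m)} (h : 2 ≤ G.numComponents A) :
    1 ≤ choose 2 A := by
  rw [choose]; exact_mod_cast Nat.choose_pos h

theorem choose_two_le (A : Finset (Fin G.m)) : choose 2 A ≤ (G.n.choose 2 : ℕ) := by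
  rw [choose]; exact_mod_cast Nat.choose_le_choose 2 (numComponents_le A)

theorem choose_nonneg (k : ℕ) (A : Finset (Fin G.m)) : 0 ≤ choose k A := Nat.cast_nonneg _

variable (hs : 0 < s)
include hs

theorem keep_pos : (0 : ℝ) < 1 - (1 / 2) ^ s :=
  sub_pos.2 (pow_lt_one₀ (by norm_num) (by norm_num) hs.ne')

omit hs in
theorem keep_le_one : (1 : ℝ) - (1 / 2) ^ s ≤ 1 := by simp

theorem importance_nonneg (i : ℕ) (A : Finset (Fin G.m)) : 0 ≤ importance c s i A :=
  mul_nonneg (by have := keep_pos hs; positivity) (choose_nonneg _ _)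

variable (hc : ∀ S : Finset (Fin G.n), S.Nonempty → S ≠ Finset.univ → c ≤ G.cutValue S)
include hc

/-- The case k = 2 of `perc_choose_le`, where (ρ^(c/2))² = ρ^c: the potential is a supermartingale
along the levels. -/
theorem perc_importance_le (i : ℕ) (A : Finset (Fin G.m)) :
    perc (1 - (1 / 2) ^ s) (List.finRange G.m) (importance c s i) A ≤ importance c s (i + 1) A := by
  have h := perc_choose_le hc le_rfl (keep_pos hs) keep_le_one A
  rw [← Real.rpow_mul_natCast (keep_pos hs).le, Nat.cast_ofNat, div_mul_cancel₀ _ two_ne_zero,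
    Real.rpow_natCast] at h
  have hp := keep_pos hs
  change perc _ _ (fun B => _ * choose 2 B) A ≤ _
  rw [perc_mul_left]
  refine (mul_le_mul_of_nonneg_left h (by positivity)).trans_eq ?_
  rw [importance, pow_succ]; ring

variable (hM : 0 ≤ M) (hfM : ∀ A, |f A| ≤ M) (hf : ∀ A, G.numComponents A < 2 → f A = 0)
include hM hfM hf

/-- For i = 0 this holds because a disconnected subgraph has at least one pair of components; the
supermartingale property propagates it backwards. -/
theorem abs_backward_le (i : ℕ) (A : Finset (Fin G.m)) :
    |backward s f i A| ≤ M * importance c s i A := by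
  induction i generalizing A with
  | zero =>
    simp only [backward, importance, Function.iterate_zero, id, pow_zero, one_mul]
    by_cases h : G.numComponents A < 2
    · simp [hf A h, choose_two_eq_zero h]
    · have := one_le_choose_two (A := A) (by omega)
      have := hfM A
      nlinarith
  | succ i ih =>
    rw [backward_succ]
    refine (abs_perc_le (keep_pos hs).le keep_le_one _ ih A).trans ?_
    rw [perc_mul_left]
    exact mul_le_mul_of_nonneg_left (perc_importance_le hs hc i A) hM

-- The noise of a level is bounded by the square of the potential. On disconnected members 1 ≤
-- binom(κ,2) = ρ^(-c(i+1)) times the potential at i+1. One factor of φ² is replaced by the maximal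
-- potential ρ^(ci) binom(n,2), the other is averaged by the supermartingale property. The powers of
-- ρ combine to ρ^(-c).
omit hfM hf hM in
theorem weighted_perc_sq_le (i : ℕ) {φ : Finset (Fin G.m) → ℝ} {M : ℝ}
    (hφ : ∀ A, |φ A| ≤ M * importance c s i A)
    {st : List (Finset (Fin G.m)) × ℕ} (hst : Valid N st) :
    weighted (fun _ => 1) st *
      weighted (perc (1 - (1 / 2) ^ s) (List.finRange G.m) fun A => φ A ^ 2) st ≤
    M ^ 2 * ((G.n.choose 2 : ℕ) / (1 - (1 / 2) ^ s) ^ c) * weighted (importance c s (i + 1)) st ^ 2 := by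
  have hp := keep_pos hs
  set ρ : ℝ := 1 - (1 / 2) ^ s with hρ
  set n2 : ℝ := ((G.n.choose 2 : ℕ) : ℝ)
  have hn2 : 0 ≤ n2 := Nat.cast_nonneg _
  have h1 : weighted (fun _ => 1) st ≤ (((ρ ^ c) ^ (i + 1))⁻¹) * weighted (importance c s (i + 1)) st := by
    rw [← weighted_mul_left]
    refine weighted_mono fun A hA => ?_
    have := one_le_choose_two (hst.2.2 A hA)
    rw [importance, ← hρ, ← mul_assoc, inv_mul_cancel₀ (by positivity), one_mul]
    exact this
  have h2 : weighted (perc ρ (List.finRange G.m) fun A => φ A ^ 2) st ≤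
      (M ^ 2 * n2 * (ρ ^ c) ^ i) * weighted (importance c s (i + 1)) st := by
    rw [← weighted_mul_left]
    refine weighted_mono fun A _ => ?_
    refine (perc_mono hp.le keep_le_one _ (ψ := fun A => (M ^ 2 * n2 * (ρ ^ c) ^ i) * importance c s i A)
      (fun A => ?_) A).trans ?_
    · have h3 : φ A ^ 2 ≤ (M * importance c s i A) ^ 2 := sq_le_sq' (by linarith [(abs_le.1 (hφ A)).1])
        (abs_le.1 (hφ A)).2
      refine h3.trans ?_
      have h4 : importance c s i A ≤ (ρ ^ c) ^ i * n2 := by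
        rw [importance, ← hρ]; gcongr; exact choose_two_le A
      have h5 : 0 ≤ M ^ 2 * importance c s i A := mul_nonneg (sq_nonneg _) (importance_nonneg hs i A)
      calc (M * importance c s i A) ^ 2 = (M ^ 2 * importance c s i A) * importance c s i A := by ring
        _ ≤ (M ^ 2 * importance c s i A) * ((ρ ^ c) ^ i * n2) := by gcongr
        _ = _ := by ring
    · rw [perc_mul_left]
      exact mul_le_mul_of_nonneg_left (perc_importance_le hs hc i A) (by positivity)
  have h6 : 0 ≤ weighted (importance c s (i + 1)) st := weighted_nonneg fun A _ => importance_nonneg hs _ A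
  have h7 : 0 ≤ weighted (perc ρ (List.finRange G.m) fun A => φ A ^ 2) st :=
    weighted_nonneg fun A _ => perc_nonneg hp.le keep_le_one _ (fun _ => sq_nonneg _) A
  refine (mul_le_mul h1 h2 h7 (by positivity)).trans_eq ?_
  rw [pow_succ (ρ ^ c) i]
  field_simp

omit hs hM hfM hc in
theorem backward_eq_zero (i : ℕ) (A : Finset (Fin G.m)) (h : G.numComponents A < 2) :
    backward s f i A = 0 := by
  have hcl : ∀ (φ : Finset (Fin G.m) → ℝ), (∀ A, G.numComponents A < 2 → φ A = 0) →
      ∀ (l : List (Fin G.m)) (A), G.numComponents A < 2 → perc (1 - (1 / 2) ^ s) l φ A = 0 := by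
    intro φ hφ l
    induction l with
    | nil => exact hφ
    | cons j l ih =>
      intro A hA
      simp only [perc]
      rw [ih A hA, ih _ ((numComponents_insert_le A j).1.trans_lt hA)]; ring
  induction i generalizing A with
  | zero => exact hf A h
  | succ i ih => rw [backward_succ]; exact hcl _ ih _ A h

/-- The first level is split off. It adds noise b M² W² to the estimate, where W is the weighted
potential at its start, and multiplies the bound for the second moment of W by 1 + b (the same
estimate for the potential itself, with M = 1). The factor (1+b)^i - 1 solves the recursion b +
(1+b)((1+b)^i - 1) = (1+b)^(i+1) - 1. -/
theorem exp_levels (hN : 0 < N) (i : ℕ) {st : List (Finset (Fin G.m)) × ℕ} (hst : Valid N st) :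
    (iter (level s N) i st).exp (weighted f) = weighted (backward s f i) st ∧
    (iter (level s N) i st).exp (fun r => weighted f r ^ 2) ≤ weighted (backward s f i) st ^ 2 +
      ((1 + 2 / N * ((G.n.choose 2 : ℕ) / (1 - (1 / 2) ^ s) ^ c)) ^ i - 1) * M ^ 2 *
        weighted (importance c s i) st ^ 2 := by
  have hp := keep_pos hs
  set b : ℝ := 2 / N * ((G.n.choose 2 : ℕ) / (1 - (1 / 2) ^ s) ^ c) with hb
  have hb0 : 0 ≤ b := by positivity
  have hn : (0 : ℝ) ≤ 2 / N := by positivity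
  induction i generalizing st with
  | zero => simp [iter, backward]
  | succ i ih =>
    have hall := all_level (s := s) hN hst
    constructor
    · rw [iter, exp_bind, exp_congr (hall.mono fun r hr => (ih hr).1),
        exp_level (backward_eq_zero (s := s) hf i) hst hN, backward_succ]
    · rw [iter, exp_bind]
      refine (exp_le_exp (hall.mono fun r hr => (ih hr).2)).trans ?_
      rw [exp_add, exp_mul_left]
      have h1 := exp_level_sq_le (s := s) (backward_eq_zero (s := s) hf i) hst hN
      have h2 := exp_level_sq_le (s := s) (φ := importance c s i) (fun A hA => by
        rw [importance, choose_two_eq_zero hA, mul_zero]) hst hN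
      have h3 := weighted_perc_sq_le hs hc i (fun A => abs_backward_le hs hc hM hfM hf i A) hst
      have h4 := weighted_perc_sq_le hs hc i (φ := importance c s i) (M := 1) (fun A => by
        rw [one_mul, abs_of_nonneg (importance_nonneg hs i A)]) hst
      have h5 : weighted (perc (1 - (1 / 2) ^ s) (List.finRange G.m) (importance c s i)) st ≤
        weighted (importance c s (i + 1)) st := weighted_mono fun A _ => perc_importance_le hs hc i A
      have h6 : 0 ≤ weighted (perc (1 - (1 / 2) ^ s) (List.finRange G.m) (importance c s i)) st :=
        weighted_nonneg fun A _ => perc_nonneg hp.le keep_le_one _ (importance_nonneg hs i) A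
      have h7 := pow_le_pow_left₀ h6 h5 2
      rw [← backward_succ] at h1
      have h8 : (level s N st).exp (fun r => weighted (backward s f i) r ^ 2) ≤
          weighted (backward s f (i + 1)) st ^ 2 + b * M ^ 2 * weighted (importance c s (i + 1)) st ^ 2 := by
        refine h1.trans ?_
        have := mul_le_mul_of_nonneg_left h3 hn
        rw [hb]; linarith
      have h9 : (level s N st).exp (fun r => weighted (importance c s i) r ^ 2) ≤
          (1 + b) * weighted (importance c s (i + 1)) st ^ 2 := by
        refine h2.trans ?_
        have := mul_le_mul_of_nonneg_left h4 hn
        rw [hb]; linarith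
      have h10 : 0 ≤ ((1 + b) ^ i - 1) * M ^ 2 :=
        mul_nonneg (sub_nonneg.2 (one_le_pow₀ (by linarith))) (sq_nonneg _)
      have h11 := mul_le_mul_of_nonneg_left h9 h10
      refine (add_le_add h8 h11).trans_eq ?_
      rw [pow_succ]; ring

open Classical in
/-- The splitting estimator is concentrated at its expectation. -/
theorem exp_levels_deviation (hn : 2 ≤ G.n) (hN : 0 < N) (i : ℕ) {e : ℝ} (he : 0 < e) :
    1 - ((1 + 2 / N * ((G.n.choose 2 : ℕ) / (1 - (1 / 2) ^ s) ^ c)) ^ i - 1) * M ^ 2 *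
        (((1 - (1 / 2) ^ s) ^ c) ^ i * (G.n.choose 2 : ℕ)) ^ 2 / e ^ 2 ≤
      (iter (level s N) i ([∅], 1)).exp fun r =>
        if |weighted f r - perc ((1 - (1 / 2) ^ s) ^ i) (List.finRange G.m) f ∅| ≤ e
          then 1 else 0 := by
  have hst : Valid N (([∅], 1) : List (Finset (Fin G.m)) × ℕ) :=
    ⟨by simpa [Nat.one_le_iff_ne_zero] using hN.ne', one_pos, by simpa [numComponents_empty] using hn⟩
  obtain ⟨h1, h2⟩ := exp_levels hs hc hM hfM hf hN i hst
  have e1 : ∀ φ : Finset (Fin G.m) → ℝ, weighted φ ([∅], 1) = φ ∅ := fun φ => by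
    simp [weighted, popSum]
  have e2 : choose 2 (∅ : Finset (Fin G.m)) = (G.n.choose 2 : ℕ) := by
    rw [choose, numComponents_empty]
  rw [e1] at h1 h2
  rw [e1, importance, e2] at h2
  rw [← backward_eq_perc]
  set F := backward s f i ∅
  -- Chebyshev's inequality: 1 - |W - F|²/e² lies below the indicator of |W - F| ≤ e.
  have h3 : (iter (level s N) i ([∅], 1)).exp (fun r => 1 + (-(e ^ 2)⁻¹) * (weighted f r ^ 2 +
      (-(2 * F) * weighted f r + F ^ 2))) ≤ (iter (level s N) i ([∅], 1)).exp fun r =>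
        if |weighted f r - F| ≤ e then 1 else 0 := by
    refine exp_mono _ fun r => ?_
    have h4 : weighted f r ^ 2 + (-(2 * F) * weighted f r + F ^ 2) = |weighted f r - F| ^ 2 := by
      rw [sq_abs]; ring
    rw [h4]
    split_ifs with h5
    · have : 0 ≤ (e ^ 2)⁻¹ * |weighted f r - F| ^ 2 := by positivity
      linarith
    · have h6 : e ^ 2 ≤ |weighted f r - F| ^ 2 := pow_le_pow_left₀ he.le (not_le.1 h5).le 2
      have : 1 ≤ (e ^ 2)⁻¹ * |weighted f r - F| ^ 2 := by
        rw [inv_mul_eq_div, one_le_div (by positivity)]; exact h6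
      linarith
  refine le_trans ?_ h3
  rw [exp_add, exp_const, exp_mul_left, exp_add, exp_add, exp_mul_left, exp_const, h1,
    div_eq_inv_mul]
  have h7 : 0 ≤ (e ^ 2)⁻¹ := by positivity
  have := mul_le_mul_of_nonneg_left h2 h7
  nlinarith

end Splitting

end Multigraph

/-! ### The program -/

namespace Prog

/-- The number of vertices. -/
abbrev numVertices : Expr := .read 0 (.lit 0)

/-- The number of edges. -/
abbrev numEdges : Expr := .read 0 (.lit 1)

/-- The address of vertex `v` in row `p` of the population. -/
abbrev address (p v : Expr) : Expr := .add (.mul p numVertices) v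

/-- Toss a coin that shows `1` with probability `2 ^ (-s)`. -/
def tossCoin : Prog :=
  .seq (assign 18 (.lit 1)) <|
  .loop (var 5) <| .seq (.flip 19 (.lit 0)) <| .ite (var 19) .skip (assign 18 (.lit 0))

/-- Merge the components of the ends of the current edge, in the current row. -/
def mergeRow : Prog :=
  .seq (assign 20 (.read 13 (address (var 24) (.read 1 (var 17))))) <|
  .seq (assign 21 (.read 13 (address (var 24) (.read 2 (var 17))))) <|
  forLoop 22 numVertices <|
    .ite (.sub (.read 13 (address (var 24) (var 22))) (var 20)) .skip
      (.write 13 (address (var 24) (var 22)) (var 21))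

/-- Toss the coin for the current edge. -/
def edgeRow : Prog := .seq tossCoin (.ite (var 18) mergeRow .skip)

/-- Toss the coins for all edges. -/
def mutateRow : Prog := forLoop 17 numEdges edgeRow

/-- Count the components of the current row. -/
def countRow : Prog :=
  .seq (assign 23 (.lit 0)) <|
  forLoop 22 numVertices <|
    .ite (.sub (.read 13 (address (var 24) (var 22))) (var 22)) .skip
      (assign 23 (.add (var 23) (.lit 1)))

/-- Copy the current row to the end of the new population. -/
def keepRow : Prog :=
  .seq (forLoop 22 numVertices
    (.write 13 (address (var 25) (var 22)) (.read 13 (address (var 24) (var 22))))) <|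
  assign 25 (.add (var 25) (.lit 1))

/-- Mutate the current row and keep it if it remains disconnected. -/
def stepRow : Prog :=
  .seq mutateRow <| .seq countRow <| .ite (.lt (var 23) (.lit 2)) .skip keepRow

/-- Replicate the population. -/
def replicate : Prog :=
  -- S + [S < 1] is max(S, 1), as in `copies`.
  .seq (assign 16 (.div (var 11) (.add (var 14) (.lt (var 14) (.lit 1))))) <|
  -- The source of the copy runs into the cells just written, so one loop continues the first S n
  -- cells periodically. If S = 0 the count is 0.
  .seq (forLoop 29 (.mul (.sub (var 16) (.lit 1)) (.mul (var 14) numVertices))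
    (.write 13 (.add (.mul (var 14) numVertices) (var 29)) (.read 13 (var 29)))) <|
  .seq (mulBy 14 (var 16)) (mulBy 15 (var 16))

/-- Replicate and mutate the population. -/
def runLevel : Prog :=
  .seq replicate <| .seq (assign 25 (.lit 0)) <| .seq (forLoop 24 (var 14) stepRow) <|
  assign 14 (var 25)

end Prog

/-! ### Correctness of the routines for one row. -/

namespace Multigraph

open Prog

variable {G : Multigraph} {x y : ℝ}

/-- The memory contains the graph `G`. -/
structure Stored (G : Multigraph) (t : Memory) : Prop where
  n_eq : t 0 0 = G.n
  m_eq : t 0 1 = G.m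
  fst_eq : ∀ j : Fin G.m, t 1 (j : ℕ) = ((G.ends j).1 : ℕ)
  snd_eq : ∀ j : Fin G.m, t 2 (j : ℕ) = ((G.ends j).2 : ℕ)

theorem Stored.congr {t t' : Memory} (h : G.Stored t) (h0 : t' 0 = t 0) (h1 : t' 1 = t 1)
    (h2 : t' 2 = t 2) : G.Stored t' :=
  ⟨by rw [h0, h.n_eq], by rw [h0, h.m_eq], fun j => by rw [h1, h.fst_eq],
    fun j => by rw [h2, h.snd_eq]⟩

/-- Row `p` of the array `r` contains labels of the components of `(V, B)`. -/
def Row (G : Multigraph) (r : ℤ → ℤ) (p : ℕ) (B : Finset (Fin G.m)) : Prop :=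
  ∃ ℓ, G.Labels B ℓ ∧ ∀ v : Fin G.n, r ((p : ℤ) * G.n + (v : ℕ)) = (ℓ v : ℕ)

/-- The arrays agree outside of row `p`. -/
def SameOutside (G : Multigraph) (p : ℕ) (r r' : ℤ → ℤ) : Prop :=
  ∀ i : ℤ, (i < p * G.n ∨ ((p : ℤ) + 1) * G.n ≤ i) → r' i = r i

theorem SameOutside.row {p p' : ℕ} {r r' : ℤ → ℤ} {B : Finset (Fin G.m)}
    (h : G.SameOutside p r r') (hp : p' ≠ p) (hr : G.Row r p' B) : G.Row r' p' B := by
  obtain ⟨ℓ, h1, h2⟩ := hr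
  refine ⟨ℓ, h1, fun v => ?_⟩
  rw [h _ ?_, h2]
  have hv : ((v : ℕ) : ℤ) < G.n := by exact_mod_cast v.2
  have hv0 : (0 : ℤ) ≤ ((v : ℕ) : ℤ) := by positivity
  have hn : (0 : ℤ) ≤ G.n := by positivity
  rcases lt_or_gt_of_ne hp with h3 | h3
  · left
    have : (p' : ℤ) + 1 ≤ p := by exact_mod_cast h3
    nlinarith
  · right
    have : (p : ℤ) + 1 ≤ p' := by exact_mod_cast h3
    nlinarith

/-- Array conventions: 13 holds the labels of all members, row by row; 5 holds s, 17 the current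
edge, 24 the row being mutated, 25 the number of rows kept so far, 14 and 15 the population size and
the inverse weight, 11 the target size N. -/
theorem simulates_tossCoin {t : Memory} {s : ℕ} (hs : t 5 0 = s) :
    Simulates x y tossCoin t (coin s true) (fun t' b => t' 18 0 = if b then 1 else 0)
      (4 * s + 2) := by
  have h0 : Det x y (assign 18 (.lit 1)) t (fun t' => t' = t.set 18 0 1) 1 := .write rfl
  refine (Simulates.det_seq h0 (w' := s * (3 + 1) + 1) ?_).weaken (by omega)
  rintro t' rfl -
  refine Simulates.loop (fun _ t' b => t' 18 0 = if b then 1 else 0) s ?_ true ?_ ?_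
  · simp [Expr.val, hs]
  · simp
  · intro i hi t' b _ hb
    refine CoinTree.Rel.node fun b' => ?_
    cases b' <;> cases b <;>
      simp [workTree, Expr.val, Expr.places] <;> refine .ret ?_ <;> simp_all

/-- The labels of both ends are saved in arrays 20 and 21 before the sweep, since the sweep may
overwrite the cell of an end. -/
theorem det_mergeRow {t : Memory} (ht : G.Stored t) {p : ℕ} (hp : t 24 0 = p) {j : Fin G.m}
    (hj : t 17 0 = (j : ℕ)) {ℓ : Fin G.n → Fin G.n}
    (hℓ : ∀ v : Fin G.n, t 13 ((p : ℤ) * G.n + (v : ℕ)) = (ℓ v : ℕ)) :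
    Det x y mergeRow t (fun t' => (∀ v : Fin G.n, t' 13 ((p : ℤ) * G.n + (v : ℕ)) =
      (G.mergeLabels j ℓ v : ℕ)) ∧ G.SameOutside p (t 13) (t' 13)) (4 * G.n + 4) := by
  have h1 : Det x y (assign 20 (.read 13 (address (var 24) (.read 1 (var 17))))) t
      (fun t' => t' = t.set 20 0 (ℓ (G.ends j).1 : ℕ)) 1 :=
    .write (by simp [Expr.val, hp, hj, ht.n_eq, ht.fst_eq, hℓ])
  refine (h1.seq (w' := 4 * G.n + 3) ?_).weaken (by omega)
  rintro _ rfl -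
  have h2 : Det x y (assign 21 (.read 13 (address (var 24) (.read 2 (var 17)))))
      (t.set 20 0 (ℓ (G.ends j).1 : ℕ))
      (fun t' => t' = (t.set 20 0 (ℓ (G.ends j).1 : ℕ)).set 21 0 (ℓ (G.ends j).2 : ℕ)) 1 :=
    .write (by simp [Expr.val, hp, hj, ht.n_eq, ht.snd_eq, hℓ])
  refine (h2.seq (w' := G.n * (2 + 2) + 2) ?_).weaken (by omega)
  rintro _ rfl -
  refine (Det.forLoop (fun k t' => (∀ v : Fin G.n, t' 13 ((p : ℤ) * G.n + (v : ℕ)) =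
      if (v : ℕ) < k then (G.mergeLabels j ℓ v : ℕ) else (ℓ v : ℕ)) ∧
        G.SameOutside p (t 13) (t' 13)) G.n ?_ ?_ ?_).mono ?_
  · simp [Expr.val, ht.n_eq]
  · exact ⟨by simpa using hℓ, fun i _ => by simp⟩
  · rintro k hk t' hf hk' ⟨hI, hO⟩
    have e1 : t' 24 0 = p := by rw [hf 24 (by decide)]; simpa using hp
    have e2 : t' 0 0 = G.n := by rw [hf 0 (by decide)]; simpa using ht.n_eq
    have e3 : t' 20 0 = (ℓ (G.ends j).1 : ℕ) := by rw [hf 20 (by decide)]; simp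
    have e4 : t' 21 0 = (ℓ (G.ends j).2 : ℕ) := by rw [hf 21 (by decide)]; simp
    have e5 : t' 13 ((p : ℤ) * G.n + k) = (ℓ ⟨k, hk⟩ : ℕ) := by simpa using hI ⟨k, hk⟩
    refine Det.ite (w := 1) (fun hne => Det.skip ?_) fun heq => Det.write ?_
    · simp only [Expr.val, e1, e2, hk', e5, e3, ne_eq, sub_eq_zero, Nat.cast_inj] at hne
      refine ⟨by simpa using hk', fun v => ?_, fun i hi => by simpa using hO i hi⟩
      simp only [set_apply, show ¬(13 = 22) by decide, false_and, if_false, hI]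
      by_cases hv : (v : ℕ) = k
      · obtain rfl : v = ⟨k, hk⟩ := Fin.ext hv
        simp [mergeLabels, Fin.ext_iff, hne]
      · simp only [show (v : ℕ) < k + 1 ↔ (v : ℕ) < k by omega]
    · simp only [Expr.val, e1, e2, hk', e5, e3, sub_eq_zero, Nat.cast_inj] at heq
      refine ⟨by simpa using hk', fun v => ?_, fun i hi => ?_⟩
      · simp only [Expr.val, e1, e2, e4, hk', set_apply, show ¬(13 = 22) by decide, false_and,
          if_false, true_and, add_right_inj, Nat.cast_inj, hI]
        by_cases hv : (v : ℕ) = k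
        · obtain rfl : v = ⟨k, hk⟩ := Fin.ext hv
          simp [mergeLabels, Fin.ext_iff, heq]
        · simp only [hv, if_false, show (v : ℕ) < k + 1 ↔ (v : ℕ) < k by omega]
      · have : i ≠ (p : ℤ) * G.n + k := by
          have : (k : ℤ) < G.n := by exact_mod_cast hk
          rintro rfl
          rcases hi with hi | hi
          · omega
          · linarith
        simpa [Expr.val, e1, e2, hk', this] using hO i hi
  · rintro t' ⟨hI, hO⟩ -
    exact ⟨fun v => by simpa using hI v, hO⟩

theorem simulates_edgeRow {t : Memory} (ht : G.Stored t) {s : ℕ} (hs : t 5 0 = s) {p : ℕ}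
    (hp : t 24 0 = p) {j : Fin G.m} (hj : t 17 0 = (j : ℕ)) {B : Finset (Fin G.m)}
    (hB : G.Row (t 13) p B) (l : List (Fin G.m)) :
    Simulates x y edgeRow t (edgeStep s (j :: l, B)) (fun t' r => r.1 = l ∧
      G.Row (t' 13) p r.2 ∧ G.SameOutside p (t 13) (t' 13)) (4 * s + 4 * G.n + 7) := by
  refine (Simulates.seq (w' := 4 * G.n + 5) (simulates_tossCoin hs) ?_).weaken (by omega)
  intro t' b hb hf
  obtain ⟨ℓ, hℓ1, hℓ2⟩ := hB
  have e13 : t' 13 = t 13 := hf 13 (by decide)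
  have h := ht.congr (t' := t') (hf 0 (by decide)) (hf 1 (by decide)) (hf 2 (by decide))
  refine Det.simulates _ (Q := fun t' => G.Row (t' 13) p (if b then insert j B else B) ∧
    G.SameOutside p (t 13) (t' 13)) ?_ fun t' h _ => ⟨rfl, h⟩
  refine Det.ite (w := 4 * G.n + 4) (fun hne => ?_) fun heq => ?_
  · have hbt : b = true := by
      cases b
      · simp [Expr.val, hb] at hne
      · rfl
    subst hbt
    refine (det_mergeRow h (by rw [hf 24 (by decide), hp]) (by rw [hf 17 (by decide), hj])
      (ℓ := ℓ) (by rw [e13]; exact hℓ2)).mono ?_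
    rintro t'' ⟨h1, h2⟩ -
    exact ⟨⟨_, hℓ1.insert j, h1⟩, by rwa [e13] at h2⟩
  · have hbf : b = false := by
      cases b
      · rfl
      · simp [Expr.val, hb] at heq
    subst hbf
    refine (Det.skip ?_).weaken (by omega)
    rw [e13]
    exact ⟨⟨ℓ, hℓ1, hℓ2⟩, fun i _ => rfl⟩

theorem simulates_mutateRow {t : Memory} (ht : G.Stored t) {s : ℕ} (hs : t 5 0 = s) {p : ℕ}
    (hp : t 24 0 = p) {B : Finset (Fin G.m)} (hB : G.Row (t 13) p B) :
    Simulates x y mutateRow t (mutate s B) (fun t' r =>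
      G.Row (t' 13) p r.2 ∧ G.SameOutside p (t 13) (t' 13))
      (G.m * (4 * s + 4 * G.n + 9) + 2) := by
  refine (Simulates.forLoop (w := 4 * s + 4 * G.n + 7) (fun k t' r =>
    r.1 = (List.finRange G.m).drop k ∧ G.Row (t' 13) p r.2 ∧ G.SameOutside p (t 13) (t' 13))
    G.m ?_ _ ?_ ?_).mono fun t' r h _ => h.2
  · simp [Expr.val, ht.m_eq]
  · refine ⟨rfl, ?_, fun i _ => ?_⟩
    · rwa [set_of_ne (by decide)]
    · rw [set_of_ne (by decide)]
  · rintro k hk t' ⟨l, A⟩ hf hk' ⟨hl, hA, hO⟩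
    simp only at hl hA hO
    have hdrop : (List.finRange G.m).drop k =
        ⟨k, hk⟩ :: (List.finRange G.m).drop (k + 1) := by
      rw [List.drop_eq_getElem_cons (by simpa using hk)]
      simp
    rw [hdrop] at hl
    subst hl
    refine ((simulates_edgeRow (ht.congr (hf 0 (by decide)) (hf 1 (by decide)) (hf 2 (by decide)))
      (by rw [hf 5 (by decide), hs]) (by rw [hf 24 (by decide), hp]) (j := ⟨k, hk⟩) hk' hA _)).mono ?_
    rintro t'' r ⟨h1, h2, h3⟩ hf'
    refine ⟨by rw [hf' 17 (by decide), hk'], h1, ?_, fun i hi => ?_⟩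
    · rwa [set_of_ne (by decide)]
    · rw [set_of_ne (by decide), h3 i hi, hO i hi]

theorem det_countRow {t : Memory} (ht : G.Stored t) {p : ℕ} (hp : t 24 0 = p)
    {B : Finset (Fin G.m)} (hB : G.Row (t 13) p B) :
    Det x y countRow t (fun t' => t' 23 0 = G.numComponents B) (4 * G.n + 3) := by
  obtain ⟨ℓ, hℓ1, hℓ2⟩ := hB
  have h1 : Det x y (assign 23 (.lit 0)) t (fun t' => t' = t.set 23 0 0) 1 := .write rfl
  refine (h1.seq (w' := G.n * (2 + 2) + 2) ?_).weaken (by omega)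
  rintro _ rfl -
  refine (Det.forLoop (fun k t' => t' 23 0 =
    ((Finset.univ.filter fun v : Fin G.n => (v : ℕ) < k ∧ ℓ v = v).card : ℕ)) G.n ?_ ?_ ?_).mono ?_
  · simp [Expr.val, ht.n_eq]
  · simp
  · rintro k hk t' hf hk' hI
    have e1 : t' 24 0 = p := by rw [hf 24 (by decide)]; simpa using hp
    have e2 : t' 0 0 = G.n := by rw [hf 0 (by decide)]; simpa using ht.n_eq
    have e3 : t' 13 = t 13 := by rw [hf 13 (by decide), set_of_ne (by decide)]
    have e5 : t' 13 ((p : ℤ) * G.n + k) = (ℓ ⟨k, hk⟩ : ℕ) := by rw [e3]; exact hℓ2 ⟨k, hk⟩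
    refine Det.ite (w := 1) (fun hne => Det.skip ?_) fun heq => Det.write ?_
    · simp only [Expr.val, e1, e2, hk', e5, ne_eq, sub_eq_zero, Nat.cast_inj] at hne
      refine ⟨hk', ?_⟩
      rw [set_of_ne (by decide), hI]
      congr 2
      ext v
      simp only [Finset.mem_filter, Finset.mem_univ, true_and]
      refine ⟨fun h => ⟨by omega, h.2⟩, fun h => ⟨?_, h.2⟩⟩
      by_contra h'
      obtain rfl : v = ⟨k, hk⟩ := Fin.ext (by have := h.1; simp only; omega)
      exact hne (by rw [h.2])
    · simp only [Expr.val, e1, e2, hk', e5, sub_eq_zero, Nat.cast_inj] at heq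
      refine ⟨by simpa using hk', ?_⟩
      rw [set_of_ne (by decide)]
      simp only [Expr.val, set_apply, and_self, if_true, hI]
      have : (Finset.univ.filter fun v : Fin G.n => (v : ℕ) < k + 1 ∧ ℓ v = v) =
          insert ⟨k, hk⟩ (Finset.univ.filter fun v : Fin G.n => (v : ℕ) < k ∧ ℓ v = v) := by
        ext v
        simp only [Finset.mem_filter, Finset.mem_univ, true_and, Finset.mem_insert]
        constructor
        · rintro ⟨h1, h2⟩
          by_cases h3 : (v : ℕ) = k
          · exact .inl (Fin.ext h3)
          · exact .inr ⟨by omega, h2⟩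
        · rintro (rfl | ⟨h1, h2⟩)
          · exact ⟨by simp, Fin.ext heq⟩
          · exact ⟨by omega, h2⟩
      rw [this, Finset.card_insert_of_notMem (by simp)]
      push_cast; ring
  · rintro t' hI -
    rw [hI, hℓ1.numComponents_eq]
    simp

/-- The new population is written over rows that are already processed. As q ≤ p, no row still to be
processed is destroyed, and for q = p the copy is the identity. -/
theorem det_keepRow {t : Memory} (ht : G.Stored t) {p q : ℕ} (hp : t 24 0 = p) (hq : t 25 0 = q)
    (hpq : q ≤ p) {B : Finset (Fin G.m)} (hB : G.Row (t 13) p B) :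
    Det x y keepRow t (fun t' => t' 25 0 = q + 1 ∧ G.Row (t' 13) q B ∧
      G.SameOutside q (t 13) (t' 13)) (3 * G.n + 3) := by
  obtain ⟨ℓ, hℓ1, hℓ2⟩ := hB
  refine (Det.seq (w := G.n * (1 + 2) + 2) (w' := 1) (Det.forLoop (fun k t' =>
    (∀ v : Fin G.n, t' 13 ((p : ℤ) * G.n + (v : ℕ)) = (ℓ v : ℕ)) ∧
    (∀ v : Fin G.n, (v : ℕ) < k → t' 13 ((q : ℤ) * G.n + (v : ℕ)) = (ℓ v : ℕ)) ∧
    G.SameOutside q (t 13) (t' 13)) G.n ?_ ?_ ?_) ?_).weaken (by omega)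
  · simp [Expr.val, ht.n_eq]
  · exact ⟨by simpa using hℓ2, by simp, fun i _ => by simp⟩
  · rintro k hk t' hf hk' ⟨hI, hJ, hO⟩
    have e1 : t' 24 0 = p := by rw [hf 24 (by decide), hp]
    have e2 : t' 0 0 = G.n := by rw [hf 0 (by decide), ht.n_eq]
    have e3 : t' 25 0 = q := by rw [hf 25 (by decide), hq]
    have e5 : t' 13 ((p : ℤ) * G.n + k) = (ℓ ⟨k, hk⟩ : ℕ) := hI ⟨k, hk⟩
    have hkn : (k : ℤ) < G.n := by exact_mod_cast hk
    refine Det.write ⟨by simpa using hk', fun v => ?_, fun v hv => ?_, fun i hi => ?_⟩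
    · rw [set_of_ne (by decide)]
      simp only [Expr.val, e1, e2, e3, hk', e5, set_apply, true_and]
      split_ifs with h
      · rcases hpq.eq_or_lt with rfl | hlt
        · have : (v : ℕ) = k := by exact_mod_cast add_left_cancel h
          congr 2; exact congrArg ℓ (Fin.ext this.symm)
        · exfalso
          have h1 : (q : ℤ) + 1 ≤ p := by exact_mod_cast hlt
          have h2 : (0 : ℤ) ≤ ((v : ℕ) : ℤ) := by positivity
          nlinarith
      · exact hI v
    · rw [set_of_ne (by decide)]
      simp only [Expr.val, e1, e2, e3, hk', e5, set_apply, true_and, add_right_inj, Nat.cast_inj]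
      split_ifs with h
      · congr 2; exact congrArg ℓ (Fin.ext h.symm)
      · exact hJ v (by omega)
    · have : i ≠ (q : ℤ) * G.n + k := by
        rintro rfl
        rcases hi with hi | hi
        · omega
        · linarith
      simpa [Expr.val, e1, e2, e3, hk', this] using hO i hi
  · rintro t' ⟨-, hJ, hO⟩ hf
    have e3 : t' 25 0 = q := by rw [hf 25 (by decide), hq]
    refine Det.write ⟨by simp [Expr.val, e3], ⟨ℓ, hℓ1, fun v => ?_⟩, fun i hi => ?_⟩
    · rw [set_of_ne (by decide), hJ v v.2]
    · rw [set_of_ne (by decide), hO i hi]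

end Multigraph

/-! ### Correctness of the routines for the population. -/

namespace Multigraph

open Prog

variable {G : Multigraph} {x y : ℝ}

/-- The rows of the array `r` represent the population `l`. -/
def Represents (G : Multigraph) (r : ℤ → ℤ) (l : List (Finset (Fin G.m))) : Prop :=
  ∀ p B, l[p]? = some B → G.Row r p B

/-- The old and new populations share array 13: the survivors occupy the first rows, the unprocessed
members the rows from p on. -/
theorem simulates_stepRow {t : Memory} (ht : G.Stored t) {s : ℕ} (hs : t 5 0 = s) {p : ℕ}
    (hp : t 24 0 = p) {out : List (Finset (Fin G.m))} (hq : t 25 0 = out.length)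
    (hpq : out.length ≤ p) {B : Finset (Fin G.m)} {l : List (Finset (Fin G.m))}
    (hrow : G.Represents (t 13) out) (hB : ∀ i A, (B :: l)[i]? = some A → G.Row (t 13) (p + i) A) :
    Simulates x y stepRow t (popStep s (B :: l, out)) (fun t' r => r.1 = l ∧
      t' 25 0 = r.2.length ∧ r.2.length ≤ p + 1 ∧ G.Represents (t' 13) r.2 ∧
      ∀ i A, l[i]? = some A → G.Row (t' 13) (p + 1 + i) A)
      (G.m * (4 * s + 4 * G.n + 9) + 7 * G.n + 9) := by
  have hB0 : G.Row (t 13) p B := hB 0 B rfl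
  have hl : ∀ i A, l[i]? = some A → G.Row (t 13) (p + 1 + i) A := fun i A hi => by
    have := hB (i + 1) A (by simpa using hi)
    rwa [show p + 1 + i = p + (i + 1) by ring]
  refine (Simulates.seq (w' := 7 * G.n + 7) (simulates_mutateRow ht hs hp hB0) ?_).weaken (by omega)
  rintro t1 ⟨l', A⟩ ⟨hA, hO⟩ hf
  simp only at hA
  have ht1 := ht.congr (hf 0 (by decide)) (hf 1 (by decide)) (hf 2 (by decide))
  have hp1 : t1 24 0 = p := by rw [hf 24 (by decide), hp]
  have hq1 : t1 25 0 = out.length := by rw [hf 25 (by decide), hq]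
  have hrow1 : G.Represents (t1 13) out := fun i A' hi => by
    have := (List.getElem?_eq_some_iff.1 hi).1
    exact hO.row (by omega) (hrow i A' hi)
  have hl1 : ∀ i A, l[i]? = some A → G.Row (t1 13) (p + 1 + i) A := fun i A' hi =>
    hO.row (by omega) (hl i A' hi)
  refine Det.simulates _ (Q := fun t' => t' 25 0 =
      (if 2 ≤ G.numComponents A then out ++ [A] else out).length ∧
      (if 2 ≤ G.numComponents A then out ++ [A] else out).length ≤ p + 1 ∧
      G.Represents (t' 13) (if 2 ≤ G.numComponents A then out ++ [A] else out) ∧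
      ∀ i A, l[i]? = some A → G.Row (t' 13) (p + 1 + i) A) ?_ fun t' h _ => ⟨rfl, h⟩
  refine ((det_countRow ht1 hp1 hA).seq (w' := 3 * G.n + 4) ?_).weaken (by omega)
  intro t2 h2 hf2
  have e13 : t2 13 = t1 13 := hf2 13 (by decide)
  refine Det.ite (w := 3 * G.n + 3) (fun hne => ?_) fun heq => ?_
  · have : ¬2 ≤ G.numComponents A := by
      intro h
      apply hne
      simp only [Expr.val, h2]
      rw [if_neg]
      exact_mod_cast not_lt.2 h
    simp only [if_neg this]
    refine (Det.skip ?_).weaken (by omega)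
    rw [e13]
    exact ⟨by rw [hf2 25 (by decide), hq1], by omega, hrow1, hl1⟩
  · have : 2 ≤ G.numComponents A := by
      by_contra h
      have h' : (G.numComponents A : ℤ) < 2 := by exact_mod_cast not_le.1 h
      simp [Expr.val, h2, h'] at heq
    simp only [if_pos this]
    refine (det_keepRow (ht1.congr (hf2 0 (by decide)) (hf2 1 (by decide)) (hf2 2 (by decide)))
      (by rw [hf2 24 (by decide), hp1]) (by rw [hf2 25 (by decide), hq1]) hpq
      (by rw [e13]; exact hA)).mono ?_
    rintro t3 ⟨h3, h4, h5⟩ -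
    rw [e13] at h5
    refine ⟨by simp [h3], by simpa using hpq, fun i A' hi => ?_, fun i A' hi =>
      h5.row (by omega) (hl1 i A' hi)⟩
    rw [List.getElem?_append] at hi
    split_ifs at hi with h6
    · exact h5.row (by omega) (hrow1 i A' hi)
    · rw [List.getElem?_singleton] at hi
      split_ifs at hi with h7
      obtain rfl : i = out.length := by omega
      rw [← Option.some_inj.1 hi]
      exact h4

theorem simulates_stepRows {t : Memory} (ht : G.Stored t) {s : ℕ} (hs : t 5 0 = s)
    {pop : List (Finset (Fin G.m))} (hS : t 14 0 = pop.length) (hq : t 25 0 = 0)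
    (hrow : G.Represents (t 13) pop) :
    Simulates x y (forLoop 24 (var 14) stepRow) t (CoinTree.iter (popStep s) pop.length (pop, []))
      (fun t' r => t' 25 0 = r.2.length ∧ G.Represents (t' 13) r.2)
      (pop.length * (G.m * (4 * s + 4 * G.n + 9) + 7 * G.n + 11) + 2) := by
  refine (Simulates.forLoop (w := G.m * (4 * s + 4 * G.n + 9) + 7 * G.n + 9) (fun k t' r =>
    r.1 = pop.drop k ∧ t' 25 0 = r.2.length ∧ r.2.length ≤ k ∧ G.Represents (t' 13) r.2 ∧
      ∀ i A, (pop.drop k)[i]? = some A → G.Row (t' 13) (k + i) A)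
    pop.length ?_ _ ?_ ?_).mono fun t' r h _ => ⟨h.2.1, h.2.2.2.1⟩
  · simp [Expr.val, hS]
  · refine ⟨rfl, by simpa using hq, le_rfl, fun p B h => by simp at h, fun i A hi => ?_⟩
    rw [set_of_ne (by decide), zero_add]
    exact hrow i A hi
  · rintro k hk t' ⟨l, out⟩ hf hk' ⟨hl, hq, hqk, hout, hrest⟩
    simp only at hl hq hqk hout hrest
    have hdrop := List.drop_eq_getElem_cons hk
    rw [hdrop] at hl hrest
    subst hl
    refine (simulates_stepRow (ht.congr (hf 0 (by decide)) (hf 1 (by decide)) (hf 2 (by decide)))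
      (by rw [hf 5 (by decide), hs]) hk' hq hqk hout hrest).mono ?_
    rintro t'' r ⟨h1, h2, h3, h4, h5⟩ hf'
    refine ⟨by rw [hf' 24 (by decide), hk'], h1, ?_, h3, ?_, ?_⟩
    · rwa [set_of_ne (by decide)]
    · rwa [set_of_ne (by decide)]
    · rwa [set_of_ne (by decide)]

theorem getElem?_flatten_replicate {α : Type*} (l : List α) (a p : ℕ) (b : α)
    (h : (List.replicate a l).flatten[p]? = some b) :
    l[p % l.length]? = some b ∧ p < a * l.length := by
  induction a generalizing p with
  | zero => simp at h
  | succ a ih =>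
    rw [List.replicate_succ, List.flatten_cons, List.getElem?_append] at h
    split_ifs at h with hp
    · rw [Nat.mod_eq_of_lt hp]
      exact ⟨h, by nlinarith⟩
    · obtain ⟨h1, h2⟩ := ih _ h
      rw [Nat.mod_eq_sub_mod (by omega)]
      exact ⟨h1, by rw [Nat.succ_mul]; omega⟩

theorem copies_le (N S : ℕ) : copies N S ≤ N := Nat.div_le_self _ _

/-- During the copy, cell i equals the original cell i mod S n, so row p becomes a copy of row p mod
S. The inverse weight D may have many digits, but its multiplier is at most N, which bounds the
work. -/
theorem det_replicate {t : Memory} (ht : G.Stored t) {N D : ℕ} (hN : t 11 0 = N)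
    {pop : List (Finset (Fin G.m))} (hS : t 14 0 = pop.length) (hD : t 15 0 = D)
    (hrow : G.Represents (t 13) pop) :
    Det x y Prog.replicate t (fun t' => t' 14 0 = (replicated N pop).length ∧
      t' 15 0 = (D * copies N pop.length : ℕ) ∧ G.Represents (t' 13) (replicated N pop))
      (3 * (N * G.n) + 8 * N + 11) := by
  set a := copies N pop.length with ha
  set S := pop.length with hSdef
  have haN : a ≤ N := copies_le _ _
  have haS : a * S ≤ N := copies_mul_le _ _
  have hcnt : (a - 1) * (S * G.n) ≤ N * G.n := by
    rw [← mul_assoc]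
    exact Nat.mul_le_mul_right _ ((Nat.mul_le_mul_right _ (Nat.sub_le _ _)).trans haS)
  have h1 : Det x y (assign 16 (.div (var 11) (.add (var 14) (.lt (var 14) (.lit 1))))) t
      (fun t' => t' = t.set 16 0 a) 1 := by
    refine .write ?_
    simp only [Expr.val, hN, hS, ha, copies]
    congr 1
    rcases Nat.eq_zero_or_pos S with h | h
    · simp [h]
    · rw [if_neg (by exact_mod_cast not_lt.2 h), max_eq_left (by omega)]
      simp
  refine (h1.seq (w' := 3 * (N * G.n) + 8 * N + 10) ?_).weaken (by omega)
  rintro _ rfl -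
  refine (Det.seq (w := ((a - 1) * (S * G.n)) * (1 + 2) + 2) (w' := 8 * N + 8)
    (Q := fun t' => ∀ i : ℕ, i < S * G.n + (a - 1) * (S * G.n) →
      t' 13 i = t 13 ((i % (S * G.n) : ℕ) : ℤ)) ?_ ?_).weaken (by omega)
  · refine Det.forLoop (fun k t' => ∀ i : ℕ, i < S * G.n + k →
      t' 13 i = t 13 ((i % (S * G.n) : ℕ) : ℤ)) _ ?_ ?_ ?_
    · simp only [Expr.val, set_apply]
      simp only [show ¬(14 = 29) by decide, show ¬(14 = 16) by decide, show ¬(0 = 29) by decide,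
        show ¬(0 = 16) by decide, show ¬(16 = 29) by decide, false_and, if_false, and_self, if_true,
        hS, ht.n_eq]
      rcases Nat.eq_zero_or_pos a with h | h
      · rw [h]
        simp
        positivity
      · have : ((a : ℤ) - 1) = ((a - 1 : ℕ) : ℤ) := by push_cast [h]; ring
        rw [this]
        norm_cast
    · intro i hi
      rw [set_of_ne (by decide), set_of_ne (by decide), Nat.mod_eq_of_lt (by simpa using hi)]
    · intro k hk t' hf hk' hI
      have e1 : t' 0 0 = G.n := by rw [hf 0 (by decide)]; simpa using ht.n_eq
      have e2 : t' 14 0 = S := by rw [hf 14 (by decide)]; simpa using hS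
      have hpos : 0 < S * G.n := by
        rcases Nat.eq_zero_or_pos (S * G.n) with h | h
        · rw [h] at hk; simp at hk
        · exact h
      refine Det.write ⟨by simpa using hk', fun i hi => ?_⟩
      rw [set_of_ne (by decide)]
      simp only [Expr.val, e1, e2, hk', set_apply, true_and]
      split_ifs with h
      · have : i = S * G.n + k := by exact_mod_cast h
        rw [this, Nat.add_mod_left]
        exact hI k (by omega)
      · refine hI i ?_
        have : i ≠ S * G.n + k := by
          rintro rfl
          push_cast at h
          exact h rfl
        omega
  · intro t2 h2 hf2
    have e14 : t2 14 0 = S := by rw [hf2 14 (by decide)]; simpa using hS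
    have e15 : t2 15 0 = D := by rw [hf2 15 (by decide)]; simpa using hD
    have e16 : t2 16 0 = a := by rw [hf2 16 (by decide)]; simp
    refine ((Det.mulBy (a := 14) (a : ℤ) N (by decide) (fun r => ?_) (by simpa using haN)).seq
      (w' := 4 * N + 4) ?_).weaken (by omega)
    · simpa [Expr.val] using e16
    intro t3 h3 hf3
    refine (Det.mulBy (a := 15) (a : ℤ) N (by decide) (fun r => ?_) (by simpa using haN)).mono ?_
    · simpa [Expr.val, hf3 16 (by decide)] using e16
    intro t4 h4 hf4
    refine ⟨?_, ?_, ?_⟩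
    · rw [hf4 14 (by decide), h3, e14, length_replicated]; push_cast; ring
    · rw [h4, hf3 15 (by decide), e15]; push_cast; ring
    · rw [hf4 13 (by decide), hf3 13 (by decide)]
      intro p B hp
      obtain ⟨h5, h6⟩ := getElem?_flatten_replicate _ _ _ _ hp
      obtain ⟨ℓ, h7, h8⟩ := hrow _ _ h5
      refine ⟨ℓ, h7, fun v => ?_⟩
      have hv := v.2
      rw [← hSdef] at h6 h8
      have hSpos : 0 < S := by
        rcases Nat.eq_zero_or_pos S with h | h
        · rw [h] at h6; simp at h6
        · exact h
      have e := h2 (p * G.n + v) ?_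
      · have hm : (p * G.n + v) % (S * G.n) = (p % S) * G.n + v := by
          have h9 : (p % S + 1) * G.n ≤ S * G.n := Nat.mul_le_mul_right _ (Nat.mod_lt _ hSpos)
          conv_lhs => rw [← Nat.div_add_mod p S]
          rw [show (S * (p / S) + p % S) * G.n + v = S * G.n * (p / S) + ((p % S) * G.n + v) by ring,
            Nat.mul_add_mod, Nat.mod_eq_of_lt (by nlinarith)]
        rw [hm] at e
        push_cast at e h8 ⊢
        rw [e, h8]
      · have h10 : (p + 1) * G.n ≤ (a * S) * G.n := Nat.mul_le_mul_right _ h6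
        have h11 : S * G.n + (a - 1) * (S * G.n) = (a * S) * G.n := by
          have : a = (a - 1) + 1 := by
            rcases Nat.eq_zero_or_pos a with h | h
            · rw [← ha, h] at h6; simp at h6
            · omega
          conv_rhs => rw [this]
          ring
        rw [h11]
        nlinarith

/-- The memory contains the population and its weight. -/
def Holds (G : Multigraph) (t : Memory) (st : List (Finset (Fin G.m)) × ℕ) : Prop :=
  t 14 0 = st.1.length ∧ t 15 0 = st.2 ∧ G.Represents (t 13) st.1

theorem simulates_runLevel {t : Memory} (ht : G.Stored t) {s N : ℕ} (hs : t 5 0 = s)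
    (hN : t 11 0 = N) {st : List (Finset (Fin G.m)) × ℕ} (hst : G.Holds t st) :
    Simulates x y runLevel t (level s N st) (fun t' r => G.Holds t' r)
      (N * (G.m * (4 * s + 4 * G.n + 9) + 10 * G.n + 19) + 15) := by
  obtain ⟨h1, h2, h3⟩ := hst
  have hlen : (replicated N st.1).length ≤ N := by
    rw [length_replicated]; exact copies_mul_le _ _
  have hw := Nat.mul_le_mul_right (G.m * (4 * s + 4 * G.n + 9) + 7 * G.n + 11) hlen
  have hw' : N * (G.m * (4 * s + 4 * G.n + 9) + 10 * G.n + 19) =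
    N * (G.m * (4 * s + 4 * G.n + 9) + 7 * G.n + 11) + 3 * (N * G.n) + 8 * N := by ring
  refine (Simulates.det_seq (det_replicate ht hN h1 h2 h3)
    (w' := 1 + ((N * (G.m * (4 * s + 4 * G.n + 9) + 7 * G.n + 11) + 2) + 1)) ?_).weaken (by omega)
  rintro t1 ⟨h4, h5, h6⟩ hf1
  have h7 : Det x y (assign 25 (.lit 0)) t1 (fun t' => t' = t1.set 25 0 0) 1 := .write rfl
  refine Simulates.det_seq h7 ?_
  rintro _ rfl -
  refine Simulates.seq (R := fun t' r => t' 25 0 = r.2.length ∧ G.Represents (t' 13) r.2 ∧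
      t' 15 0 = (st.2 * copies N st.1.length : ℕ)) (w' := 1)
    (((simulates_stepRows (ht.congr ?_ ?_ ?_) (s := s) ?_ (pop := replicated N st.1) ?_ ?_ ?_).mono
      ?_).weaken (by omega)) ?_
  · rw [set_of_ne (by decide), hf1 0 (by decide)]
  · rw [set_of_ne (by decide), hf1 1 (by decide)]
  · rw [set_of_ne (by decide), hf1 2 (by decide)]
  · rw [set_of_ne (by decide), hf1 5 (by decide), hs]
  · rw [set_of_ne (by decide), h4]
  · simp
  · rwa [set_of_ne (by decide)]
  · rintro t2 r ⟨h8, h9⟩ hf2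
    exact ⟨h8, h9, by rw [hf2 15 (by decide), set_of_ne (by decide), h5]⟩
  · rintro t2 r ⟨h8, h9, h10⟩ hf2
    refine Det.simulates _ (Q := fun t' => G.Holds t' (r.2, st.2 * copies N st.1.length)) ?_
      fun t' h _ => h
    refine .write ⟨by simp [Expr.val, h8], ?_, ?_⟩
    · rw [set_of_ne (by decide), h10]
    · rwa [set_of_ne (by decide)]

theorem simulates_runLevels {t : Memory} (ht : G.Stored t) {s N L : ℕ} (hs : t 5 0 = s)
    (hN : t 11 0 = N) (hL : t 10 0 = L) {st : List (Finset (Fin G.m)) × ℕ} (hst : G.Holds t st) :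
    Simulates x y (.loop (var 10) runLevel) t (CoinTree.iter (level s N) L st)
      (fun t' r => G.Holds t' r)
      (L * (N * (G.m * (4 * s + 4 * G.n + 9) + 10 * G.n + 19) + 16) + 1) := by
  refine Simulates.loop (fun _ t' r => G.Holds t' r) L ?_ st hst ?_
  · simp [Expr.val, hL]
  · intro i _ t' r hf hr
    exact simulates_runLevel (ht.congr (hf 0 (by decide)) (hf 1 (by decide)) (hf 2 (by decide)))
      (by rw [hf 5 (by decide), hs]) (by rw [hf 11 (by decide), hN]) hr

end Multigraph

/-! ### Constants and the quantities derived from them. -/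

/-- The constants of the program, which depend on the parameters `x` and `y`. -/
structure Settings where
  /-- factor of the scale -/
  scaleFactor : ℕ
  /-- exponent of the scale -/
  scaleExponent : ℕ
  /-- factor of the maximal number of levels -/
  levelFactor : ℕ
  /-- factor of the population size -/
  sizeFactor : ℕ
  /-- exponent of the population size -/
  sizeExponent : ℕ
  /-- whether `(x - 1) (y - 1) = 1` -/
  trivial : Bool
  /-- whether the difference is to be computed -/
  difference : Bool

namespace Settings

/-- The number of binary places. -/
def places (c : Settings) (T : ℕ) : ℕ := Nat.clog 2 (c.scaleFactor * T ^ c.scaleExponent)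

/-- The scale. -/
def scale (c : Settings) (T : ℕ) : ℕ := 2 ^ c.places T

/-- The scaled parameter `y`. -/
noncomputable def scaledY (c : Settings) (y : ℝ) (T : ℕ) : ℤ := ⌊(2 : ℝ) ^ c.places T * y⌋

/-- The number of levels. -/
noncomputable def numLevels (c : Settings) (y : ℝ) (T : ℕ) : ℕ :=
  ((Finset.range (c.levelFactor * c.scale T)).filter fun i =>
    ¬c.scaledY y T * ((c.scale T : ℤ) - 1) ^ (i + 1) < (c.scale T : ℤ) * c.scale T ^ (i + 1)).card

/-- The population size. -/
def popSize (c : Settings) (T : ℕ) : ℕ := c.sizeFactor * c.scale T ^ c.sizeExponent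

/-- The scaled parameter `(x - 1) (y - 1)`. -/
noncomputable def scaledQ (c : Settings) (x y : ℝ) (T : ℕ) : ℤ :=
  if c.trivial then c.scale T
  else (⌊(2 : ℝ) ^ c.places T * x⌋ - c.scale T) * (c.scaledY y T - c.scale T) / c.scale T

/-- The scaled contribution of a graph with `r` components. -/
noncomputable def contribution (c : Settings) (x y : ℝ) (T r : ℕ) : ℤ :=
  if c.places T < r then 0 else (c.scale T : ℤ) ^ c.places T -
    c.scaledQ x y T ^ (r - 1) * c.scale T ^ (c.places T + 1 - r)

end Settings

/-! ### Setup and output routines. -/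

namespace Prog

/-- Compute the scale. -/
def setupScale (c : Settings) : Prog :=
  .seq (assign 31 (.lit c.scaleFactor)) <|
  .seq (.loop (.lit c.scaleExponent)
    (mulBy 31 (.add (.add (.read 0 (.lit 0)) (.read 0 (.lit 1))) (.read 0 (.lit 2))))) <|
  .seq (assign 4 (.lit 1)) <| .seq (assign 5 (.lit 0)) <|
  -- With B the threshold in array 31, doubling stops at the first power of 2 that is at least B. B
  -- rounds suffice because B ≤ 2^B; the remaining ones are idle.
  .loop (var 31) <| .ite (.lt (var 4) (var 31))
    (.seq (assign 4 (.add (var 4) (var 4))) (assign 5 (.add (var 5) (.lit 1)))) .skip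

/-- Compute the number of levels. -/
def setupLevels (c : Settings) : Prog :=
  .seq (assign 8 (var 7)) <| .seq (assign 9 (var 4)) <| .seq (assign 10 (.lit 0)) <|
  .seq (assign 30 (.lit c.levelFactor)) <| .seq (mulBy 30 (var 4)) <|
  -- With v = Y/P this counts the i for which v (1 - 1/P)^(i+1) ≥ 1, in integer arithmetic.
  .loop (var 30) <| .seq (mulBy 8 (.sub (var 4) (.lit 1))) <| .seq (mulBy 9 (var 4)) <|
    .ite (.lt (var 8) (var 9)) .skip (assign 10 (.add (var 10) (.lit 1)))

/-- Compute the population size. -/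
def setupSize (c : Settings) : Prog :=
  .seq (assign 11 (.lit c.sizeFactor)) (.loop (.lit c.sizeExponent) (mulBy 11 (var 4)))

/-- Compute the scaled parameter `(x - 1) (y - 1)`. -/
def setupQ (c : Settings) : Prog :=
  .seq (assign 26 (.sub (var 6) (var 4))) <| .seq (mulBy 26 (.sub (var 7) (var 4))) <|
  match c.trivial with
  | true => assign 26 (var 4)
  | false => assign 26 (.div (var 26) (var 4))

/-- The initial population. -/
def setupPop : Prog :=
  .seq (assign 14 (.lit 1)) <| .seq (assign 15 (.lit 1)) <|
  forLoop 22 numVertices (.write 13 (var 22) (var 22))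

/-- Compute all parameters. -/
def setup (c : Settings) : Prog :=
  .seq (setupScale c) <| .seq (assign 6 (.paramX (var 5))) <| .seq (assign 7 (.paramY (var 5))) <|
  .seq (setupLevels c) <| .seq (setupSize c) <| .seq (setupQ c) setupPop

/-- Compute the contribution of the current row. -/
def addRow : Prog :=
  .seq countRow <| .ite (.lt (var 5) (var 23)) .skip <|
  -- The power of the rounded Q has denominator P^(r-1), for r components; s+1-r further factors P
  -- bring all rows to the common denominator P^s, also that of the term 1 in array 32.
  .seq (assign 28 (.lit 1)) <| .seq (.loop (.sub (var 23) (.lit 1)) (mulBy 28 (var 26))) <|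
  .seq (.loop (.sub (.add (var 5) (.lit 1)) (var 23)) (mulBy 28 (var 4))) <|
  assign 27 (.add (var 27) (.sub (var 32) (var 28)))

/-- Sum up the contributions of all rows. -/
def collect : Prog :=
  .seq (assign 27 (.lit 0)) <| .seq (assign 32 (.lit 1)) <|
  .seq (.loop (var 5) (mulBy 32 (var 4))) <| forLoop 24 (var 14) addRow

/-- Compute the output. -/
def finish (c : Settings) : Prog :=
  .seq (assign 9 (var 15)) <| .seq (.loop (var 5) (mulBy 9 (var 4))) <|
  .seq (match c.difference with
    | true => assign 8 (var 27)
    | false => assign 8 (.sub (var 9) (var 27))) <|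
  -- The explicit factor v^m/(v-1)^(n-1) with v = Y/P is Y^m P^(n-1) over P^m (Y-P)^(n-1).
  .seq (.loop numEdges (.seq (mulBy 8 (var 7)) (mulBy 9 (var 4)))) <|
  .seq (.loop (.sub numVertices (.lit 1))
    (.seq (mulBy 8 (var 4)) (mulBy 9 (.sub (var 7) (var 4))))) <|
  .seq (.write 3 (.lit 0) (var 8)) (.write 3 (.lit 1) (var 9))

/-- The approximation scheme. -/
def scheme (c : Settings) : Prog :=
  .seq (setup c) <| .seq (.loop (var 10) runLevel) <| .seq collect (finish c)

theorem scheme_gentle (c : Settings) : (scheme c).Gentle := by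
  obtain ⟨_, _, _, _, _, a, b⟩ := c
  cases a <;> cases b <;>
  simp [scheme, setup, setupScale, setupLevels, setupSize, setupQ, setupPop, collect, addRow,
    finish, runLevel, replicate, stepRow, mutateRow, countRow, keepRow, edgeRow, tossCoin, mergeRow,
    mulBy, forLoop, Gentle, Expr.ParamFree, Expr.Assignable, Expr.Gentle]

end Prog

/-! ### Correctness of the setup. -/

namespace Multigraph

open Prog

variable {G : Multigraph} {x y : ℝ} {c : Settings} {Z : ℕ}

theorem det_setupScale {t : Memory} (ht : G.Stored t) {k : ℕ} (hk : t 0 2 = k)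
    (hZ1 : G.n + G.m + k ≤ Z) (hZ2 : c.scaleFactor * (G.n + G.m + k) ^ c.scaleExponent ≤ Z) :
    Det x y (setupScale c) t (fun t' => t' 5 0 = c.places (G.n + G.m + k) ∧
      t' 4 0 = c.scale (G.n + G.m + k)) (c.scaleExponent * (4 * Z + 5) + 4 * Z + 5) := by
  set T := G.n + G.m + k
  set B := c.scaleFactor * T ^ c.scaleExponent with hB
  have h1 : Det x y (assign 31 (.lit c.scaleFactor)) t
    (fun t' => t' = t.set 31 0 c.scaleFactor) 1 := .write rfl
  refine (h1.seq (w' := c.scaleExponent * (4 * Z + 5) + 4 * Z + 4) ?_).weaken (by omega)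
  rintro _ rfl -
  refine (Det.seq (w := c.scaleExponent * (4 * Z + 4 + 1) + 1) (w' := 4 * Z + 3)
    (Det.loop (fun i t' => t' 31 0 = (c.scaleFactor * T ^ i : ℕ)) c.scaleExponent ?_ ?_ ?_)
    ?_).weaken (by rw [show 4 * Z + 4 + 1 = 4 * Z + 5 from rfl]; omega)
  · simp [Expr.val]
  · simp
  · intro i _ t' hf hI
    have e : t' 0 = t 0 := by rw [hf 0 (by decide), set_of_ne (by decide)]
    refine (Det.mulBy (a := 31) (T : ℤ) Z (by decide) (fun r => ?_) (by simpa using hZ1)).mono ?_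
    · simp only [Expr.val, set_of_ne (show 0 ≠ 12 by decide), e, ht.n_eq, ht.m_eq, hk]
      push_cast [T]; ring
    · intro t'' h _
      rw [h, hI]; push_cast; ring
  · intro t2 h2 hf2
    have h3 : Det x y (assign 4 (.lit 1)) t2 (fun t' => t' = t2.set 4 0 1) 1 := .write rfl
    refine (h3.seq (w' := 4 * Z + 2) ?_).weaken (by omega)
    rintro _ rfl -
    have h4 : Det x y (assign 5 (.lit 0)) (t2.set 4 0 1)
      (fun t' => t' = (t2.set 4 0 1).set 5 0 0) 1 := .write rfl
    refine (h4.seq (w' := 4 * Z + 1) ?_).weaken (by omega)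
    rintro _ rfl -
    refine ((Det.loop (w := 3) (fun i t' => t' 5 0 = (min i (Nat.clog 2 B) : ℕ) ∧
      t' 4 0 = (2 ^ min i (Nat.clog 2 B) : ℕ)) B ?_ ?_ ?_).weaken (by omega)).mono ?_
    · simp only [Expr.val, set_of_ne (show 31 ≠ 5 by decide), set_of_ne (show 31 ≠ 4 by decide), h2]
      exact Int.toNat_natCast _
    · simp
    · rintro i hi t' hf ⟨h5, h6⟩
      have e : t' 31 0 = B := by
        rw [hf 31 (by decide), set_of_ne (by decide), set_of_ne (by decide)]; exact h2
      have hlt : t' 4 0 < t' 31 0 ↔ i < Nat.clog 2 B := by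
        rw [h6, e, Nat.cast_lt]
        rcases lt_or_ge i (Nat.clog 2 B) with h | h
        · rw [min_eq_left h.le]
          exact ⟨fun _ => h, fun _ => (Nat.lt_clog_iff_pow_lt (by norm_num)).1 h⟩
        · rw [min_eq_right h]
          exact ⟨fun h' => absurd h' (not_lt.2 (Nat.le_pow_clog (by norm_num) B)),
            fun h' => absurd h' (not_lt.2 h)⟩
      refine Det.ite (w := 2) (fun hne => ?_) fun heq => (Det.skip ?_).weaken (by omega)
      · have hi' : i < Nat.clog 2 B := by
          by_contra h
          simp [Expr.val, mt hlt.1 h] at hne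
        have h7 : Det x y (assign 4 (.add (var 4) (var 4))) t'
          (fun u => u = t'.set 4 0 (t' 4 0 + t' 4 0)) 1 := .write rfl
        refine h7.seq (w' := 1) ?_
        rintro _ rfl -
        refine .write ?_
        rw [min_eq_left hi'.le] at h5 h6
        rw [min_eq_left hi']
        simp [Expr.val, h5, h6, pow_succ]
        ring
      · have hi' : Nat.clog 2 B ≤ i := by
          by_contra h
          simp [Expr.val, hlt.2 (not_le.1 h)] at heq
        rw [min_eq_right hi'] at h5 h6
        rw [min_eq_right (by omega)]
        exact ⟨h5, h6⟩
    · rintro t' ⟨h5, h6⟩ -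
      have : min B (Nat.clog 2 B) = c.places T := by
        rw [min_eq_right]; · rfl
        exact Nat.clog_le_of_le_pow Nat.lt_two_pow_self.le
      rw [this] at h5 h6
      exact ⟨h5, h6⟩

theorem det_setupLevels {t : Memory} {T : ℕ} (h4 : t 4 0 = c.scale T)
    (h7 : t 7 0 = c.scaledY y T) (hZ1 : c.scale T ≤ Z) (hZ2 : c.levelFactor * c.scale T ≤ Z) :
    Det x y (setupLevels c) t (fun t' => t' 10 0 = c.numLevels y T)
      (8 * Z ^ 2 + 15 * Z + 9) := by
  set P := c.scale T with hP
  set Y := c.scaledY y T with hY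
  have hP1 : 1 ≤ P := Nat.one_le_two_pow
  have hP1' : (1 : ℤ) ≤ P := by exact_mod_cast hP1
  have e1 : Det x y (assign 8 (var 7)) t (fun t' => t' = t.set 8 0 Y) 1 :=
    .write (by simp [Expr.val, h7])
  refine (e1.seq (w' := 8 * Z ^ 2 + 15 * Z + 8) ?_).weaken (by omega)
  rintro _ rfl -
  have e2 : Det x y (assign 9 (var 4)) (t.set 8 0 Y) (fun t' => t' = (t.set 8 0 Y).set 9 0 P) 1 :=
    .write (by simp [Expr.val, h4])
  refine (e2.seq (w' := 8 * Z ^ 2 + 15 * Z + 7) ?_).weaken (by omega)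
  rintro _ rfl -
  have e3 : Det x y (assign 10 (.lit 0)) ((t.set 8 0 Y).set 9 0 P)
    (fun t' => t' = ((t.set 8 0 Y).set 9 0 P).set 10 0 0) 1 := .write rfl
  refine (e3.seq (w' := 8 * Z ^ 2 + 15 * Z + 6) ?_).weaken (by omega)
  rintro _ rfl -
  have e4 : Det x y (assign 30 (.lit c.levelFactor)) (((t.set 8 0 Y).set 9 0 P).set 10 0 0)
    (fun t' => t' = (((t.set 8 0 Y).set 9 0 P).set 10 0 0).set 30 0 c.levelFactor) 1 := .write rfl
  refine (e4.seq (w' := 8 * Z ^ 2 + 15 * Z + 5) ?_).weaken (by omega)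
  rintro _ rfl -
  refine ((Det.mulBy (a := 30) (P : ℤ) Z (by decide) (fun r => ?_) (by simpa using hZ1)).seq
    (w' := Z * (8 * Z + 11) + 1) ?_).weaken (by nlinarith)
  · simp [Expr.val, h4]
  intro t1 h1 hf1
  simp only [set_apply, and_self, if_true] at h1
  have hloop := Det.loop (x := x) (y := y) (s := t1) (w := 8 * Z + 10) (e := var 30)
    (c := .seq (mulBy 8 (.sub (var 4) (.lit 1))) <| .seq (mulBy 9 (var 4)) <|
      .ite (.lt (var 8) (var 9)) .skip (assign 10 (.add (var 10) (.lit 1))))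
    (fun i t' => t' 8 0 = Y * ((P : ℤ) - 1) ^ i ∧ t' 9 0 = (P : ℤ) * P ^ i ∧
      t' 10 0 = (((Finset.range i).filter fun i =>
        ¬Y * ((P : ℤ) - 1) ^ (i + 1) < (P : ℤ) * P ^ (i + 1)).card : ℕ))
    (c.levelFactor * P) ?_ ?_ ?_
  · refine (hloop.weaken ?_).mono fun t' h _ => h.2.2
    have := Nat.mul_le_mul_right (8 * Z + 10 + 1) hZ2
    nlinarith
  · simp only [Expr.val, h1]
    norm_cast
  · refine ⟨?_, ?_, ?_⟩
    · rw [hf1 8 (by decide)]; simp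
    · rw [hf1 9 (by decide)]; simp
    · rw [hf1 10 (by decide)]; simp
  · rintro i _ t' hf ⟨h5, h6, h8⟩
    have e5 : t' 4 0 = P := by rw [hf 4 (by decide), hf1 4 (by decide)]; simpa using h4
    refine ((Det.mulBy (a := 8) ((P : ℤ) - 1) Z (by decide) (fun r => ?_) (by omega)).seq
      (w' := 4 * Z + 6) ?_).weaken (by omega)
    · simp [Expr.val, e5]
    intro t2 h9 hf2
    have e6 : t2 4 0 = P := by rw [hf2 4 (by decide), e5]
    refine ((Det.mulBy (a := 9) (P : ℤ) Z (by decide) (fun r => ?_) (by simpa using hZ1)).seq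
      (w' := 2) ?_).weaken (by omega)
    · simp [Expr.val, e6]
    intro t3 h10 hf3
    have e8 : t3 8 0 = Y * ((P : ℤ) - 1) ^ (i + 1) := by
      rw [hf3 8 (by decide), h9, h5]; ring
    have e9 : t3 9 0 = (P : ℤ) * P ^ (i + 1) := by
      rw [h10, hf2 9 (by decide), h6]; ring
    have e10 : t3 10 0 = t' 10 0 := by rw [hf3 10 (by decide), hf2 10 (by decide)]
    refine Det.ite (w := 1) (fun hne => Det.skip ⟨e8, e9, ?_⟩) fun heq => Det.write ⟨?_, ?_, ?_⟩
    · have : Y * ((P : ℤ) - 1) ^ (i + 1) < (P : ℤ) * P ^ (i + 1) := by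
        by_contra h
        simp [Expr.val, e8, e9, h] at hne
      rw [e10, h8, Finset.range_add_one, Finset.filter_insert, if_neg (not_not.2 this)]
    · simpa using e8
    · simpa using e9
    · have : ¬Y * ((P : ℤ) - 1) ^ (i + 1) < (P : ℤ) * P ^ (i + 1) := by
        intro h
        simp [Expr.val, e8, e9, h] at heq
      simp only [Expr.val, set_apply, and_self, if_true]
      rw [e10, h8, Finset.range_add_one, Finset.filter_insert, if_pos this,
        Finset.card_insert_of_notMem (by simp)]
      push_cast; ring

theorem det_loop_mulBy {t : Memory} {a : ℕ} {e e' : Expr} (n : ℕ) (he : (e.val x y t).toNat = n)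
    (v : ℤ) (ha : a ≠ 12) (he' : ∀ t', Frame (mulBy a e') t t' → ∀ r, e'.val x y (t'.set 12 0 r) = v)
    (hv : v.natAbs ≤ Z) :
    Det x y (.loop e (mulBy a e')) t (fun t' => t' a 0 = t a 0 * v ^ n) (n * (4 * Z + 5) + 1) := by
  refine Det.loop (w := 4 * Z + 4) (fun i t' => t' a 0 = t a 0 * v ^ i) n he (by simp) ?_
  intro i _ t' hf hI
  refine (Det.mulBy v Z ha (he' t' hf) hv).mono fun t'' h _ => ?_
  rw [h, hI, pow_succ]; ring

theorem det_setupSize {t : Memory} {T : ℕ} (h4 : t 4 0 = c.scale T) (hZ1 : c.scale T ≤ Z) :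
    Det x y (setupSize c) t (fun t' => t' 11 0 = c.popSize T)
      (c.sizeExponent * (4 * Z + 5) + 2) := by
  have e1 : Det x y (assign 11 (.lit c.sizeFactor)) t
    (fun t' => t' = t.set 11 0 c.sizeFactor) 1 := .write rfl
  refine (e1.seq (w' := c.sizeExponent * (4 * Z + 5) + 1) ?_).weaken (by omega)
  rintro _ rfl -
  refine (det_loop_mulBy c.sizeExponent (by simp [Expr.val]) (c.scale T : ℤ) (by decide)
    (fun t' hf r => ?_) (by simpa using hZ1)).mono fun t' h _ => ?_
  · simpa [Expr.val, hf 4 (by decide)] using h4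
  · rw [h]; simp [Settings.popSize]

theorem det_setupQ {t : Memory} {T : ℕ} (h4 : t 4 0 = c.scale T)
    (h6 : t 6 0 = ⌊(2 : ℝ) ^ c.places T * x⌋) (h7 : t 7 0 = c.scaledY y T)
    (hZ1 : (c.scaledY y T - c.scale T).natAbs ≤ Z) :
    Det x y (setupQ c) t (fun t' => t' 26 0 = c.scaledQ x y T) (4 * Z + 6) := by
  have e1 : Det x y (assign 26 (.sub (var 6) (var 4))) t
    (fun t' => t' = t.set 26 0 (⌊(2 : ℝ) ^ c.places T * x⌋ - c.scale T)) 1 :=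
    .write (by simp [Expr.val, h6, h4])
  refine (e1.seq (w' := 4 * Z + 5) ?_).weaken (by omega)
  rintro _ rfl -
  refine (Det.mulBy (a := 26) (c.scaledY y T - c.scale T) Z (by decide) (fun r => ?_) hZ1).seq
    (w' := 1) ?_
  · simp [Expr.val, h7, h4]
  intro t1 h1 hf1
  have e4 : t1 4 0 = c.scale T := by rw [hf1 4 (by decide)]; simpa using h4
  rcases hc : c.trivial
  · refine Det.write ?_
    simp [Expr.val, h1, e4, Settings.scaledQ, hc]
  · refine Det.write ?_
    simp [Expr.val, e4, Settings.scaledQ, hc]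

theorem det_setupPop {t : Memory} (ht : G.Stored t) :
    Det x y setupPop t (fun t' => G.Holds t' ([∅], 1)) (3 * G.n + 4) := by
  have e1 : Det x y (assign 14 (.lit 1)) t (fun t' => t' = t.set 14 0 1) 1 := .write rfl
  refine (e1.seq (w' := 3 * G.n + 3) ?_).weaken (by omega)
  rintro _ rfl -
  have e2 : Det x y (assign 15 (.lit 1)) (t.set 14 0 1)
    (fun t' => t' = (t.set 14 0 1).set 15 0 1) 1 := .write rfl
  refine (e2.seq (w' := G.n * (1 + 2) + 2) ?_).weaken (by omega)
  rintro _ rfl -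
  refine (Det.forLoop (fun k t' => ∀ i : ℕ, i < k → t' 13 i = i) G.n ?_ ?_ ?_).mono ?_
  · simp [Expr.val, ht.n_eq]
  · simp
  · intro k _ t' _ hk' hI
    refine Det.write ⟨by simpa using hk', fun i hi => ?_⟩
    simp only [Expr.val, hk', set_apply, show ¬(13 = 22) by decide, false_and, if_false, true_and,
      Nat.cast_inj]
    split_ifs with h
    · rw [h]
    · exact hI i (by omega)
  · intro t' h hf
    refine ⟨?_, ?_, fun p B hp => ?_⟩
    · rw [hf 14 (by decide)]; simp
    · rw [hf 15 (by decide)]; simp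
    · rw [List.getElem?_singleton] at hp
      split_ifs at hp with h0
      subst h0
      rw [← Option.some_inj.1 hp]
      exact ⟨id, labels_empty, fun v => by simpa using h v v.2⟩

/-- The memory contains the parameters of the program. -/
structure Ready (c : Settings) (x y : ℝ) (T : ℕ) (t : Memory) : Prop where
  places_eq : t 5 0 = c.places T
  scale_eq : t 4 0 = c.scale T
  scaledY_eq : t 7 0 = c.scaledY y T
  popSize_eq : t 11 0 = c.popSize T
  scaledQ_eq : t 26 0 = c.scaledQ x y T

theorem Ready.of_frame {T : ℕ} {t t' : Memory} {P : Prog} (h : Ready c x y T t)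
    (hf : Frame P t t') (hP : ∀ a ∈ [4, 5, 7, 11, 26], a ∉ P.writes) : Ready c x y T t' := by
  refine ⟨?_, ?_, ?_, ?_, ?_⟩
  · rw [hf 5 (hP 5 (by simp)), h.places_eq]
  · rw [hf 4 (hP 4 (by simp)), h.scale_eq]
  · rw [hf 7 (hP 7 (by simp)), h.scaledY_eq]
  · rw [hf 11 (hP 11 (by simp)), h.popSize_eq]
  · rw [hf 26 (hP 26 (by simp)), h.scaledQ_eq]

/-- All loop counts are at most `Z`. -/
structure Bounded (c : Settings) (x y : ℝ) (G : Multigraph) (k Z : ℕ) : Prop where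
  input_le : G.n + G.m + k ≤ Z
  threshold_le : c.scaleFactor * (G.n + G.m + k) ^ c.scaleExponent ≤ Z
  scale_le : c.scale (G.n + G.m + k) ≤ Z
  levels_le : c.levelFactor * c.scale (G.n + G.m + k) ≤ Z
  scaledY_le : (c.scaledY y (G.n + G.m + k)).natAbs ≤ Z
  sub_le : (c.scaledY y (G.n + G.m + k) - c.scale (G.n + G.m + k)).natAbs ≤ Z
  scaledQ_le : (c.scaledQ x y (G.n + G.m + k)).natAbs ≤ Z
  popSize_le : c.popSize (G.n + G.m + k) ≤ Z

theorem Bounded.places_le {k : ℕ} (h : Bounded c x y G k Z) : c.places (G.n + G.m + k) ≤ Z :=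
  Nat.lt_two_pow_self.le.trans h.scale_le

theorem Bounded.numLevels_le {k : ℕ} (h : Bounded c x y G k Z) :
    c.numLevels y (G.n + G.m + k) ≤ Z := by
  refine (Finset.card_filter_le _ _).trans ?_
  rw [Finset.card_range]
  exact h.levels_le

theorem det_setup {t : Memory} (ht : G.Stored t) {k : ℕ} (hk : t 0 2 = k)
    (hZ : Bounded c x y G k Z) :
    Det x y (setup c) t (fun t' => Ready c x y (G.n + G.m + k) t' ∧
      t' 10 0 = c.numLevels y (G.n + G.m + k) ∧ G.Holds t' ([∅], 1) ∧ G.Stored t')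
      ((c.scaleExponent + c.sizeExponent) * (4 * Z + 5) + 8 * Z ^ 2 + 28 * Z + 28) := by
  set T := G.n + G.m + k with hT
  have hs := hZ.places_le
  have hn : G.n ≤ Z := by have := hZ.input_le; omega
  refine ((det_setupScale ht hk hZ.input_le hZ.threshold_le).seq
    (w' := c.sizeExponent * (4 * Z + 5) + 8 * Z ^ 2 + 24 * Z + 23) ?_).weaken
      (by rw [Nat.add_mul]; omega)
  rintro t1 ⟨h5, h4⟩ hf1
  have hw1 : ∀ a ∉ [31, 12, 4, 5], t1 a = t a := fun a ha => hf1 a (by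
    simp [setupScale, mulBy, writes] at ha ⊢; tauto)
  have e1 : Det x y (assign 6 (.paramX (var 5))) t1
    (fun t' => t' = t1.set 6 0 ⌊(2 : ℝ) ^ c.places T * x⌋) (c.places T + 1) := by
    refine (Det.write_param ?_).weaken (le_of_eq ?_)
    · simp [Expr.val, h5, hT]
    · simp [Expr.places, Expr.val, h5, hT]
  refine (e1.seq (w' := c.sizeExponent * (4 * Z + 5) + 8 * Z ^ 2 + 23 * Z + 22) ?_).weaken
    (by rw [← hT] at hs; omega)
  rintro _ rfl -
  have e2 : Det x y (assign 7 (.paramY (var 5))) (t1.set 6 0 ⌊(2 : ℝ) ^ c.places T * x⌋)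
    (fun t' => t' = (t1.set 6 0 ⌊(2 : ℝ) ^ c.places T * x⌋).set 7 0 (c.scaledY y T))
    (c.places T + 1) := by
    refine (Det.write_param ?_).weaken (le_of_eq ?_)
    · simp [Expr.val, h5, hT, Settings.scaledY]
    · simp [Expr.places, Expr.val, h5, hT]
  refine (e2.seq (w' := c.sizeExponent * (4 * Z + 5) + 8 * Z ^ 2 + 22 * Z + 21) ?_).weaken
    (by rw [← hT] at hs; omega)
  rintro _ rfl -
  refine ((det_setupLevels (y := y) (T := T) (Z := Z) ?_ ?_ hZ.scale_le hZ.levels_le).seq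
    (w' := c.sizeExponent * (4 * Z + 5) + 7 * Z + 12) ?_).weaken (by omega)
  · simpa using h4
  · simp
  intro t2 h10 hf2
  have hw2 : ∀ a ∉ [8, 9, 10, 30, 12], t2 a = _ := fun a ha => hf2 a (by
    simp [setupLevels, mulBy, writes] at ha ⊢; tauto)
  have g4 : t2 4 0 = c.scale T := by rw [hw2 4 (by decide)]; simpa using h4
  refine ((det_setupSize g4 hZ.scale_le).seq (w' := 7 * Z + 10) ?_).weaken (by omega)
  intro t3 h11 hf3
  have hw3 : ∀ a ∉ [11, 12], t3 a = t2 a := fun a ha => hf3 a (by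
    simp [setupSize, mulBy, writes] at ha ⊢; tauto)
  have g4' : t3 4 0 = c.scale T := by rw [hw3 4 (by decide), g4]
  have g7 : t3 7 0 = c.scaledY y T := by rw [hw3 7 (by decide), hw2 7 (by decide)]; simp
  refine ((det_setupQ g4' ?_ g7 hZ.sub_le).seq (w' := 3 * Z + 4) ?_).weaken (by omega)
  · rw [hw3 6 (by decide), hw2 6 (by decide)]; simp
  intro t4 h26 hf4
  have hw : ∀ a ∉ [26, 12], t4 a = t3 a := fun a ha => hf4 a (by
    rcases hc : c.trivial <;> simp [setupQ, mulBy, writes, hc] at ha ⊢ <;> tauto)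
  have hst : G.Stored t4 := ht.congr
    (by rw [hw 0 (by decide), hw3 0 (by decide), hw2 0 (by decide), set_of_ne (by decide),
      set_of_ne (by decide), hw1 0 (by decide)])
    (by rw [hw 1 (by decide), hw3 1 (by decide), hw2 1 (by decide), set_of_ne (by decide),
      set_of_ne (by decide), hw1 1 (by decide)])
    (by rw [hw 2 (by decide), hw3 2 (by decide), hw2 2 (by decide), set_of_ne (by decide),
      set_of_ne (by decide), hw1 2 (by decide)])
  refine ((det_setupPop hst).weaken (by omega)).mono ?_
  intro t5 h hf5
  refine ⟨⟨?_, ?_, ?_, ?_, ?_⟩, ?_, h, hst.congr (hf5 0 (by decide)) (hf5 1 (by decide))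
    (hf5 2 (by decide))⟩
  · rw [hf5 5 (by decide), hw 5 (by decide), hw3 5 (by decide), hw2 5 (by decide),
      set_of_ne (by decide), set_of_ne (by decide), h5]
  · rw [hf5 4 (by decide), hw 4 (by decide), g4']
  · rw [hf5 7 (by decide), hw 7 (by decide), g7]
  · rw [hf5 11 (by decide), hw 11 (by decide), h11]
  · rw [hf5 26 (by decide), h26]
  · rw [hf5 10 (by decide), hw 10 (by decide), hw3 10 (by decide), h10]

end Multigraph

/-! ### Correctness of the output routines and of the whole program. -/

namespace Settings

/-- The sum of the contributions of the population. -/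
noncomputable def total {G : Multigraph} (c : Settings) (x y : ℝ) (T : ℕ)
    (pop : List (Finset (Fin G.m))) : ℤ :=
  (pop.map fun B => c.contribution x y T (G.numComponents B)).sum

/-- The numerator of the output. -/
noncomputable def numerator {G : Multigraph} (c : Settings) (x y : ℝ) (T : ℕ)
    (st : List (Finset (Fin G.m)) × ℕ) : ℤ :=
  (if c.difference then c.total x y T st.1
    else st.2 * (c.scale T : ℤ) ^ c.places T - c.total x y T st.1) *
    c.scaledY y T ^ G.m * (c.scale T : ℤ) ^ (G.n - 1)

/-- The denominator of the output. -/
noncomputable def denominator {G : Multigraph} (c : Settings) (y : ℝ) (T : ℕ)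
    (st : List (Finset (Fin G.m)) × ℕ) : ℤ :=
  st.2 * (c.scale T : ℤ) ^ c.places T * (c.scale T : ℤ) ^ G.m *
    (c.scaledY y T - c.scale T) ^ (G.n - 1)

end Settings

namespace Multigraph

open Prog

variable {G : Multigraph} {x y : ℝ} {c : Settings} {Z : ℕ}

theorem det_addRow {t : Memory} (ht : G.Stored t) {k : ℕ} (hZ : Bounded c x y G k Z)
    (hr : Ready c x y (G.n + G.m + k) t) {p : ℕ} (hp : t 24 0 = p) {B : Finset (Fin G.m)}
    (hB : G.Row (t 13) p B)
    (h32 : t 32 0 = (c.scale (G.n + G.m + k) : ℤ) ^ c.places (G.n + G.m + k)) :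
    Det x y addRow t (fun t' => t' 27 0 = t 27 0 +
      c.contribution x y (G.n + G.m + k) (G.numComponents B)) (4 * Z ^ 2 + 13 * Z + 13) := by
  have hs := hZ.places_le
  have hn : G.n ≤ Z := by have := hZ.input_le; omega
  set T := G.n + G.m + k
  set r := G.numComponents B
  refine ((det_countRow ht hp hB).seq (w' := ((Z + 1) * (4 * Z + 5) + 4) + 1) ?_).weaken
    (by nlinarith)
  intro t1 h1 hf1
  have hr1 := hr.of_frame hf1 (by decide)
  have g27 : t1 27 0 = t 27 0 := by rw [hf1 27 (by decide)]
  refine Det.ite (fun hne => (Det.skip ?_).weaken (by omega)) fun heq => ?_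
  · have : c.places T < r := by
      by_contra h
      simp [Expr.val, h1, hr1.places_eq] at hne
      omega
    rw [g27, Settings.contribution, if_pos this, add_zero]
  · have hlt : ¬c.places T < r := by
      intro h
      simp [Expr.val, h1, hr1.places_eq] at heq
      omega
    have e2 : Det x y (assign 28 (.lit 1)) t1 (fun t' => t' = t1.set 28 0 1) 1 := .write rfl
    have hw : (r - 1) * (4 * Z + 5) + (c.places T + 1 - r) * (4 * Z + 5) ≤
        (Z + 1) * (4 * Z + 5) := by
      rw [← Nat.add_mul]
      exact Nat.mul_le_mul_right _ (by omega)
    refine (e2.seq (w' := (r - 1) * (4 * Z + 5) + 1 +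
      ((c.places T + 1 - r) * (4 * Z + 5) + 1 + 1)) ?_).weaken (by omega)
    rintro _ rfl -
    refine (det_loop_mulBy (a := 28) (r - 1) ?_ (c.scaledQ x y T) (by decide) (fun t' hf i => ?_)
      hZ.scaledQ_le).seq ?_
    · simp [Expr.val, h1, r]
    · simpa [Expr.val, hf 26 (by decide)] using hr1.scaledQ_eq
    intro t3 h3 hf3
    have g5 : t3 5 0 = c.places T := by
      rw [hf3 5 (by decide), set_of_ne (by decide), hr1.places_eq]
    have g4 : t3 4 0 = c.scale T := by
      rw [hf3 4 (by decide), set_of_ne (by decide), hr1.scale_eq]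
    have g23 : t3 23 0 = r := by rw [hf3 23 (by decide), set_of_ne (by decide), h1]
    refine (det_loop_mulBy (a := 28) (c.places T + 1 - r) ?_ (c.scale T : ℤ) (by decide)
      (fun t' hf i => ?_) (by simpa using hZ.scale_le)).seq ?_
    · simp only [Expr.val, g5, g23]; omega
    · simpa [Expr.val, hf 4 (by decide)] using g4
    intro t4 h4 hf4
    refine Det.write ?_
    have g27' : t4 27 0 = t 27 0 := by
      rw [hf4 27 (by decide), hf3 27 (by decide), set_of_ne (by decide), g27]
    have g32 : t4 32 0 = (c.scale T : ℤ) ^ c.places T := by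
      rw [hf4 32 (by decide), hf3 32 (by decide), set_of_ne (by decide), hf1 32 (by decide), h32]
    simp only [Expr.val, set_apply, and_self, if_true]
    rw [g27', g32, h4, h3, Settings.contribution, if_neg hlt]
    simp

theorem det_collect {t : Memory} (ht : G.Stored t) {k : ℕ} (hZ : Bounded c x y G k Z)
    (hr : Ready c x y (G.n + G.m + k) t) {st : List (Finset (Fin G.m)) × ℕ} (hst : G.Holds t st)
    (hlen : st.1.length ≤ Z) :
    Det x y collect t (fun t' => t' 27 0 = c.total x y (G.n + G.m + k) st.1)
      (4 * Z ^ 3 + 17 * Z ^ 2 + 20 * Z + 5) := by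
  have hs := hZ.places_le
  have hn : G.n ≤ Z := by have := hZ.input_le; omega
  have hw1 := Nat.mul_le_mul_right (4 * Z + 5) hs
  have hw2 := Nat.mul_le_mul_right (4 * Z ^ 2 + 13 * Z + 13 + 2) hlen
  have hw3 : Z * (4 * Z ^ 2 + 13 * Z + 13 + 2) = 4 * Z ^ 3 + 13 * Z ^ 2 + 15 * Z := by ring
  have hw4 : Z * (4 * Z + 5) = 4 * Z ^ 2 + 5 * Z := by ring
  set T := G.n + G.m + k with hT
  obtain ⟨h14, h15, h13⟩ := hst
  have e1 : Det x y (assign 27 (.lit 0)) t (fun t' => t' = t.set 27 0 0) 1 := .write rfl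
  refine (e1.seq (w' := 4 * Z ^ 3 + 17 * Z ^ 2 + 20 * Z + 4) ?_).weaken (by omega)
  rintro _ rfl -
  have e2 : Det x y (assign 32 (.lit 1)) (t.set 27 0 0)
    (fun t' => t' = (t.set 27 0 0).set 32 0 1) 1 := .write rfl
  refine (e2.seq (w' := c.places T * (4 * Z + 5) + 1 +
    (st.1.length * (4 * Z ^ 2 + 13 * Z + 13 + 2) + 2)) ?_).weaken (by omega)
  rintro _ rfl -
  refine (det_loop_mulBy (a := 32) (c.places T) ?_ (c.scale T : ℤ) (by decide)
      (fun t' hf i => ?_) (by simpa using hZ.scale_le)).seq ?_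
  · simp [Expr.val, hr.places_eq]
  · simpa [Expr.val, hf 4 (by decide)] using hr.scale_eq
  intro t1 h1 hf1
  have hw : ∀ a ∉ [27, 32, 12], t1 a = t a := fun a ha => by
    simp only [List.mem_cons, List.not_mem_nil, or_false, not_or] at ha
    rw [hf1 a (by simp [writes, mulBy, ha]), set_of_ne ha.2.1, set_of_ne ha.1]
  refine (Det.forLoop (fun i t' => t' 27 0 = c.total x y T (st.1.take i)) st.1.length ?_ ?_ ?_).mono
    ?_
  · simp [Expr.val, hw 14 (by decide), h14]
  · rw [set_of_ne (by decide), hf1 27 (by decide)]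
    simp [Settings.total]
  · intro i hi t' hf hi' hI
    have hw' : ∀ a ∉ [27, 32, 12, 22, 23, 24, 28], t' a = t a := fun a ha => by
      simp only [List.mem_cons, List.not_mem_nil, or_false, not_or] at ha
      rw [hf a (by simp [writes, addRow, countRow, forLoop, mulBy, ha]), hw a (by simp [ha])]
    refine (det_addRow (k := k) (ht.congr (hw' 0 (by decide)) (hw' 1 (by decide))
      (hw' 2 (by decide))) hZ ⟨?_, ?_, ?_, ?_, ?_⟩ hi' (B := st.1[i]) ?_ ?_).mono ?_
    · rw [hw' 5 (by decide), hr.places_eq]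
    · rw [hw' 4 (by decide), hr.scale_eq]
    · rw [hw' 7 (by decide), hr.scaledY_eq]
    · rw [hw' 11 (by decide), hr.popSize_eq]
    · rw [hw' 26 (by decide), hr.scaledQ_eq]
    · rw [hw' 13 (by decide)]
      exact h13 _ _ (List.getElem?_eq_getElem hi)
    · rw [hf 32 (by decide), h1]; simp [← hT]
    · intro t'' h hf'
      refine ⟨by rw [hf' 24 (by decide), hi'], ?_⟩
      rw [set_of_ne (by decide), h, hI, Settings.total, Settings.total, List.take_add_one,
        List.getElem?_eq_getElem hi, List.map_append, List.sum_append]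
      simp [-List.map_take]
      rfl
  · intro t' h _
    rwa [List.take_length] at h

theorem det_finish {t : Memory} (ht : G.Stored t) {k : ℕ} (hZ : Bounded c x y G k Z)
    (hr : Ready c x y (G.n + G.m + k) t) {st : List (Finset (Fin G.m)) × ℕ}
    (h15 : t 15 0 = st.2) (h27 : t 27 0 = c.total x y (G.n + G.m + k) st.1) :
    Det x y (finish c) t (fun t' => t' 3 0 = c.numerator x y (G.n + G.m + k) st ∧
      t' 3 1 = c.denominator y (G.n + G.m + k) st) (20 * Z ^ 2 + 23 * Z + 7) := by
  have hs := hZ.places_le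
  have hn : G.n - 1 ≤ Z := by have := hZ.input_le; omega
  have hm : G.m ≤ Z := by have := hZ.input_le; omega
  have hw1 := Nat.mul_le_mul_right (4 * Z + 5) hs
  have hw2 := Nat.mul_le_mul_right (8 * Z + 9) hn
  have hw3 := Nat.mul_le_mul_right (8 * Z + 9) hm
  have hw4 : Z * (4 * Z + 5) = 4 * Z ^ 2 + 5 * Z := by ring
  have hw5 : Z * (8 * Z + 9) = 8 * Z ^ 2 + 9 * Z := by ring
  set T := G.n + G.m + k with hT
  have e1 : Det x y (assign 9 (var 15)) t (fun t' => t' = t.set 9 0 st.2) 1 :=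
    .write (by simp [Expr.val, h15])
  refine (e1.seq (w' := c.places T * (4 * Z + 5) + 1 + (1 + (G.m * (8 * Z + 9) + 1 +
    ((G.n - 1) * (8 * Z + 9) + 1 + 2)))) ?_).weaken (by omega)
  rintro _ rfl -
  refine (det_loop_mulBy (a := 9) (c.places T) ?_ (c.scale T : ℤ) (by decide)
      (fun t' hf i => ?_) (by simpa using hZ.scale_le)).seq ?_
  · simp [Expr.val, hr.places_eq]
  · simpa [Expr.val, hf 4 (by decide)] using hr.scale_eq
  intro t1 h1 hf1
  have hw : ∀ a ∉ [9, 12], t1 a = t a := fun a ha => by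
    simp only [List.mem_cons, List.not_mem_nil, or_false, not_or] at ha
    rw [hf1 a (by simp [writes, mulBy, ha]), set_of_ne ha.1]
  have g9 : t1 9 0 = st.2 * (c.scale T : ℤ) ^ c.places T := by rw [h1]; simp
  set a0 : ℤ := if c.difference then c.total x y T st.1
    else st.2 * (c.scale T : ℤ) ^ c.places T - c.total x y T st.1 with ha0
  refine Det.seq (Q := fun t' => t' = t1.set 8 0 a0) (w := 1) ?_ ?_
  · rcases hc : c.difference
    · refine .write ?_
      simp [Expr.val, ha0, hc, g9, hw 27 (by decide), h27]
    · refine .write ?_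
      simp [Expr.val, ha0, hc, hw 27 (by decide), h27]
  rintro _ rfl -
  set P : ℤ := (c.scale T : ℤ)
  set Y : ℤ := c.scaledY y T
  refine Det.seq (Det.loop (w := 8 * Z + 8) (fun i t' => t' 8 0 = a0 * Y ^ i ∧
    t' 9 0 = st.2 * P ^ c.places T * P ^ i) G.m ?_ ?_ ?_) ?_
  · simp [Expr.val, hw 0 (by decide), ht.m_eq]
  · simp [g9]
  · rintro i _ t' hf ⟨h8, h9⟩
    refine ((Det.mulBy (a := 8) Y Z (by decide) (fun r => ?_) hZ.scaledY_le).seq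
      (w' := 4 * Z + 4) ?_).weaken (by omega)
    · simpa [Expr.val, hf 7 (by decide), hw 7 (by decide)] using hr.scaledY_eq
    intro t2 h2 hf2
    refine (Det.mulBy (a := 9) P Z (by decide) (fun r => ?_) (by simpa [P] using hZ.scale_le)).mono ?_
    · simpa [Expr.val, hf2 4 (by decide), hf 4 (by decide), hw 4 (by decide)] using hr.scale_eq
    intro t3 h3 hf3
    refine ⟨?_, ?_⟩
    · rw [hf3 8 (by decide), h2, h8]; ring
    · rw [h3, hf2 9 (by decide), h9]; ring
  rintro t2 ⟨h8, h9⟩ hf2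
  have hw2' : ∀ a ∉ [8, 9, 12], t2 a = t a := fun a ha => by
    simp only [List.mem_cons, List.not_mem_nil, or_false, not_or] at ha
    rw [hf2 a (by simp [writes, mulBy, ha]), set_of_ne ha.1, hw a (by simp [ha])]
  refine Det.seq (Det.loop (w := 8 * Z + 8) (fun i t' => t' 8 0 = a0 * Y ^ G.m * P ^ i ∧
    t' 9 0 = st.2 * P ^ c.places T * P ^ G.m * (Y - P) ^ i) (G.n - 1) ?_ ?_ ?_) ?_
  · simp [Expr.val, hw2' 0 (by decide), ht.n_eq]
  · simp [h8, h9]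
  · rintro i _ t' hf ⟨h8, h9⟩
    refine ((Det.mulBy (a := 8) P Z (by decide) (fun r => ?_) (by simpa [P] using hZ.scale_le)).seq
      (w' := 4 * Z + 4) ?_).weaken (by omega)
    · simpa [Expr.val, hf 4 (by decide), hw2' 4 (by decide)] using hr.scale_eq
    intro t3 h3 hf3
    refine (Det.mulBy (a := 9) (Y - P) Z (by decide) (fun r => ?_) hZ.sub_le).mono ?_
    · simp [Expr.val, hf3 4 (by decide), hf 4 (by decide), hw2' 4 (by decide), hr.scale_eq,
        hf3 7 (by decide), hf 7 (by decide), hw2' 7 (by decide), hr.scaledY_eq, P, Y, hT]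
    intro t4 h4 hf4
    refine ⟨?_, ?_⟩
    · rw [hf4 8 (by decide), h3, h8]; ring
    · rw [h4, hf3 9 (by decide), h9]; ring
  rintro t3 ⟨h8', h9'⟩ hf3
  have e4 : Det x y (.write 3 (.lit 0) (var 8)) t3
    (fun t' => t' = t3.set 3 0 (c.numerator x y T st)) 1 := by
    refine .write ?_
    simp only [Expr.val, h8', Settings.numerator]
    rfl
  refine e4.seq (w' := 1) ?_
  rintro _ rfl -
  refine .write ⟨by simp [Expr.val], ?_⟩
  simp [Expr.val, h9', Settings.denominator]
  rfl

/-- Only the levels flip coins. They also dominate the work: levels times members times edges times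
a term linear in n and s, each factor being O(Z). -/
theorem simulates_scheme {t : Memory} (ht : G.Stored t) {k : ℕ} (hk : t 0 2 = k)
    (hZ : Bounded c x y G k Z) (hZ1 : 1 ≤ Z) (hN : 1 ≤ c.popSize (G.n + G.m + k)) :
    Simulates x y (scheme c) t (CoinTree.iter
      (level (c.places (G.n + G.m + k)) (c.popSize (G.n + G.m + k)))
      (c.numLevels y (G.n + G.m + k)) (([∅], 1) : List (Finset (Fin G.m)) × ℕ))
      (fun t' r => t' 3 0 = c.numerator x y (G.n + G.m + k) r ∧
        t' 3 1 = c.denominator y (G.n + G.m + k) r)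
      ((9 * (c.scaleExponent + c.sizeExponent) + 223) * Z ^ 4) := by
  have hs := hZ.places_le
  have hL := hZ.numLevels_le
  have hNZ := hZ.popSize_le
  have hn : G.n ≤ Z := by have := hZ.input_le; omega
  have hm : G.m ≤ Z := by have := hZ.input_le; omega
  set T := G.n + G.m + k with hT
  set L := c.numLevels y T
  set N := c.popSize T
  set s := c.places T
  have hW : L * (N * (G.m * (4 * s + 4 * G.n + 9) + 10 * G.n + 19) + 16) + 1 ≤
      Z * (Z * (Z * (4 * Z + 4 * Z + 9) + 10 * Z + 19) + 16) + 1 := by gcongr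
  set W := L * (N * (G.m * (4 * s + 4 * G.n + 9) + 10 * G.n + 19) + 16) + 1
  refine (Simulates.det_seq (det_setup ht hk hZ) (w' := W + ((4 * Z ^ 3 + 17 * Z ^ 2 + 20 * Z + 5) +
    (20 * Z ^ 2 + 23 * Z + 7))) ?_).weaken ?_
  · rintro t1 ⟨hr1, h10, hh1, hs1⟩ hf1
    have hall : (CoinTree.iter (level s N) L (([∅], 1) : List (Finset (Fin G.m)) × ℕ)).All
        fun r => r.1.length ≤ N := by
      refine CoinTree.All.iter (fun st _ => ?_) _ _ (by simpa using hN)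
      refine (all_popSteps s (replicated N st.1) [] (by simp)).bind fun r hr => ?_
      refine hr.1.trans ?_
      rw [length_replicated]
      simpa using copies_mul_le N st.1.length
    have hsim := simulates_runLevels (x := x) (y := y) hs1 hr1.places_eq hr1.popSize_eq h10 hh1
    have hsim' : Simulates x y (.loop (var 10) runLevel) t1 (CoinTree.iter (level s N) L ([∅], 1))
        (fun t' r => G.Holds t' r ∧ r.1.length ≤ N) W :=
      (CoinTree.Rel.and_right hsim hall).mono fun a b h => ⟨⟨h.1.1, h.2⟩, h.1.2⟩
    refine Simulates.seq_det hsim' ?_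
    rintro t2 r ⟨hh2, hlen⟩ hf2
    have hs2 := hs1.congr (hf2 0 (by decide)) (hf2 1 (by decide)) (hf2 2 (by decide))
    have hr2 := hr1.of_frame hf2 (by decide)
    refine (det_collect hs2 hZ hr2 hh2 (hlen.trans hNZ)).seq ?_
    intro t3 h3 hf3
    exact det_finish (hs2.congr (hf3 0 (by decide)) (hf3 1 (by decide)) (hf3 2 (by decide))) hZ
      (hr2.of_frame hf3 (by decide)) (by rw [hf3 15 (by decide), hh2.2.1]) h3
  -- The constant 223 = 64 + 63 + 46 + 50 is the sum of the coefficients of setup, levels,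
  -- collection and output; 9 comes from 4 Z + 5 ≤ 9 Z^4.
  · have h1 : Z ≤ Z ^ 4 := by simpa using Nat.pow_le_pow_right hZ1 (show 1 ≤ 4 by norm_num)
    have h2 : Z ^ 2 ≤ Z ^ 4 := Nat.pow_le_pow_right hZ1 (by norm_num)
    have h3 : Z ^ 3 ≤ Z ^ 4 := Nat.pow_le_pow_right hZ1 (by norm_num)
    have h4 : 1 ≤ Z ^ 4 := Nat.one_le_pow _ _ hZ1
    have h5 : Z * (Z * (Z * (4 * Z + 4 * Z + 9) + 10 * Z + 19) + 16) + 1 =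
      8 * Z ^ 4 + 19 * Z ^ 3 + 19 * Z ^ 2 + 16 * Z + 1 := by ring
    have h6 : (c.scaleExponent + c.sizeExponent) * (4 * Z + 5) ≤
      (c.scaleExponent + c.sizeExponent) * (9 * Z ^ 4) := Nat.mul_le_mul_left _ (by omega)
    have h7 : (9 * (c.scaleExponent + c.sizeExponent) + 223) * Z ^ 4 =
      (c.scaleExponent + c.sizeExponent) * (9 * Z ^ 4) + 223 * Z ^ 4 := by ring
    omega

end Multigraph

/-! ### The defect of a reliable graph -/

theorem one_add_pow_le {d : ℝ} (hd : 0 ≤ d) {m : ℕ} (h : m * d ≤ 1) :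
    (1 + d) ^ m ≤ 1 + 2 * (m * d) := by
  have h0 : 0 ≤ m * d := by positivity
  have h1 := Real.abs_exp_sub_one_le (x := m * d) (by rwa [abs_of_nonneg h0])
  rw [abs_of_nonneg h0] at h1
  have h2 : (1 + d) ^ m ≤ Real.exp (m * d) := by
    rw [Real.exp_nat_mul]
    exact pow_le_pow_left₀ (by linarith) (by linarith [Real.add_one_le_exp d]) m
  linarith [(abs_le.1 h1).2]

theorem abs_mul_sub_one_le {u v a b : ℝ} (hu : |u - 1| ≤ a) (hv : |v - 1| ≤ b) :
    |u * v - 1| ≤ (1 + a) * (1 + b) - 1 := by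
  have h := abs_add_le ((u - 1) * (v - 1)) ((u - 1) + (v - 1))
  have h2 := abs_add_le (u - 1) (v - 1)
  rw [abs_mul] at h
  have h3 : |u - 1| * |v - 1| ≤ a * b :=
    mul_le_mul hu hv (abs_nonneg _) ((abs_nonneg _).trans hu)
  rw [show u * v - 1 = (u - 1) * (v - 1) + ((u - 1) + (v - 1)) by ring]
  linarith

theorem abs_pow_sub_one_le {u a : ℝ} (hu : |u - 1| ≤ a) (i : ℕ) :
    |u ^ i - 1| ≤ (1 + a) ^ i - 1 := by
  induction i with
  | zero => simp
  | succ i ih =>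
    rw [pow_succ]
    refine (abs_mul_sub_one_le ih hu).trans_eq ?_
    ring

namespace Multigraph

variable {G : Multigraph}

/-- Each edge contributes a factor within `d` of 1 to the density of one law with respect to the
other, so the density is within (1+d)^m - 1 ≤ 2 m d of 1. The error is thus relative even on rare
events. -/
theorem abs_perc_sub_perc_le {q p d : ℝ} (hq : 0 < q) (hq1 : q < 1) (h1 : |p / q - 1| ≤ d)
    (h2 : |(1 - p) / (1 - q) - 1| ≤ d) (hd : G.m * d ≤ 1) {φ ψ : Finset (Fin G.m) → ℝ}
    (h : ∀ A, |φ A| ≤ ψ A) :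
    |perc p (List.finRange G.m) φ ∅ - perc q (List.finRange G.m) φ ∅| ≤
      2 * (G.m * d) * perc q (List.finRange G.m) ψ ∅ := by
  have hq1' := sub_pos.2 hq1
  have hd0 : 0 ≤ d := (abs_nonneg _).trans h1
  rw [perc_empty_eq_sum, perc_empty_eq_sum, perc_empty_eq_sum, ← Finset.sum_sub_distrib,
    Finset.mul_sum]
  refine (Finset.abs_sum_le_sum_abs _ _).trans (Finset.sum_le_sum fun A _ => ?_)
  set i := G.m - A.card
  set j := A.card
  have hij : i + j = G.m := Nat.sub_add_cancel (by simpa using A.card_le_univ)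
  have h3 : |(p / q) ^ i * ((1 - p) / (1 - q)) ^ j - 1| ≤ 2 * (G.m * d) := by
    refine (abs_mul_sub_one_le (abs_pow_sub_one_le h1 i) (abs_pow_sub_one_le h2 j)).trans ?_
    rw [add_sub_cancel, add_sub_cancel, ← pow_add, hij]
    linarith [one_add_pow_le hd0 hd]
  have e : p ^ i * (1 - p) ^ j * φ A - q ^ i * (1 - q) ^ j * φ A =
      ((p / q) ^ i * ((1 - p) / (1 - q)) ^ j - 1) * (q ^ i * (1 - q) ^ j) * φ A := by
    rw [div_pow, div_pow]
    field_simp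
  rw [e, abs_mul, abs_mul, abs_of_nonneg (by positivity : 0 ≤ q ^ i * (1 - q) ^ j)]
  calc _ ≤ 2 * (G.m * d) * (q ^ i * (1 - q) ^ j) * ψ A := by
        gcongr
        exact h A
    _ = _ := by ring

/-! ### Gaps, truncation and tails. -/

/-- The difference to `1` of the weight `Q ^ (κ - 1)` of a spanning subgraph. -/
noncomputable def gap (Q : ℝ) (A : Finset (Fin G.m)) : ℝ := 1 - Q ^ (G.numComponents A - 1)

/-- The gap, truncated to subgraphs with few components. -/
noncomputable def truncatedGap (s : ℕ) (Q : ℝ) (A : Finset (Fin G.m)) : ℝ :=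
  if G.numComponents A ≤ s then gap Q A else 0

open Classical in
/-- The weight `R ^ κ` of a spanning subgraph with at least `i` components. -/
noncomputable def tail (i : ℕ) (R : ℝ) (A : Finset (Fin G.m)) : ℝ :=
  if i ≤ G.numComponents A then R ^ G.numComponents A else 0

theorem tail_nonneg (i : ℕ) {R : ℝ} (hR : 0 ≤ R) (A : Finset (Fin G.m)) : 0 ≤ tail i R A := by
  rw [tail]; split_ifs <;> positivity

theorem gap_eq_zero (Q : ℝ) {A : Finset (Fin G.m)} (h : G.numComponents A < 2) : gap Q A = 0 := by
  rw [gap, show G.numComponents A - 1 = 0 by omega, pow_zero, sub_self]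

theorem truncatedGap_eq_zero (s : ℕ) (Q : ℝ) {A : Finset (Fin G.m)} (h : G.numComponents A < 2) :
    truncatedGap s Q A = 0 := by
  rw [truncatedGap, gap_eq_zero Q h, ite_self]

variable {Q Q' R : ℝ}

theorem abs_gap_le (hR : 1 ≤ R) (hQ : |Q| ≤ R) {r : ℕ} {A : Finset (Fin G.m)}
    (h : G.numComponents A ≤ r) : |gap Q A| ≤ 2 * R ^ r := by
  have h1 : |Q ^ (G.numComponents A - 1)| ≤ R ^ r := by
    rw [abs_pow]
    exact (pow_le_pow_left₀ (abs_nonneg _) hQ _).trans (pow_le_pow_right₀ hR (by omega))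
  have h2 : 1 ≤ R ^ r := one_le_pow₀ hR
  rw [gap]
  have := abs_le.1 h1
  exact abs_le.2 ⟨by linarith, by linarith⟩

theorem abs_gap_le_tail (hR : 1 ≤ R) (hQ : |Q| ≤ R) (A : Finset (Fin G.m)) :
    |gap Q A| ≤ 2 * tail 2 R A := by
  rw [tail]
  split_ifs with h
  · exact abs_gap_le hR hQ le_rfl
  · rw [gap_eq_zero Q (not_le.1 h)]; simp

theorem abs_truncatedGap_le (hR : 1 ≤ R) (hQ : |Q| ≤ R) (s : ℕ) (A : Finset (Fin G.m)) :
    |truncatedGap s Q A| ≤ 2 * R ^ s := by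
  rw [truncatedGap]
  split_ifs with h
  · exact abs_gap_le hR hQ h
  · rw [abs_zero]; positivity

theorem abs_truncatedGap_le_tail (hR : 1 ≤ R) (hQ : |Q| ≤ R) (s : ℕ) (A : Finset (Fin G.m)) :
    |truncatedGap s Q A| ≤ 2 * tail 2 R A := by
  rw [truncatedGap]
  split_ifs with h
  · exact abs_gap_le_tail hR hQ A
  · rw [abs_zero]; exact mul_nonneg zero_le_two (tail_nonneg 2 (by linarith) A)

/-- Up to `s` components this is |Q'^j - Q^j| ≤ j |Q' - Q| R^(j-1); beyond that the truncated gap is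
0 and the whole gap is the error. -/
theorem abs_truncatedGap_sub_le (hR : 1 ≤ R) (hQ : |Q| ≤ R) (hQ' : |Q'| ≤ R) {d : ℝ}
    (hd : |Q' - Q| ≤ d) (s : ℕ) (A : Finset (Fin G.m)) :
    |truncatedGap s Q' A - gap Q A| ≤ G.n * d * tail 2 R A + 2 * tail (s + 1) R A := by
  have hR0 : 0 ≤ R := by linarith
  have hd0 : 0 ≤ d := (abs_nonneg _).trans hd
  have ht := tail_nonneg (s + 1) hR0 A
  have ht2 := tail_nonneg 2 hR0 A
  have ht3 : 0 ≤ G.n * d * tail 2 R A := by positivity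
  rw [truncatedGap]
  split_ifs with h
  · refine le_trans ?_ (le_add_of_nonneg_right (by linarith))
    by_cases h2 : 2 ≤ G.numComponents A
    · rw [tail, if_pos h2, gap, gap, sub_sub_sub_cancel_left, abs_sub_comm]
      refine (abs_pow_sub_pow_le Q' Q _).trans ?_
      have h3 : max |Q'| |Q| ≤ R := max_le hQ' hQ
      have h4 : ((G.numComponents A - 1 : ℕ) : ℝ) ≤ G.n := by
        exact_mod_cast (Nat.sub_le _ _).trans (numComponents_le A)
      calc _ ≤ d * G.n * R ^ (G.numComponents A - 1 - 1) := by gcongr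
        _ ≤ d * G.n * R ^ G.numComponents A := by
            gcongr 2
            omega
        _ = _ := by ring
    · rw [gap_eq_zero Q' (not_le.1 h2), gap_eq_zero Q (not_le.1 h2), sub_self, abs_zero]
      exact ht3
  · have e : tail (s + 1) R A = R ^ G.numComponents A := if_pos (not_le.1 h)
    rw [e, zero_sub, abs_neg]
    linarith [abs_gap_le hR hQ (le_refl (G.numComponents A))]

variable {c : ℕ} {q : ℝ}

/-- The expected gap of a random spanning subgraph. -/
noncomputable def defect (G : Multigraph) (q Q : ℝ) : ℝ :=
  perc q (List.finRange G.m) (gap (G := G) Q) ∅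

/-! ### The size of the defect of a highly connected graph. -/

section Reliable

variable (hc : ∀ S : Finset (Fin G.n), S.Nonempty → S ≠ Finset.univ → c ≤ G.cutValue S)
  (hq : 0 < q) (hq1 : q < 1) (hR : 1 ≤ R) (hQ : |Q| ≤ R)
  (hs : G.n * R * q ^ ((c : ℝ) / 2) ≤ 1 / 2)
include hc hq hq1 hR hs

theorem perc_tail_le {i : ℕ} (hi : 2 ≤ i) : perc q (List.finRange G.m) (tail (G := G) i R) ∅ ≤
    2 * (G.n * R * q ^ ((c : ℝ) / 2)) ^ i :=
  perc_pow_numComponents_le hc hi hq hq1.le (by linarith) hs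

include hQ

theorem abs_defect_le : |G.defect q Q| ≤ 4 * (G.n * R * q ^ ((c : ℝ) / 2)) ^ 2 := by
  refine (abs_perc_le hq.le hq1.le _ (abs_gap_le_tail hR hQ) ∅).trans ?_
  rw [perc_mul_left]
  linarith [perc_tail_le hc hq hq1 hR hs le_rfl]

/-- With exactly two components the gap is 1 - Q, so the defect differs from (1 - Q) P(κ ≥ 2) only
through three or more components. Failure of the cut `S` gives P(κ ≥ 2) ≥ q^c, and `h3` makes the
third-order term at most half of the resulting main term. -/
theorem le_abs_defect {S : Finset (Fin G.n)} (hS : S.Nonempty) (hS' : S ≠ Finset.univ)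
    (hSc : G.cutValue S = c)
    (h3 : 4 * (G.n * R) ^ 3 * q ^ ((c : ℝ) / 2) ≤ |1 - Q| / 2) :
    |1 - Q| / 2 * q ^ c ≤ |G.defect q Q| := by
  classical
  set l := List.finRange G.m
  set p2 := perc q l (fun A => if 2 ≤ G.numComponents A then 1 else 0) ∅
  have hz : 0 ≤ q ^ ((c : ℝ) / 2) := Real.rpow_nonneg hq.le _
  have hzc : (q ^ ((c : ℝ) / 2)) ^ 2 = q ^ c := by
    rw [← Real.rpow_mul_natCast hq.le, Nat.cast_ofNat, div_mul_cancel₀ _ two_ne_zero,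
      Real.rpow_natCast]
  have h1 : |G.defect q Q - (1 - Q) * p2| ≤ 4 * (G.n * R * q ^ ((c : ℝ) / 2)) ^ 3 := by
    rw [defect, ← perc_mul_left, ← perc_sub]
    refine (abs_perc_le hq.le hq1.le _ (ψ := fun A => 2 * tail 3 R A) (fun A => ?_) ∅).trans ?_
    · rw [tail]
      rcases lt_or_ge (G.numComponents A) 2 with h | h
      · rw [gap_eq_zero Q h, if_neg (not_le.2 h), if_neg (by omega)]; simp
      · rw [if_pos h]
        split_ifs with h'
        · have h4 : |Q ^ (G.numComponents A - 1)| ≤ R ^ G.numComponents A := by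
            rw [abs_pow]
            exact (pow_le_pow_left₀ (abs_nonneg _) hQ _).trans (pow_le_pow_right₀ hR (by omega))
          have h5 : R ≤ R ^ G.numComponents A := le_self_pow₀ hR (by omega)
          rw [gap, show 1 - Q ^ (G.numComponents A - 1) - (1 - Q) * 1 =
            Q - Q ^ (G.numComponents A - 1) by ring]
          refine (abs_sub _ _).trans ?_
          linarith
        · rw [gap, show G.numComponents A - 1 = 1 by omega]; simp
    · rw [perc_mul_left]
      linarith [perc_tail_le hc hq hq1 hR hs (show 2 ≤ 3 by norm_num)]
  have h2 : q ^ c ≤ p2 := hSc ▸ pow_cutValue_le_perc hS hS' hq.le hq1.le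
  have h4 : |1 - Q| * q ^ c ≤ |(1 - Q) * p2| := by
    have : 0 ≤ p2 := le_trans (by positivity) h2
    rw [abs_mul, abs_of_nonneg this]; gcongr
  have h5 : 4 * (G.n * R * q ^ ((c : ℝ) / 2)) ^ 3 ≤ |1 - Q| / 2 * q ^ c := by
    rw [← hzc]
    calc _ = (4 * (G.n * R) ^ 3 * q ^ ((c : ℝ) / 2)) * (q ^ ((c : ℝ) / 2)) ^ 2 := by ring
      _ ≤ _ := by gcongr
  have h6 := abs_sub_abs_le_abs_sub ((1 - Q) * p2) (G.defect q Q)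
  rw [abs_sub_comm] at h6
  linarith

/-- The effect of rounding and truncation. -/
theorem abs_perc_truncatedGap_sub_defect_le {p d d' : ℝ} (hQ' : |Q'| ≤ R) (hd : |Q' - Q| ≤ d)
    (h1 : |p / q - 1| ≤ d') (h2 : |(1 - p) / (1 - q) - 1| ≤ d') (hd' : G.m * d' ≤ 1)
    {s : ℕ} (hs0 : 1 ≤ s) :
    |perc p (List.finRange G.m) (truncatedGap (G := G) s Q') ∅ - G.defect q Q| ≤
      (8 * (G.m * d') + 2 * (G.n * d) + 8 / 2 ^ s) * (G.n * R) ^ 2 * q ^ c := by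
  set z := q ^ ((c : ℝ) / 2) with hz'
  have hz : 0 ≤ z := Real.rpow_nonneg hq.le _
  have hzc : z ^ 2 = q ^ c := by
    rw [hz', ← Real.rpow_mul_natCast hq.le, Nat.cast_ofNat, div_mul_cancel₀ _ two_ne_zero,
      Real.rpow_natCast]
  have hd0 : 0 ≤ d := (abs_nonneg _).trans hd
  have hd0' : 0 ≤ d' := (abs_nonneg _).trans h1
  have ht2 := perc_tail_le hc hq hq1 hR hs le_rfl
  have hts := perc_tail_le hc hq hq1 hR hs (show 2 ≤ s + 1 by omega)
  have h3 := abs_perc_sub_perc_le (G := G) hq hq1 h1 h2 hd' (abs_truncatedGap_le_tail hR hQ' s)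
  rw [perc_mul_left] at h3
  have h4 := abs_perc_le hq.le hq1.le (List.finRange G.m)
    (abs_truncatedGap_sub_le (G := G) hR hQ hQ' hd s) ∅
  rw [perc_sub, perc_add, perc_mul_left, perc_mul_left] at h4
  -- The tail beyond `s` components has s - 1 more factors n R z ≤ 1/2 than the leading order.
  have h5 : (G.n * R * z) ^ (s + 1) ≤ 2 / 2 ^ s * (G.n * R * z) ^ 2 := by
    have h0 : 0 ≤ G.n * R * z := by positivity
    calc (G.n * R * z) ^ (s + 1) = (G.n * R * z) ^ (s - 1) * (G.n * R * z) ^ 2 := by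
          rw [← pow_add]; congr 1; omega
      _ ≤ (1 / 2) ^ (s - 1) * (G.n * R * z) ^ 2 := by gcongr
      _ = _ := by
        obtain ⟨i, rfl⟩ : ∃ i, s = i + 1 := ⟨s - 1, by omega⟩
        rw [Nat.add_sub_cancel, pow_succ, one_div, inv_pow]
        field_simp
        ring
  have e : (G.n * R) ^ 2 * q ^ c = (G.n * R * z) ^ 2 := by rw [← hzc]; ring
  rw [mul_assoc _ _ (q ^ c), e]
  have h6 := abs_sub_le (perc p (List.finRange G.m) (truncatedGap (G := G) s Q') ∅)
    (perc q (List.finRange G.m) (truncatedGap (G := G) s Q') ∅) (G.defect q Q)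
  refine h6.trans ((add_le_add h3 h4).trans ?_)
  have h7 : 2 * (G.m * d') * (2 * perc q (List.finRange G.m) (tail (G := G) 2 R) ∅) ≤
      2 * (G.m * d') * (2 * (2 * (G.n * R * z) ^ 2)) := by gcongr
  have h8 : G.n * d * perc q (List.finRange G.m) (tail (G := G) 2 R) ∅ ≤
      G.n * d * (2 * (G.n * R * z) ^ 2) := by gcongr
  have h9 : 8 / 2 ^ s * (G.n * R * z) ^ 2 = 4 * (2 / 2 ^ s * (G.n * R * z) ^ 2) := by ring
  linarith

end Reliable

/-- For q = 1/y the law gives A the weight (y-1)^|A| / y^m, and (|A| + κ - n) + (n - 1) = |A| + (κ -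
1) regroups the powers of y - 1 into those of Q. -/
theorem tutte_eq (x : ℝ) {y : ℝ} (hy : 1 < y) (hn : 1 ≤ G.n)
    (hu : G.numComponents Finset.univ = 1) :
    G.tutte x y = y ^ G.m / (y - 1) ^ (G.n - 1) * (1 - G.defect (1 / y) ((x - 1) * (y - 1))) := by
  have hy0 : 0 < y := by linarith
  have hy1 : 0 < y - 1 := by linarith
  have h1 : 1 - G.defect (1 / y) ((x - 1) * (y - 1)) = perc (1 / y) (List.finRange G.m)
      (fun A => ((x - 1) * (y - 1)) ^ (G.numComponents A - 1)) ∅ := by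
    rw [defect]
    change 1 - perc _ _ (fun A => 1 - ((x - 1) * (y - 1)) ^ (G.numComponents A - 1)) ∅ = _
    rw [perc_sub, perc_const, sub_sub_cancel]
  rw [h1, perc_empty_eq_sum, Finset.mul_sum, tutte]
  refine Finset.sum_congr rfl fun A _ => ?_
  have hA : A.card ≤ G.m := by simpa using A.card_le_univ
  have h2 := G.n_le_card_add_numComponents A
  have h3 := numComponents_pos hn A
  obtain ⟨j, hj⟩ : ∃ j, G.numComponents A = j + 1 := ⟨_, (Nat.sub_add_cancel h3).symm⟩
  have h4 : (y - 1) ^ (A.card + G.numComponents A - G.n) * (y - 1) ^ (G.n - 1) =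
      (y - 1) ^ A.card * (y - 1) ^ j := by
    rw [← pow_add, ← pow_add]; congr 1; omega
  have h5 : y ^ G.m = y ^ (G.m - A.card) * y ^ A.card := by
    rw [← pow_add, Nat.sub_add_cancel hA]
  rw [hu, show 1 - 1 / y = (y - 1) / y by field_simp, div_pow, div_pow, one_pow, h5, mul_pow]
  rw [hj] at h4 ⊢
  rw [Nat.add_sub_cancel]
  field_simp
  linear_combination (x - 1) ^ j * h4

theorem deltaTutte_eq (x : ℝ) {y : ℝ} (hy : 1 < y) (hn : 1 ≤ G.n)
    (hu : G.numComponents Finset.univ = 1) :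
    G.deltaTutte x y = y ^ G.m / (y - 1) ^ (G.n - 1) * G.defect (1 / y) ((x - 1) * (y - 1)) := by
  rw [deltaTutte, tutte_eq x hy hn hu]
  ring

end Multigraph

/-! ### Rounding -/

/-- A downward closed condition holds on an initial segment; this identifies the count in
`numLevels` with a threshold. -/
theorem exists_forall_lt_iff {p : ℕ → Prop} (h : ∀ i, p (i + 1) → p i) (n : ℕ) :
    ∃ L ≤ n, ∀ i < n, (p i ↔ i < L) := by
  induction n with
  | zero => exact ⟨0, le_rfl, by simp⟩
  | succ n ih =>
    obtain ⟨L, hL, hp⟩ := ih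
    by_cases hn : p n
    · have hall : ∀ j, p (n - j) := fun j => by
        induction j with
        | zero => exact hn
        | succ j ih =>
          rcases Nat.lt_or_ge j n with hj | hj
          · exact h _ (by rwa [show n - (j + 1) + 1 = n - j by omega])
          · rwa [show n - (j + 1) = n - j by omega]
      refine ⟨n + 1, le_rfl, fun i hi => iff_of_true ?_ hi⟩
      have := hall (n - i)
      rwa [show n - (n - i) = i by omega] at this
    · refine ⟨L, by omega, fun i hi => ?_⟩
      rcases Nat.lt_or_ge i n with h' | h'
      · exact hp i h'
      · rw [show i = n by omega]
        exact iff_of_false hn (by omega)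

namespace Settings

variable (c : Settings) (x y : ℝ) (T : ℕ)

/-- The rounded parameter `y`. -/
noncomputable def roundedY : ℝ := c.scaledY y T / 2 ^ c.places T

/-- The rounded parameter `(x - 1) (y - 1)`. -/
noncomputable def roundedQ : ℝ := c.scaledQ x y T / 2 ^ c.places T

theorem roundedY_le : c.roundedY y T ≤ y := by
  rw [roundedY, div_le_iff₀ (by positivity), mul_comm]
  exact Int.floor_le _

theorem lt_roundedY_add : y < c.roundedY y T + 1 / 2 ^ c.places T := by
  rw [roundedY, ← add_div, lt_div_iff₀ (by positivity), mul_comm]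
  exact Int.lt_floor_add_one _

variable {c x y T}

/-- In units of 1/P, rounding x costs at most y, rounding y at most |x| + 1, and the final division
at most 1. The case Q = 1 is stored exactly because the defect is then 0 and a relative error leaves
no room. -/
theorem abs_roundedQ_sub_le (hy : 1 < y) (hc : c.trivial = true → (x - 1) * (y - 1) = 1) :
    |c.roundedQ x y T - (x - 1) * (y - 1)| ≤ (y + |x| + 2) / 2 ^ c.places T := by
  have hP : (1 : ℝ) ≤ 2 ^ c.places T := one_le_pow₀ one_le_two
  have h1 := c.roundedY_le y T
  have h2 := c.lt_roundedY_add y T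
  rw [roundedQ, scaledQ, scale]
  rw [roundedY] at h1 h2
  set P : ℝ := 2 ^ c.places T with hPdef
  have hP0 : 0 < P := by linarith
  split_ifs with h
  · rw [hc h]
    push_cast
    rw [← hPdef, div_self hP0.ne', sub_self, abs_zero]
    positivity
  · set X : ℤ := ⌊P * x⌋
    set Y : ℤ := c.scaledY y T
    have h3 : (X : ℝ) ≤ P * x := Int.floor_le _
    have h4 : P * x < X + 1 := Int.lt_floor_add_one _
    set N : ℤ := (X - (2 ^ c.places T : ℕ)) * (Y - (2 ^ c.places T : ℕ)) / (2 ^ c.places T : ℕ)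
    have h5 : (N : ℝ) ≤ (X - P) * (Y - P) / P := by
      rw [le_div_iff₀ hP0]
      have : N * (2 ^ c.places T : ℕ) ≤ (X - (2 ^ c.places T : ℕ)) * (Y - (2 ^ c.places T : ℕ)) :=
        Int.ediv_mul_le _ (by positivity)
      have : ((N * (2 ^ c.places T : ℕ) : ℤ) : ℝ) ≤ _ := Int.cast_le.2 this
      push_cast at this
      exact this
    have h6 : (X - P) * (Y - P) / P < N + 1 := by
      rw [div_lt_iff₀ hP0]
      have : (X - (2 ^ c.places T : ℕ)) * (Y - (2 ^ c.places T : ℕ)) < (N + 1) * (2 ^ c.places T : ℕ) :=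
        Int.lt_ediv_add_one_mul_self _ (by positivity)
      have : _ < (((N + 1) * (2 ^ c.places T : ℕ) : ℤ) : ℝ) := Int.cast_lt.2 this
      push_cast at this
      exact this
    set u := X / P with hu
    set v := Y / P with hv
    have hXu : (X : ℝ) = P * u := by rw [hu]; field_simp
    have hYv : (Y : ℝ) = P * v := by rw [hv]; field_simp
    have hu1 : |(u - x) * P| ≤ 1 := by
      rw [abs_le]
      constructor <;> linarith
    have hv1 : |(v - y) * P| ≤ 1 := by
      rw [abs_le]
      have : 1 / P * P = 1 := div_mul_cancel₀ _ hP0.ne'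
      constructor <;> nlinarith
    have hN : |N - P * ((u - 1) * (v - 1))| ≤ 1 := by
      have e : (X - P) * (Y - P) / P = P * ((u - 1) * (v - 1)) := by
        rw [hXu, hYv]; field_simp
      rw [e] at h5 h6
      exact abs_le.2 ⟨by linarith, by linarith⟩
    have hv0 : |v - 1| ≤ y := by
      have : 1 / P ≤ 1 := (div_le_one hP0).2 hP
      exact abs_le.2 ⟨by linarith, by linarith⟩
    have hx1 : |x - 1| ≤ |x| + 1 := by simpa using abs_sub x 1
    nth_rw 2 [← abs_of_pos hP0]
    rw [le_div_iff₀ (abs_pos.2 hP0.ne'), ← abs_mul,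
      show (N / P - (x - 1) * (y - 1)) * P = (N - P * ((u - 1) * (v - 1))) +
        ((u - x) * P * (v - 1) + (x - 1) * ((v - y) * P)) by field_simp; ring]
    have h7 : |(u - x) * P * (v - 1)| ≤ 1 * y := by
      rw [abs_mul]
      exact mul_le_mul hu1 hv0 (abs_nonneg _) zero_le_one
    have h8 : |(x - 1) * ((v - y) * P)| ≤ (|x| + 1) * 1 := by
      rw [abs_mul]
      exact mul_le_mul hx1 hv1 (by positivity) (by positivity)
    have h9 := abs_add_le (N - P * ((u - 1) * (v - 1)))
      ((u - x) * P * (v - 1) + (x - 1) * ((v - y) * P))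
    have h10 := abs_add_le ((u - x) * P * (v - 1)) ((x - 1) * ((v - y) * P))
    linarith

/-- The number of levels is chosen such that `1 / y` is approximated from above. -/
theorem pow_numLevels (hy : 1 < y) (hℓ : y < c.levelFactor + 1) (hP : (4 : ℝ) ≤ 2 ^ c.places T)
    (hY : 1 ≤ c.roundedY y T) :
    1 / y ≤ (1 - (1 / 2 : ℝ) ^ c.places T) ^ c.numLevels y T ∧
    (1 - (1 / 2 : ℝ) ^ c.places T) ^ c.numLevels y T ≤ 1 / y * (1 + 4 / 2 ^ c.places T) ∧
    c.numLevels y T ≤ c.levelFactor * c.scale T := by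
  have h1 := c.roundedY_le y T
  have h2 := c.lt_roundedY_add y T
  set u : ℝ := (1 / 2) ^ c.places T with hu
  have hPu : (2 : ℝ) ^ c.places T * u = 1 := by rw [hu, ← mul_pow]; norm_num
  have hu0 : 0 < u := by positivity
  have hu4 : u ≤ 1 / 4 := by nlinarith
  have hdiv : ∀ r : ℝ, r / 2 ^ c.places T = r * u := fun r => by
    rw [div_eq_iff (by positivity), mul_assoc, mul_comm u, hPu, mul_one]
  have hy0 : 0 < y := by linarith
  rw [hdiv] at h2 ⊢
  set v := c.roundedY y T with hv
  have hp : ∀ i, (¬c.scaledY y T * ((c.scale T : ℤ) - 1) ^ (i + 1) <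
      (c.scale T : ℤ) * c.scale T ^ (i + 1)) ↔ 1 ≤ v * (1 - u) ^ (i + 1) := by
    intro i
    rw [not_lt, ← Int.cast_le (R := ℝ), hv, roundedY]
    push_cast [scale]
    set P : ℝ := 2 ^ c.places T
    have hP0 : 0 < P := by linarith
    have e : 1 - u = (P - 1) / P := by
      rw [eq_div_iff hP0.ne']; linear_combination -hPu
    rw [e, div_pow, div_mul_div_comm, one_le_div (by positivity)]
  have hanti : ∀ i, 1 ≤ v * (1 - u) ^ (i + 1 + 1) → 1 ≤ v * (1 - u) ^ (i + 1) := fun i h =>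
    h.trans (mul_le_mul_of_nonneg_left
      (pow_le_pow_of_le_one (by linarith) (by linarith) (Nat.le_succ _)) (by linarith))
  obtain ⟨L, hL, hLp⟩ := exists_forall_lt_iff
    (p := fun i => 1 ≤ v * (1 - u) ^ (i + 1)) hanti (c.levelFactor * c.scale T)
  have hcard : c.numLevels y T = L := by
    rw [numLevels, ← Finset.card_range L]
    congr 1
    ext i
    rw [Finset.mem_filter, Finset.mem_range, Finset.mem_range, hp]
    exact ⟨fun h => (hLp i h.1).1 h.2, fun h => ⟨h.trans_le hL, (hLp i (h.trans_le hL)).2 h⟩⟩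
  rw [hcard]
  have h3 : 1 ≤ v * (1 - u) ^ L := by
    rcases Nat.eq_zero_or_pos L with h | h
    · simpa [h] using hY
    · have := (hLp (L - 1) (by omega)).2 (by omega)
      rwa [Nat.sub_add_cancel h] at this
  -- The search range does not cut the count off: otherwise (1-u)^L ≤ (1+u)^(-L) ≤ 1/(1 + L u) =
  -- 1/(1 + `levelFactor`), which is below 1/y ≤ 1/v, contrary to `h3`.
  have hlast : L < c.levelFactor * c.scale T := by
    rcases hL.lt_or_eq with h | h
    · exact h
    · exfalso
      have h4 : (1 - u) ^ L * (1 + u) ^ L ≤ 1 := by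
        rw [← mul_pow]; exact pow_le_one₀ (by nlinarith) (by nlinarith)
      have h5 : 1 + (L : ℝ) * u ≤ (1 + u) ^ L := one_add_mul_le_pow (by linarith) L
      have h6 : (L : ℝ) * u = c.levelFactor := by
        rw [h, scale]; push_cast; rw [mul_assoc, hPu, mul_one]
      have h7 : 0 < (1 - u) ^ L := pow_pos (by linarith) _
      nlinarith
  have h4 : v * (1 - u) ^ (L + 1) < 1 := not_le.1 fun h => lt_irrefl _ ((hLp L hlast).1 h)
  have h7 : 0 < (1 - u) ^ L := pow_pos (by linarith) _
  refine ⟨?_, ?_, hL⟩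
  · rw [div_le_iff₀ hy0]; nlinarith
  · rw [one_div, ← div_eq_inv_mul, le_div_iff₀ hy0]
    -- One factor 1 - u is lost by the rounding of y and one by the stopping rule, and (1-u)^(-2) ≤
    -- 1 + 4u for u ≤ 1/4.
    have h8 : y * (1 - u) ≤ v := by nlinarith
    have h9 : (1 - u) ^ L * y * (1 - u) ^ 2 ≤ 1 := by
      rw [pow_succ] at h4
      have : 0 < (1 - u) ^ L * (1 - u) := mul_pos h7 (by linarith)
      nlinarith
    have h10 : 1 ≤ (1 - u) ^ 2 * (1 + 4 * u) := by nlinarith [sq_nonneg u]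
    have h11 : 0 < (1 - u) ^ L * y := by positivity
    nlinarith

end Settings

/-- Each of the m + j factors has a relative error of at most (1 + 2/(y-1)) u, because v - 1 ≥
(y-1)/2. -/
theorem prefactor_rounding {y u v : ℝ} (hy : 1 < y) (hv : v ≤ y) (hvu : y < v + u)
    (hu : u ≤ (y - 1) / 2) {m j : ℕ} (h : ((m + j : ℕ) : ℝ) * ((1 + 2 / (y - 1)) * u) ≤ 1) :
    ∃ r, v ^ m / (v - 1) ^ j = r * (y ^ m / (y - 1) ^ j) ∧
      |r - 1| ≤ 2 * (((m + j : ℕ) : ℝ) * ((1 + 2 / (y - 1)) * u)) := by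
  have hy0 : 0 < y := by linarith
  have hy1 : 0 < y - 1 := by linarith
  have hv1 : (y - 1) / 2 ≤ v - 1 := by linarith
  have hv1' : 0 < v - 1 := by linarith
  have hu0 : 0 < u := by linarith
  have hd : 0 ≤ 2 / (y - 1) * u := by positivity
  have h1 : |v / y - 1| ≤ (1 + 2 / (y - 1)) * u := by
    have e : v / y - 1 = -((y - v) / y) := by field_simp; ring
    rw [e, abs_neg, abs_of_nonneg (div_nonneg (by linarith) hy0.le), div_le_iff₀ hy0]
    nlinarith
  have h2 : |(y - 1) / (v - 1) - 1| ≤ (1 + 2 / (y - 1)) * u := by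
    have e : (y - 1) / (v - 1) - 1 = (y - v) / (v - 1) := by field_simp; ring
    rw [e, abs_of_nonneg (div_nonneg (by linarith) hv1'.le), div_le_iff₀ hv1']
    have h3 : u ≤ 2 / (y - 1) * u * (v - 1) := by
      calc u = 2 / (y - 1) * u * ((y - 1) / 2) := by field_simp
        _ ≤ _ := by gcongr
    have : 0 ≤ u * (v - 1) := by positivity
    nlinarith
  refine ⟨(v / y) ^ m * ((y - 1) / (v - 1)) ^ j, ?_, ?_⟩
  · rw [div_pow, div_pow]; field_simp
  · refine (abs_mul_sub_one_le (abs_pow_sub_one_le h1 m) (abs_pow_sub_one_le h2 j)).trans ?_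
    rw [add_sub_cancel, add_sub_cancel, ← pow_add]
    linarith [one_add_pow_le (by nlinarith) h]

/-! ### What the output represents. -/

namespace Multigraph

variable {G : Multigraph} (c : Settings) (x y : ℝ) (T : ℕ)

/-- The value estimated by the program. -/
noncomputable def estimand (G : Multigraph) : Finset (Fin G.m) → ℝ :=
  truncatedGap (c.places T) (c.roundedQ x y T)

theorem contribution_eq (hn : 1 ≤ G.n) (A : Finset (Fin G.m)) :
    (c.contribution x y T (G.numComponents A) : ℝ) =
      (2 ^ c.places T) ^ c.places T * estimand c x y T G A := by
  have h := numComponents_pos hn A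
  rw [estimand, truncatedGap, Settings.contribution]
  split_ifs with h1 h2 h2
  · omega
  · simp
  · obtain ⟨r, hr⟩ : ∃ r, G.numComponents A = r + 1 := ⟨_, (Nat.sub_add_cancel h).symm⟩
    rw [gap, hr, Settings.roundedQ, Settings.scale, Nat.add_sub_cancel, Nat.add_sub_add_right,
      div_pow]
    push_cast
    set P : ℝ := 2 ^ c.places T
    have hP : 0 < P := by positivity
    have e : P ^ c.places T = P ^ r * P ^ (c.places T - r) := by
      rw [← pow_add]; congr 1; omega
    rw [mul_sub, mul_one, e]
    field_simp
  · omega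

theorem total_eq (hn : 1 ≤ G.n) (pop : List (Finset (Fin G.m))) :
    (c.total x y T pop : ℝ) =
      (2 ^ c.places T) ^ c.places T * popSum (estimand c x y T G) pop := by
  induction pop with
  | nil => simp [Settings.total]
  | cons B l ih =>
    rw [Settings.total, List.map_cons, List.sum_cons, popSum_cons, mul_add, ← ih,
      ← contribution_eq c x y T hn, ← Int.cast_add]
    rfl

theorem numerator_div_denominator (hn : 1 ≤ G.n) {st : List (Finset (Fin G.m)) × ℕ}
    (hst : 0 < st.2) : (c.numerator x y T st : ℝ) / c.denominator y T st =
      c.roundedY y T ^ G.m / (c.roundedY y T - 1) ^ (G.n - 1) *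
        (if c.difference then weighted (estimand c x y T G) st
          else 1 - weighted (estimand c x y T G) st) := by
  have hD : (0 : ℝ) < st.2 := by exact_mod_cast hst
  rw [Settings.numerator, Settings.denominator, weighted]
  push_cast [Settings.scale]
  have hY : (c.scaledY y T : ℝ) = 2 ^ c.places T * c.roundedY y T := by
    rw [Settings.roundedY]; field_simp
  have hg : (((if c.difference then c.total x y T st.1 else
      st.2 * ((2 ^ c.places T : ℕ) : ℤ) ^ c.places T - c.total x y T st.1 : ℤ)) : ℝ) =
      st.2 * (2 ^ c.places T) ^ c.places T *
        (if c.difference then popSum (estimand c x y T G) st.1 / st.2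
          else 1 - popSum (estimand c x y T G) st.1 / st.2) := by
    split_ifs
    · rw [total_eq c x y T hn]; field_simp
    · push_cast
      rw [total_eq c x y T hn]; field_simp
  rw [hY] at *
  push_cast at hg
  rw [hg]
  set P : ℝ := 2 ^ c.places T
  have hP : 0 < P := by positivity
  set v := c.roundedY y T
  set g := (if c.difference then popSum (estimand c x y T G) st.1 / st.2
          else 1 - popSum (estimand c x y T G) st.1 / st.2)
  rw [show P * v - P = P * (v - 1) by ring, mul_pow, mul_pow,
    show (st.2 : ℝ) * P ^ c.places T * g * (P ^ G.m * v ^ G.m) * P ^ (G.n - 1) =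
      (st.2 * P ^ c.places T * P ^ G.m * P ^ (G.n - 1)) * (v ^ G.m * g) by ring,
    show (st.2 : ℝ) * P ^ c.places T * P ^ G.m * (P ^ (G.n - 1) * (v - 1) ^ (G.n - 1)) =
      (st.2 * P ^ c.places T * P ^ G.m * P ^ (G.n - 1)) * (v - 1) ^ (G.n - 1) by ring,
    mul_div_mul_left _ _ (by positivity), mul_div_right_comm]

theorem estimand_eq_zero (A : Finset (Fin G.m)) (h : G.numComponents A < 2) :
    estimand c x y T G A = 0 := truncatedGap_eq_zero _ _ h

theorem all_pos_level {s N : ℕ} (hN : 0 < N) {i : ℕ} :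
    (CoinTree.iter (level s N) i (([∅], 1) : List (Finset (Fin G.m)) × ℕ)).All fun r => 0 < r.2 := by
  have h : (CoinTree.iter (level s N) i (([∅], 1) : List (Finset (Fin G.m)) × ℕ)).All
      fun r => r.1.length ≤ N ∧ 0 < r.2 := by
    refine CoinTree.All.iter (fun st hst => ?_) _ _ ⟨by simpa [Nat.one_le_iff_ne_zero] using hN.ne', one_pos⟩
    refine (all_popSteps s (replicated N st.1) [] (by simp)).bind fun r hr => ⟨?_, ?_⟩
    · refine hr.1.trans ?_
      rw [length_replicated]
      simpa using copies_mul_le N st.1.length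
    · exact Nat.mul_pos hst.2 (copies_pos hN hst.1)
  exact h.mono fun r hr => hr.2

end Multigraph

/-! ### Choice of the constants. -/

/-- The settings are fine enough for the parameters. -/
structure Settings.Fits (c : Settings) (x y : ℝ) (r : ℕ) : Prop where
  base : |(x - 1) * (y - 1)| + 1 ≤ 2 ^ r
  levels : y < c.levelFactor + 1
  trivial_iff : c.trivial = true ↔ (x - 1) * (y - 1) = 1
  scaleExponent : c.scaleExponent = 4
  sizeExponent : c.sizeExponent = 2 * r + 3
  four_le : (4 : ℝ) ≤ c.scaleFactor
  gap_le : 2 / (y - 1) ≤ c.scaleFactor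
  perturb_le : 2 * (4 + 4 / (y - 1)) ≤ c.scaleFactor
  rounding_le : y + |x| + 2 ≤ c.scaleFactor
  prefactor_le : 16 * (1 + 2 / (y - 1)) ≤ c.scaleFactor
  bias_le : (x - 1) * (y - 1) ≠ 1 →
    8 * (8 * (4 + 4 / (y - 1)) + 2 * (y + |x| + 2) + 8) * (2 ^ r) ^ 2 ≤
      c.scaleFactor * (|1 - (x - 1) * (y - 1)| / 2)
  size_pos : 0 < c.sizeFactor
  size_le : 4 * c.levelFactor ≤ c.sizeFactor
  variance_le : (x - 1) * (y - 1) ≠ 1 →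
    (32768 * c.levelFactor : ℝ) ≤ c.sizeFactor * (|1 - (x - 1) * (y - 1)| / 2) ^ 2

theorem Settings.exists_fits {x y : ℝ} {r : ℕ} (hr : |(x - 1) * (y - 1)| + 1 ≤ 2 ^ r) (b : Bool) :
    ∃ c : Settings, c.Fits x y r ∧ c.difference = b := by
  classical
  set a := |1 - (x - 1) * (y - 1)| / 2
  set B := 8 * (8 * (4 + 4 / (y - 1)) + 2 * (y + |x| + 2) + 8) * (2 ^ r) ^ 2
  -- If Q = 1 then a = 0 and the quotients by `a` are 0 by convention; the conditions that involve
  -- them are void in that case.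
  obtain ⟨f, hf⟩ := exists_nat_ge (max (max (max 4 (2 / (y - 1))) (max (2 * (4 + 4 / (y - 1)))
    (y + |x| + 2))) (max (16 * (1 + 2 / (y - 1))) (B / a)))
  obtain ⟨ℓ, hℓ⟩ := exists_nat_gt y
  obtain ⟨g, hg⟩ := exists_nat_ge (32768 * ℓ / a ^ 2)
  simp only [max_le_iff] at hf
  obtain ⟨⟨⟨h1, h2⟩, h3, h4⟩, h5, h6⟩ := hf
  have ha : (x - 1) * (y - 1) ≠ 1 → 0 < a := fun h =>
    half_pos (abs_pos.2 (sub_ne_zero.2 (Ne.symm h)))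
  refine ⟨⟨f, 4, ℓ, g + 4 * ℓ + 1, 2 * r + 3, decide ((x - 1) * (y - 1) = 1), b⟩,
    ⟨hr, by simpa using hℓ.trans (lt_add_one _), by simp, rfl, rfl, h1, h2, h3, h4, h5,
      fun h => (div_le_iff₀ (ha h)).1 h6, by simp, by simp; omega, fun h => ?_⟩, rfl⟩
  have := (div_le_iff₀ (pow_pos (ha h) 2)).1 hg
  refine this.trans (mul_le_mul_of_nonneg_right ?_ (sq_nonneg a))
  push_cast
  linarith [(Nat.cast_nonneg ℓ : (0 : ℝ) ≤ ℓ)]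

/-- Since L b ≤ 1, the factor (1+b)^L - 1 is at most 8 ℓ P T²/N. The truncation bound M² = 4 P^(2r)
is absorbed by N, and the tiny u² cancels between C² and e². There remains 128 ℓ T^6/(K P²) against
(a/8k)²/4, which T^8 ≤ P² and k ≤ T settle; 32768 = 128 · 64 · 4. -/
theorem variance_bound {ℓ N P T k a u C b M e : ℝ} {L r : ℕ} (hℓ : 0 ≤ ℓ) (hk1 : 1 ≤ k) (hP : 1 ≤ P)
    (hkT : k ≤ T) (hTP : T ^ 4 ≤ P) (ha : 0 < a) (hu : 0 < u) {K : ℝ} (hK : 0 < K)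
    (hN : N = K * P ^ (2 * r + 3)) (hKℓ : 4 * ℓ ≤ K) (hKa : 32768 * ℓ ≤ K * a ^ 2)
    (hL : L ≤ ℓ * P) (hb0 : 0 ≤ b) (hb : b ≤ 4 * T ^ 2 / N) (hM : M = 2 * P ^ r)
    (hC0 : 0 ≤ C) (hC : C ≤ 2 * u * T ^ 2) (he : e = a * u / (8 * k)) :
    ((1 + b) ^ L - 1) * M ^ 2 * C ^ 2 / e ^ 2 ≤ 1 / 4 := by
  have hT1 : 1 ≤ T := hk1.trans hkT
  have hP0 : 0 < P := by linarith
  have hk0 : 0 < k := by linarith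
  have hN0 : 0 < N := by rw [hN]; positivity
  have hT2 : T ^ 2 ≤ P := (pow_le_pow_right₀ hT1 (by norm_num)).trans hTP
  have hT8 : T ^ 8 ≤ P ^ 2 := by
    rw [show T ^ 8 = (T ^ 4) ^ 2 by ring]; gcongr
  have h1 : L * b ≤ 4 * ℓ * P * T ^ 2 / N := by
    calc L * b ≤ (ℓ * P) * (4 * T ^ 2 / N) := by gcongr
      _ = _ := by ring
  have h2 : 4 * ℓ * P * T ^ 2 / N ≤ 1 := by
    rw [div_le_one hN0, hN]
    calc 4 * ℓ * P * T ^ 2 ≤ K * P * P := by gcongr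
      _ = K * P ^ 2 := by ring
      _ ≤ _ := by
        gcongr 2
        omega
  have h3 := one_add_pow_le hb0 (h1.trans h2)
  have h4 : (1 + b) ^ L - 1 ≤ 8 * ℓ * P * T ^ 2 / N := by
    have : 8 * ℓ * P * T ^ 2 / N = 2 * (4 * ℓ * P * T ^ 2 / N) := by ring
    linarith
  have h5 : 0 ≤ (1 + b) ^ L - 1 := sub_nonneg.2 (one_le_pow₀ (by linarith))
  rw [hM, he, div_le_iff₀ (by positivity)]
  calc ((1 + b) ^ L - 1) * (2 * P ^ r) ^ 2 * C ^ 2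
      ≤ (8 * ℓ * P * T ^ 2 / N) * (2 * P ^ r) ^ 2 * (2 * u * T ^ 2) ^ 2 := by gcongr
    _ = 128 * ℓ * T ^ 6 * (P ^ (2 * r + 1) / N) * u ^ 2 := by ring
    _ = 128 * ℓ * T ^ 6 * (1 / (K * P ^ 2)) * u ^ 2 := by
        congr 2
        rw [hN]
        field_simp
        ring
    _ ≤ 1 / 4 * (a / (8 * k)) ^ 2 * u ^ 2 := by
        refine mul_le_mul_of_nonneg_right ?_ (sq_nonneg u)
        rw [mul_one_div, div_le_iff₀ (by positivity), div_pow, mul_div_assoc', div_mul_eq_mul_div,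
          le_div_iff₀ (by positivity)]
        calc 128 * ℓ * T ^ 6 * (8 * k) ^ 2 = 8192 * ℓ * T ^ 6 * k ^ 2 := by ring
          _ ≤ 8192 * ℓ * T ^ 6 * T ^ 2 := by gcongr
          _ = 8192 * ℓ * T ^ 8 := by ring
          _ ≤ 8192 * ℓ * P ^ 2 := by gcongr
          _ = 1 / 4 * (32768 * ℓ) * P ^ 2 := by ring
          _ ≤ 1 / 4 * (K * a ^ 2) * P ^ 2 := by gcongr
          _ = _ := by ring
    _ = _ := by ring

/-- This `C` forces q^(c/2) ≤ n^(-(3+j)), which beats the n³ of the third-order term in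
`le_abs_defect` and leaves n^(-j) ≤ 2^(-j) < η. -/
theorem exists_connectivity {y η : ℝ} (hy : 1 < y) (hη : 0 < η) :
    ∃ C : ℝ, 0 < C ∧ ∀ n c : ℕ, 2 ≤ n → C * Real.log n < c →
      (n : ℝ) ^ 3 * (1 / y) ^ ((c : ℝ) / 2) ≤ η := by
  obtain ⟨j, hj⟩ := exists_pow_lt_of_lt_one hη (show (1 / 2 : ℝ) < 1 by norm_num)
  have hy0 : 0 < y := by linarith
  have hlog := Real.log_pos hy
  refine ⟨2 * (3 + j) / Real.log y, by positivity, fun n c hn hc => ?_⟩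
  have hn0 : (0 : ℝ) < n := by positivity
  have hn2 : (2 : ℝ) ≤ n := by exact_mod_cast hn
  have h1 : (1 / y) ^ ((c : ℝ) / 2) ≤ ((n : ℝ) ^ (3 + j))⁻¹ := by
    rw [Real.rpow_def_of_pos (by positivity), one_div, Real.log_inv]
    have e : ((n : ℝ) ^ (3 + j))⁻¹ = Real.exp (-((3 + j : ℕ) * Real.log n)) := by
      rw [Real.exp_neg, Real.exp_nat_mul, Real.exp_log hn0]
    rw [e, Real.exp_le_exp]
    rw [div_mul_eq_mul_div, div_lt_iff₀ hlog] at hc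
    push_cast
    linarith
  calc (n : ℝ) ^ 3 * (1 / y) ^ ((c : ℝ) / 2) ≤ (n : ℝ) ^ 3 * ((n : ℝ) ^ (3 + j))⁻¹ := by gcongr
    _ = (1 / (n : ℝ)) ^ j := by rw [pow_add, one_div, inv_pow]; field_simp
    _ ≤ (1 / 2) ^ j := by gcongr
    _ ≤ η := hj.le

theorem abs_ratio_sub_one_le {y p P : ℝ} (hy : 1 < y) (hP : 0 < P) (h1 : 1 / y ≤ p)
    (h2 : p ≤ 1 / y * (1 + 4 / P)) : |p / (1 / y) - 1| ≤ (4 + 4 / (y - 1)) / P ∧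
      |(1 - p) / (1 - 1 / y) - 1| ≤ (4 + 4 / (y - 1)) / P := by
  have hy0 : 0 < y := by linarith
  have hy1 : 0 < y - 1 := by linarith
  have e : 1 - 1 / y = (y - 1) / y := by field_simp
  rw [div_mul_eq_mul_div, one_mul, le_div_iff₀ hy0] at h2
  rw [div_le_iff₀ hy0] at h1
  have h3 : 0 ≤ 4 / P := by positivity
  have h4 : 0 ≤ 4 / (y - 1) / P := by positivity
  have h5 : p * y - 1 ≤ (4 + 4 / (y - 1)) / P := by rw [add_div]; linarith
  constructor
  · rw [div_div_eq_mul_div, div_one, abs_of_nonneg (by linarith)]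
    exact h5
  · have e1 : (1 - p) / (1 - 1 / y) - 1 = -((p * y - 1) / (y - 1)) := by
      rw [e]; field_simp; ring
    rw [e1, abs_neg, abs_of_nonneg (div_nonneg (by linarith) hy1.le), div_le_iff₀ hy1, add_div]
    have h6 : 4 / (y - 1) / P * (y - 1) = 4 / P := by field_simp
    nlinarith

/-! ### Consequences of the choice of constants. -/

namespace Settings

variable {c : Settings} {x y : ℝ} {r : ℕ}

theorem Fits.factor_mul_le (h : c.Fits x y r) (T : ℕ) :
    (c.scaleFactor : ℝ) * T ^ 4 ≤ 2 ^ c.places T := by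
  have := Nat.le_pow_clog one_lt_two (c.scaleFactor * T ^ c.scaleExponent)
  rw [h.scaleExponent] at this
  rw [places, h.scaleExponent]
  exact_mod_cast this

theorem Fits.scaled_le (h : c.Fits x y r) {T : ℕ} (hT : 1 ≤ T) {a : ℝ} (i : ℕ) (hi : i ≤ 4)
    (ha : a ≤ c.scaleFactor) : a * T ^ i ≤ 2 ^ c.places T := by
  refine le_trans ?_ (h.factor_mul_le T)
  have : (1 : ℝ) ≤ T := by exact_mod_cast hT
  have : (0 : ℝ) ≤ c.scaleFactor := by linarith [h.four_le]
  gcongr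

theorem Fits.places_pos (h : c.Fits x y r) {T : ℕ} (hT : 1 ≤ T) : 1 ≤ c.places T := by
  by_contra hs
  have := h.scaled_le hT 0 (by norm_num) h.four_le
  rw [show c.places T = 0 by omega] at this
  norm_num at this

theorem Fits.step_le (h : c.Fits x y r) (hy : 1 < y) {T : ℕ} (hT : 1 ≤ T) :
    (1 : ℝ) / 2 ^ c.places T ≤ (y - 1) / 2 := by
  have h1 := h.scaled_le hT 0 (by norm_num) h.gap_le
  have hy1 : 0 < y - 1 := by linarith
  rw [pow_zero, mul_one, div_le_iff₀ hy1] at h1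
  rw [div_le_iff₀ (by positivity)]
  linarith

theorem Fits.one_le_roundedY (h : c.Fits x y r) (hy : 1 < y) {T : ℕ} (hT : 1 ≤ T) :
    1 ≤ c.roundedY y T := by
  linarith [h.step_le hy hT, c.lt_roundedY_add y T]

theorem Fits.popSize_pos (h : c.Fits x y r) (T : ℕ) : 0 < c.popSize T :=
  Nat.mul_pos h.size_pos (pow_pos (pow_pos two_pos _) _)

/-- This fixes the exponent 4 of the scale: one factor T for the perturbation per edge or component,
two for n², one for the precision k. -/
theorem Fits.bias (hf : c.Fits x y r) (hy : 1 < y) (hQ1 : (x - 1) * (y - 1) ≠ 1) {n m k T : ℕ}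
    (hk : 1 ≤ k) (hn : n ≤ T) (hm : m ≤ T) (hkT : k ≤ T) :
    (8 * (m * ((4 + 4 / (y - 1)) / 2 ^ c.places T)) + 2 * (n * ((y + |x| + 2) / 2 ^ c.places T)) +
      8 / 2 ^ c.places T) * (n * 2 ^ r) ^ 2 ≤ |1 - (x - 1) * (y - 1)| / 2 / (8 * k) := by
  have h2 := hf.factor_mul_le T
  have h4 := hf.bias_le hQ1
  set P : ℝ := 2 ^ c.places T
  set R : ℝ := 2 ^ r
  set a := |1 - (x - 1) * (y - 1)| / 2
  have ha : 0 ≤ a := by positivity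
  have hP0 : 0 < P := by positivity
  have hy1 : 0 < y - 1 := by linarith
  have hnT : (n : ℝ) ≤ T := by exact_mod_cast hn
  have hmT : (m : ℝ) ≤ T := by exact_mod_cast hm
  have hkT' : (k : ℝ) ≤ T := by exact_mod_cast hkT
  have hk1 : (1 : ℝ) ≤ k := by exact_mod_cast hk
  have h3 : 0 ≤ 4 + 4 / (y - 1) := by positivity
  have h5 : 0 ≤ y + |x| + 2 := by positivity
  rw [le_div_iff₀ (by positivity)]
  have h1 : 8 * (m * ((4 + 4 / (y - 1)) / P)) + 2 * (n * ((y + |x| + 2) / P)) + 8 / P =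
      (8 * (m * (4 + 4 / (y - 1))) + 2 * (n * (y + |x| + 2)) + 8 * 1) / P := by ring
  set U := 4 + 4 / (y - 1)
  set V := y + |x| + 2
  rw [h1, div_mul_eq_mul_div, div_mul_eq_mul_div, div_le_iff₀ hP0]
  calc (8 * (m * U) + 2 * (n * V) + 8 * 1) * (n * R) ^ 2 * (8 * k)
      ≤ (8 * (T * U) + 2 * (T * V) + 8 * T) * (T * R) ^ 2 * (8 * T) := by
        gcongr; linarith
    _ = (8 * (8 * U + 2 * V + 8) * R ^ 2) * T ^ 4 := by ring
    _ ≤ (c.scaleFactor * a) * T ^ 4 := by gcongr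
    _ = a * (c.scaleFactor * T ^ 4) := by ring
    _ ≤ a * P := by gcongr

/-- As 2^s ≥ 8T and e ≤ T, one level keeps all edges of a cut of value e absent with probability ρ^e
≥ 1/2, and over all levels (ρ^L)^e ≤ 2 q^e. Then `variance_bound` applies with u = q^e. -/
theorem Fits.variance (hf : c.Fits x y r) (hy : 1 < y) (hQ1 : (x - 1) * (y - 1) ≠ 1)
    {n k e T : ℕ} (hk : 1 ≤ k) (hn : n ≤ T) (hkT : k ≤ T) (he : e ≤ T)
    (hp1 : 1 / y ≤ (1 - (1 / 2 : ℝ) ^ c.places T) ^ c.numLevels y T)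
    (hp2 : (1 - (1 / 2 : ℝ) ^ c.places T) ^ c.numLevels y T ≤ 1 / y * (1 + 4 / 2 ^ c.places T))
    (hL : c.numLevels y T ≤ c.levelFactor * c.scale T) :
    ((1 + 2 / (c.popSize T : ℝ) * ((n.choose 2 : ℕ) / (1 - (1 / 2 : ℝ) ^ c.places T) ^ e)) ^
      c.numLevels y T - 1) * (2 * (2 ^ c.places T) ^ r) ^ 2 *
      (((1 - (1 / 2 : ℝ) ^ c.places T) ^ e) ^ c.numLevels y T * (n.choose 2 : ℕ)) ^ 2 /
      (|1 - (x - 1) * (y - 1)| / 2 * (1 / y) ^ e / (8 * k)) ^ 2 ≤ 1 / 4 := by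
  have hT1 : 1 ≤ T := by omega
  have hy0 : 0 < y := by linarith
  have hy1 : 0 < y - 1 := by linarith
  have hP4 : (4 : ℝ) ≤ 2 ^ c.places T := by
    simpa using hf.scaled_le hT1 0 (by norm_num) hf.four_le
  have hTP : (T : ℝ) ^ 4 ≤ 2 ^ c.places T := by
    simpa using hf.scaled_le hT1 4 le_rfl (show (1 : ℝ) ≤ c.scaleFactor by linarith [hf.four_le])
  have hT8 : 8 * (T : ℝ) ≤ 2 ^ c.places T := by
    have h0 : 0 ≤ 4 / (y - 1) := by positivity
    simpa using hf.scaled_le hT1 1 (by norm_num) (show (8 : ℝ) ≤ c.scaleFactor by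
      linarith [hf.perturb_le])
  have ha0 : 0 < |1 - (x - 1) * (y - 1)| / 2 := half_pos (abs_pos.2 (sub_ne_zero.2 hQ1.symm))
  have hu1 : (1 / 2 : ℝ) ^ c.places T = 1 / 2 ^ c.places T := by rw [one_div_pow]
  have hkT' : (k : ℝ) ≤ T := by exact_mod_cast hkT
  have hk1 : (1 : ℝ) ≤ k := by exact_mod_cast hk
  have heT : (e : ℝ) ≤ T := by exact_mod_cast he
  have hnT : (n : ℝ) ≤ T := by exact_mod_cast hn
  have hN0 : (0 : ℝ) < c.popSize T := by exact_mod_cast hf.popSize_pos T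
  have hN : (c.popSize T : ℝ) = c.sizeFactor * (2 ^ c.places T) ^ (2 * r + 3) := by
    rw [popSize, hf.sizeExponent, scale]; push_cast; rfl
  have hL' : (c.numLevels y T : ℝ) ≤ c.levelFactor * 2 ^ c.places T := by
    have : (c.numLevels y T : ℝ) ≤ (c.levelFactor * c.scale T : ℕ) := by exact_mod_cast hL
    rw [scale] at this
    push_cast at this
    exact this
  have hnn : ((n.choose 2 : ℕ) : ℝ) ≤ T ^ 2 := by
    have : ((n.choose 2 : ℕ) : ℝ) ≤ (n : ℝ) ^ 2 := by exact_mod_cast Nat.choose_le_pow _ _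
    exact this.trans (by gcongr)
  set P : ℝ := 2 ^ c.places T
  have hP0 : 0 < P := by positivity
  have hq0 : 0 < 1 / y := by positivity
  have hρ : 1 / 2 ≤ (1 - (1 / 2 : ℝ) ^ c.places T) ^ e := by
    have h1 := one_add_mul_le_pow (a := -(1 / 2 : ℝ) ^ c.places T)
      (by linarith [show (1 / 2 : ℝ) ^ c.places T ≤ 1 from pow_le_one₀ (by norm_num) (by norm_num)]) e
    rw [← sub_eq_add_neg] at h1
    refine le_trans ?_ h1
    have h2 : (e : ℝ) * (1 / 2 : ℝ) ^ c.places T ≤ 1 / 2 := by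
      rw [hu1, mul_one_div, div_le_iff₀ hP0]
      linarith
    linarith
  have hpe : ((1 - (1 / 2 : ℝ) ^ c.places T) ^ e) ^ c.numLevels y T ≤ 2 * (1 / y) ^ e := by
    rw [pow_right_comm]
    have h1 : e * (4 / P) ≤ 1 / 2 := by
      rw [mul_div_assoc', div_le_iff₀ hP0]; linarith
    have h2 := one_add_pow_le (show 0 ≤ 4 / P by positivity) (h1.trans (by norm_num))
    calc ((1 - (1 / 2 : ℝ) ^ c.places T) ^ c.numLevels y T) ^ e ≤ (1 / y * (1 + 4 / P)) ^ e :=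
          pow_le_pow_left₀ (hq0.le.trans hp1) hp2 e
      _ = (1 / y) ^ e * (1 + 4 / P) ^ e := mul_pow _ _ _
      _ ≤ (1 / y) ^ e * 2 := by gcongr; linarith
      _ = 2 * (1 / y) ^ e := mul_comm _ _
  have hρ0 : 0 ≤ (1 - (1 / 2 : ℝ) ^ c.places T) ^ e := by linarith
  refine variance_bound (Nat.cast_nonneg c.levelFactor) hk1 (by linarith) hkT' hTP ha0
    (pow_pos hq0 e) (by exact_mod_cast hf.size_pos) hN (by exact_mod_cast hf.size_le)
    (hf.variance_le hQ1) hL' (by positivity) ?_ rfl (by positivity) ?_ rfl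
  · calc 2 / (c.popSize T : ℝ) * ((n.choose 2 : ℕ) / (1 - (1 / 2 : ℝ) ^ c.places T) ^ e) ≤
          2 / (c.popSize T : ℝ) * (T ^ 2 / (1 / 2)) := by gcongr
      _ = _ := by ring
  · gcongr

end Settings

/-! ### Accuracy of the estimator. -/

namespace Multigraph

variable {G : Multigraph} {c : Settings} {x y : ℝ} {r : ℕ}

theorem cutValue_le (S : Finset (Fin G.n)) : G.cutValue S ≤ G.m := by
  rw [← card_cut]
  simpa using (G.cut S).card_le_univ

-- The estimator deviates from its mean, and the mean from the defect, by at most a q^e/(8k) each.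
-- Because e is exactly the minimum cut, a q^e ≤ |defect|, so the absolute errors become a relative
-- one.
open Classical in
theorem exp_close (hf : c.Fits x y r) (hy : 1 < y) (hQ1 : (x - 1) * (y - 1) ≠ 1) (hn : 2 ≤ G.n)
    {e : ℕ} (hc : ∀ S : Finset (Fin G.n), S.Nonempty → S ≠ Finset.univ → e ≤ G.cutValue S)
    {S : Finset (Fin G.n)} (hS : S.Nonempty) (hS' : S ≠ Finset.univ) (hSe : G.cutValue S = e)
    (hz : G.n * 2 ^ r * (1 / y) ^ ((e : ℝ) / 2) ≤ 1 / 2)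
    (hz3 : 4 * (G.n * 2 ^ r) ^ 3 * (1 / y) ^ ((e : ℝ) / 2) ≤ |1 - (x - 1) * (y - 1)| / 2)
    {k : ℕ} (hk : 1 ≤ k) {T : ℕ} (hT : T = G.n + G.m + k) :
    3 / 4 ≤ (CoinTree.iter (level (c.places T) (c.popSize T)) (c.numLevels y T)
      (([∅], 1) : List (Finset (Fin G.m)) × ℕ)).exp fun st =>
        if |weighted (estimand c x y T G) st - G.defect (1 / y) ((x - 1) * (y - 1))| ≤
          |G.defect (1 / y) ((x - 1) * (y - 1))| / (4 * k) then 1 else 0 := by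
  have hT1 : 1 ≤ T := by omega
  have hy0 : 0 < y := by linarith
  have hy1 : 0 < y - 1 := by linarith
  have hP4 : (4 : ℝ) ≤ 2 ^ c.places T := by
    simpa using hf.scaled_le hT1 0 (by norm_num) hf.four_le
  obtain ⟨hp1, hp2, hL⟩ := Settings.pow_numLevels hy hf.levels hP4 (hf.one_le_roundedY hy hT1)
  have hQd := Settings.abs_roundedQ_sub_le (c := c) (x := x) (T := T) hy fun h => hf.trivial_iff.1 h
  have hs := hf.places_pos hT1
  have hperturb : (2 * (4 + 4 / (y - 1))) * T ≤ 2 ^ c.places T := by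
    simpa using hf.scaled_le hT1 1 (by norm_num) hf.perturb_le
  have hround : y + |x| + 2 ≤ 2 ^ c.places T := by
    simpa using hf.scaled_le hT1 0 (by norm_num) hf.rounding_le
  set Q := (x - 1) * (y - 1) with hQ
  set q := 1 / y with hq
  set P : ℝ := 2 ^ c.places T with hP
  set p := (1 - (1 / 2 : ℝ) ^ c.places T) ^ c.numLevels y T with hp
  set R : ℝ := 2 ^ r with hR
  set a := |1 - Q| / 2 with ha
  have ha0 : 0 < a := half_pos (abs_pos.2 (sub_ne_zero.2 hQ1.symm))
  have hP0 : 0 < P := by linarith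
  have hq0 : 0 < q := by positivity
  have hq1 : q < 1 := (div_lt_one hy0).2 hy
  have hR1 : 1 ≤ R := one_le_pow₀ one_le_two
  have hQR : |Q| ≤ R := by linarith [hf.base]
  have hQR' : |c.roundedQ x y T| ≤ R := by
    have h1 : (y + |x| + 2) / P ≤ 1 := (div_le_one hP0).2 hround
    have h2 := abs_sub_abs_le_abs_sub (c.roundedQ x y T) Q
    linarith [hf.base]
  have hmT : (G.m : ℝ) ≤ T := by exact_mod_cast (by omega : G.m ≤ T)
  have hk1 : (1 : ℝ) ≤ k := by exact_mod_cast hk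
  set d' := (4 + 4 / (y - 1)) / P with hd'
  have hd0 : 0 ≤ d' := by positivity
  have hTd : T * d' ≤ 1 / 2 := by
    rw [hd', mul_div_assoc', div_le_iff₀ hP0]; linarith
  obtain ⟨hpq1, hpq2⟩ := abs_ratio_sub_one_le hy hP0 hp1 hp2
  have hmd : G.m * d' ≤ 1 := by nlinarith
  have hbias := abs_perc_truncatedGap_sub_defect_le (G := G) hc hq0 hq1 hR1 hQR hz hQR' hQd hpq1 hpq2
    hmd hs
  have hlow := le_abs_defect (G := G) hc hq0 hq1 hR1 hQR hz hS hS' hSe hz3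
  set u := q ^ e with hu
  have hu0 : 0 < u := by positivity
  have hbias' : (8 * (G.m * d') + 2 * (G.n * ((y + |x| + 2) / P)) + 8 / P) * (G.n * R) ^ 2 * u ≤
      a * u / (8 * k) := by
    rw [mul_div_right_comm]
    exact mul_le_mul_of_nonneg_right (hf.bias hy hQ1 hk (by omega) (by omega) (by omega)) hu0.le
  have hM : ∀ A : Finset (Fin G.m), |estimand c x y T G A| ≤ 2 * P ^ r := fun A => by
    refine (abs_truncatedGap_le hR1 hQR' _ A).trans_eq ?_
    rw [hR, hP, ← pow_mul, ← pow_mul, mul_comm r]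
  have hdev := exp_levels_deviation (G := G) (c := e) (by omega : 0 < c.places T) hc (by positivity)
    hM (fun A hA => estimand_eq_zero c x y T A hA) hn (hf.popSize_pos T) (c.numLevels y T)
    (e := a * u / (8 * k)) (by positivity)
  have hv := hf.variance (n := G.n) hy hQ1 hk (by omega) (by omega)
    ((hSe ▸ cutValue_le S).trans (by omega)) hp1 hp2 hL
  refine (show (3 / 4 : ℝ) ≤ 1 - _ by linarith [hv]).trans (hdev.trans ?_)
  refine CoinTree.exp_mono _ fun st => ?_
  have hfin : a * u / (8 * k) + a * u / (8 * k) ≤ |G.defect q Q| / (4 * k) := by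
    rw [← add_div, div_le_div_iff₀ (by positivity) (by positivity)]
    have h1 : a * u ≤ |G.defect q Q| := hlow
    have h2 := mul_le_mul_of_nonneg_right h1 (show (0 : ℝ) ≤ 8 * k by positivity)
    linarith
  split_ifs with h1 h2 h2
  · exact le_rfl
  · refine absurd (le_trans ?_ hfin) h2
    refine (abs_sub_le _ (perc p (List.finRange G.m) (estimand c x y T G) ∅) _).trans ?_
    exact add_le_add h1 (hbias.trans hbias')
  · exact zero_le_one
  · exact le_rfl

end Multigraph

open Classical in
/-- A program that simulates a coin-flip tree inherits its distribution, at polynomial cost. -/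
theorem Prog.run_of_simulates {x y : ℝ} {P : Prog} (hP : P.Gentle) {s : Memory} {W : ℕ}
    (hs : ∀ a i, bitLen (s a i) ≤ W) {β : Type*} {t : CoinTree β} {R : Memory → β → Prop} {w : ℕ}
    (h : Simulates x y P s t R w) {a : ℕ} (ha : P.coef + (⌈|x|⌉₊ + ⌈|y|⌉₊ + 2) ≤ a) :
    (∀ o ∈ (P.run x y s).support, o.2 ≤ a * w * (W + a * w + 1)) ∧
    ∀ (p : Memory → Prop) (r : β → Prop), (∀ m b, R m b → r b → p m) →
      ENNReal.ofReal (t.exp fun b => if r b then 1 else 0) ≤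
        (P.run x y s).toOuterMeasure {o | p o.1} := by
  have h1 := workTree_withinBudget x y P hP ha W s hs
  rw [run_eq_pmf]
  constructor
  · have h2 : (P.costTree x y s).All fun o => o.2 ≤ a * w * (W + a * w + 1) :=
      h1.all_right (p := fun o => o.2 ≤ w) (h.all_left fun o b hb => hb.2) fun o o' ho hw =>
        ho.2.2.trans (by gcongr)
    exact fun o ho => h2.of_mem_support ho
  · intro p r hpr
    rw [CoinTree.toOuterMeasure_pmf]
    refine ENNReal.ofReal_le_ofReal ?_
    have h2 : (t.exp fun b => if r b then 1 else 0) ≤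
        (P.workTree x y s).exp fun o => if p o.1 then 1 else 0 := by
      refine h.exp_le fun o b hb => ?_
      split_ifs with h3 h4 h4
      · exact le_rfl
      · exact absurd (hpr _ _ hb.1 h3) h4
      · exact zero_le_one
      · exact le_rfl
    -- Coupled runs end in the same memory; the indicators are negated because `CoinTree.Rel.exp_le`
    -- bounds the cost tree from above, while a lower bound is needed.
    have h3 := h1.exp_le (φ := fun o => -1 * if p o.1 then 1 else 0)
      (ψ := fun o => -1 * if o ∈ {o : Memory × ℕ | p o.1} then 1 else 0)
      fun o o' ho => by by_cases hp : p o.1 <;> simp [hp, ← ho.1]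
    rw [CoinTree.exp_mul_left, CoinTree.exp_mul_left] at h3
    linarith

/-! ### Polynomial bounds for the loop counts and the scale. -/

namespace Settings

variable {c : Settings} {x y : ℝ} {r : ℕ}

/-- A bound for the loop counts relative to the scale. -/
def loopFactor (c : Settings) (r : ℕ) : ℕ := c.levelFactor + 1 + 2 ^ r + c.sizeFactor

theorem Fits.bounded (h : c.Fits x y r) (hy : 1 < y) {G : Multigraph} {k : ℕ} (hk : 1 ≤ k) :
    Multigraph.Bounded c x y G k
      (c.loopFactor r * c.scale (G.n + G.m + k) ^ (2 * r + 3)) := by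
  set T := G.n + G.m + k with hT
  have hT1 : 1 ≤ T := by omega
  set P := c.scale T with hP
  have hPr : (P : ℝ) = 2 ^ c.places T := by rw [hP, scale]; push_cast; rfl
  have hP1 : 1 ≤ P := Nat.one_le_two_pow
  have hfac : c.scaleFactor * T ^ c.scaleExponent ≤ P := Nat.le_pow_clog one_lt_two _
  have hTP : T ≤ P := by
    have h1 := h.scaled_le hT1 1 (by norm_num) (show (1 : ℝ) ≤ c.scaleFactor by linarith [h.four_le])
    rw [one_mul, pow_one, ← hPr] at h1
    exact_mod_cast h1
  have hPZ : P ≤ P ^ (2 * r + 3) := Nat.le_self_pow (by omega) P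
  have key : ∀ a b : ℕ, a ≤ b * P → b ≤ c.loopFactor r → a ≤ c.loopFactor r * P ^ (2 * r + 3) :=
    fun a b h1 h2 => h1.trans (Nat.mul_le_mul h2 hPZ)
  have abs_key : ∀ (z : ℤ) (b : ℕ), |(z : ℝ)| ≤ b * P → z.natAbs ≤ b * P := fun z b hz => by
    rw [← Int.cast_abs, ← Nat.cast_natAbs] at hz
    exact_mod_cast hz
  have hy1 := h.one_le_roundedY hy hT1
  have hy2 := c.roundedY_le y T
  have hYP : (c.scaledY y T : ℝ) = c.roundedY y T * P := by
    rw [roundedY, hPr, div_mul_cancel₀ _ (by positivity)]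
  have hP0 : (0 : ℝ) < P := by exact_mod_cast hP1
  have hl : c.loopFactor r = c.levelFactor + 1 + 2 ^ r + c.sizeFactor := rfl
  have h2r : 1 ≤ 2 ^ r := Nat.one_le_two_pow
  have hl1 : 1 ≤ c.loopFactor r := by omega
  have hl2 : c.levelFactor + 1 ≤ c.loopFactor r := by omega
  refine ⟨key _ 1 (by omega) hl1, key _ 1 (by rwa [one_mul]) hl1, key _ 1 (by rw [one_mul]) hl1,
    key _ c.levelFactor le_rfl (by omega), key _ (c.levelFactor + 1) (abs_key _ _ ?_) hl2,
    key _ (c.levelFactor + 1) (abs_key _ _ ?_) hl2, key _ (2 ^ r) (abs_key _ _ ?_) (by omega), ?_⟩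
  · rw [hYP, abs_of_nonneg (by positivity)]
    push_cast
    gcongr
    linarith [h.levels]
  · push_cast
    rw [hYP, show c.roundedY y T * P - P = (c.roundedY y T - 1) * P by ring,
      abs_of_nonneg (mul_nonneg (by linarith) hP0.le)]
    gcongr
    linarith [h.levels]
  · have hround : y + |x| + 2 ≤ 2 ^ c.places T := by
      simpa using h.scaled_le hT1 0 (by norm_num) h.rounding_le
    have hQd := abs_roundedQ_sub_le (c := c) (x := x) (T := T) hy fun h' => h.trivial_iff.1 h'
    have h1 : (y + |x| + 2) / (2 : ℝ) ^ c.places T ≤ 1 := (div_le_one (by positivity)).2 hround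
    have h2 := abs_sub_abs_le_abs_sub (c.roundedQ x y T) ((x - 1) * (y - 1))
    have h3 : (c.scaledQ x y T : ℝ) = c.roundedQ x y T * P := by
      rw [roundedQ, hPr, div_mul_cancel₀ _ (by positivity)]
    rw [h3, abs_mul, abs_of_pos hP0]
    push_cast
    gcongr
    linarith [h.base]
  · rw [popSize, h.sizeExponent]
    exact Nat.mul_le_mul_right _ (by omega)

/-- Rounding up to a power of 2 costs less than a factor 2. -/
theorem Fits.scale_le (h : c.Fits x y r) {T : ℕ} (hT : 1 ≤ T) :
    c.scale T ≤ 2 * c.scaleFactor * T ^ 4 := by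
  have h1 : 1 < c.scaleFactor * T ^ 4 := by
    have h2 : 4 ≤ c.scaleFactor := by exact_mod_cast h.four_le
    have h3 : 1 ≤ T ^ 4 := Nat.one_le_pow _ _ hT
    nlinarith
  have h2 := Nat.pow_pred_clog_lt_self one_lt_two h1
  have h3 : 0 < Nat.clog 2 (c.scaleFactor * T ^ 4) := Nat.clog_pos one_lt_two h1
  rw [scale, places, h.scaleExponent, ← Nat.sub_add_cancel h3, pow_succ]
  have h4 : Nat.clog 2 (c.scaleFactor * T ^ 4) - Nat.succ 0 =
    (Nat.clog 2 (c.scaleFactor * T ^ 4)).pred := rfl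
  rw [mul_assoc, h4]
  omega

end Settings

namespace Multigraph

theorem stored_inputMemory (G : Multigraph) (k : ℕ) : G.Stored (inputMemory G k) := by
  refine ⟨rfl, rfl, fun j => ?_, fun j => ?_⟩ <;>
  simp [inputMemory]

theorem bitLen_inputMemory_le (G : Multigraph) (k a : ℕ) (i : ℤ) :
    bitLen (inputMemory G k a i) ≤ G.n + G.m + k + 1 := by
  have key : ∀ b : ℕ, b ≤ G.n + G.m + k → bitLen (b : ℤ) ≤ G.n + G.m + k + 1 := fun b hb =>
    (bitLen_natCast_le b).trans (by omega)
  unfold inputMemory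
  split_ifs
  · exact key _ (by omega)
  · exact key _ (by omega)
  · exact key _ (by omega)
  · exact key 0 (by omega)
  · exact key _ (by omega)
  · exact key _ (by omega)
  · exact key 0 (by omega)
  · exact key 0 (by omega)

end Multigraph

theorem abs_mul_sub_le {r w f k : ℝ} (hk : 1 ≤ k) (hr : |r - 1| ≤ 1 / (8 * k))
    (hw : |w - f| ≤ |f| / (4 * k)) : |r * w - f| ≤ |f| / k := by
  have hk0 : 0 < k := by linarith
  have h1 : |w| ≤ 2 * |f| := by
    have h2 := abs_sub_abs_le_abs_sub w f
    have h3 : |f| / (4 * k) ≤ |f| := div_le_self (abs_nonneg f) (by linarith)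
    linarith
  rw [show r * w - f = (r - 1) * w + (w - f) by ring]
  refine (abs_add_le _ _).trans ?_
  rw [abs_mul]
  calc |r - 1| * |w| + |w - f| ≤ 1 / (8 * k) * (2 * |f|) + |f| / (4 * k) := by gcongr
    _ = |f| / k / 2 := by field_simp; ring
    _ ≤ |f| / k := half_le_self (by positivity)

/-! ### Accuracy and cost of the scheme. -/

namespace Multigraph

variable {G : Multigraph} {c : Settings} {x y : ℝ} {r : ℕ}

/-- The quantity to be approximated. -/
noncomputable def target (b : Bool) (x y : ℝ) (G : Multigraph) : ℝ :=
  if b then G.deltaTutte x y else G.tutte x y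

theorem target_eq (b : Bool) (x : ℝ) (hy : 1 < y) (hn : 1 ≤ G.n)
    (hu : G.numComponents Finset.univ = 1) :
    target b x y G = y ^ G.m / (y - 1) ^ (G.n - 1) *
      (if b then G.defect (1 / y) ((x - 1) * (y - 1))
        else 1 - G.defect (1 / y) ((x - 1) * (y - 1))) := by
  cases b
  · exact tutte_eq x hy hn hu
  · exact deltaTutte_eq x hy hn hu

/-- The output is accurate if the estimator is. -/
theorem abs_output_sub_target_le (hf : c.Fits x y r) (hy : 1 < y) (hn : 1 ≤ G.n)
    (hu : G.numComponents Finset.univ = 1) {k T : ℕ} (hk : 1 ≤ k) (hT : T = G.n + G.m + k)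
    {st : List (Finset (Fin G.m)) × ℕ} (hst : 0 < st.2)
    (hF : |G.defect (1 / y) ((x - 1) * (y - 1))| ≤ 1 / 2)
    (h : |weighted (estimand c x y T G) st - G.defect (1 / y) ((x - 1) * (y - 1))| ≤
      |G.defect (1 / y) ((x - 1) * (y - 1))| / (4 * k)) :
    |(c.numerator x y T st : ℝ) / c.denominator y T st - target c.difference x y G| ≤
      |target c.difference x y G| / k := by
  have hT1 : 1 ≤ T := by omega
  have hk1 : (1 : ℝ) ≤ k := by exact_mod_cast hk
  have hy1 : 0 < y - 1 := by linarith
  have hP0 : (0 : ℝ) < 2 ^ c.places T := by positivity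
  have hpre := hf.scaled_le hT1 2 (by norm_num) hf.prefactor_le
  have hmn : ((G.m + (G.n - 1) : ℕ) : ℝ) ≤ T := by exact_mod_cast (by omega : G.m + (G.n - 1) ≤ T)
  have hkT : (k : ℝ) ≤ T := by exact_mod_cast (by omega : k ≤ T)
  have h0 : 0 ≤ 2 / (y - 1) := by positivity
  have hd : 2 * (((G.m + (G.n - 1) : ℕ) : ℝ) * ((1 + 2 / (y - 1)) * (1 / 2 ^ c.places T))) ≤
      1 / (8 * k) := by
    rw [le_div_iff₀ (by positivity), mul_one_div, mul_div_assoc', mul_div_assoc', div_mul_eq_mul_div,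
      div_le_one hP0]
    calc 2 * (((G.m + (G.n - 1) : ℕ) : ℝ) * (1 + 2 / (y - 1))) * (8 * k) ≤
          2 * (T * (1 + 2 / (y - 1))) * (8 * T) := by gcongr
      _ = 16 * (1 + 2 / (y - 1)) * (T : ℝ) ^ 2 := by ring
      _ ≤ _ := hpre
  have h8 : 1 / (8 * (k : ℝ)) ≤ 1 := (div_le_one (by positivity)).2 (by linarith)
  obtain ⟨l, hl, hl1⟩ := prefactor_rounding hy (c.roundedY_le y T) (c.lt_roundedY_add y T)
    (hf.step_le hy hT1) (m := G.m) (j := G.n - 1) (by linarith)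
  rw [numerator_div_denominator c x y T hn hst, target_eq _ x hy hn hu, hl]
  set A := y ^ G.m / (y - 1) ^ (G.n - 1)
  set w := weighted (estimand c x y T G) st
  set F := G.defect (1 / y) ((x - 1) * (y - 1))
  have hA : 0 ≤ A := by positivity
  have key : |l * (if c.difference then w else 1 - w) - (if c.difference then F else 1 - F)| ≤
      |(if c.difference then F else 1 - F)| / k := by
    refine abs_mul_sub_le hk1 (hl1.trans hd) ?_
    split_ifs
    · exact h
    -- For T itself the error |F|/(4k) is still relative, because |F| ≤ 1/2 implies |F| ≤ |1 - F|.
    · rw [sub_sub_sub_cancel_left, abs_sub_comm]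
      refine h.trans ?_
      have := abs_sub_abs_le_abs_sub 1 F
      rw [abs_one] at this
      exact div_le_div_of_nonneg_right (by linarith) (by positivity)
  rw [show ∀ g f : ℝ, l * A * g - A * f = A * (l * g - f) by intros; ring, abs_mul, abs_mul,
    mul_div_assoc]
  exact mul_le_mul_of_nonneg_left key (abs_nonneg A)

open Classical in
theorem approximates (hf : c.Fits x y r) (hy : 1 < y) (hn : 1 ≤ G.n)
    (hu : G.numComponents Finset.univ = 1) (hF : |G.defect (1 / y) ((x - 1) * (y - 1))| ≤ 1 / 2)
    {ε : ℝ} (hε : 0 < ε) {T : ℕ} (hT : T = G.n + G.m + ⌈1 / ε⌉₊)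
    (h : 3 / 4 ≤ (CoinTree.iter (level (c.places T) (c.popSize T)) (c.numLevels y T)
      (([∅], 1) : List (Finset (Fin G.m)) × ℕ)).exp fun st =>
        if |weighted (estimand c x y T G) st - G.defect (1 / y) ((x - 1) * (y - 1))| ≤
          |G.defect (1 / y) ((x - 1) * (y - 1))| / (4 * ⌈1 / ε⌉₊) then 1 else 0)
    {a : ℕ} (ha : (Prog.scheme c).coef + (⌈|x|⌉₊ + ⌈|y|⌉₊ + 2) ≤ a) :
    (∀ o ∈ ((Prog.scheme c).run x y (inputMemory G ⌈1 / ε⌉₊)).support,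
      o.2 ≤ a * ((9 * (c.scaleExponent + c.sizeExponent) + 223) *
        (c.loopFactor r * c.scale T ^ (2 * r + 3)) ^ 4) * (T + 1 +
        a * ((9 * (c.scaleExponent + c.sizeExponent) + 223) *
        (c.loopFactor r * c.scale T ^ (2 * r + 3)) ^ 4) + 1)) ∧
    3 / 4 ≤ ((Prog.scheme c).run x y (inputMemory G ⌈1 / ε⌉₊)).toOuterMeasure
      {o | |(outputValue o.1 : ℝ) - target c.difference x y G| ≤
        ε * |target c.difference x y G|} := by
  have hk : 1 ≤ ⌈1 / ε⌉₊ := Nat.one_le_ceil_iff.2 (by positivity)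
  have hεk : 1 / ε ≤ ⌈1 / ε⌉₊ := Nat.le_ceil _
  set k := ⌈1 / ε⌉₊
  have hk0 : (0 : ℝ) < k := by exact_mod_cast hk
  have hZ1 : 1 ≤ c.loopFactor r * c.scale T ^ (2 * r + 3) :=
    Nat.mul_pos (by unfold Settings.loopFactor; positivity)
      (pow_pos (pow_pos two_pos _) _)
  have hsim := simulates_scheme (stored_inputMemory G k) (k := k) rfl (hf.bounded hy hk)
    (hT ▸ hZ1) (hT ▸ hf.popSize_pos T)
  rw [← hT] at hsim
  have hsim' := CoinTree.Rel.and_right hsim (all_pos_level (hf.popSize_pos T))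
  have hsim'' : Prog.Simulates x y (Prog.scheme c) (inputMemory G k) _ (fun t st =>
      (t 3 0 = c.numerator x y T st ∧ t 3 1 = c.denominator y T st) ∧ 0 < st.2) _ :=
    hsim'.mono fun o st h => ⟨⟨h.1.1, h.2⟩, h.1.2⟩
  obtain ⟨h1, h2⟩ := Prog.run_of_simulates (Prog.scheme_gentle c)
    (bitLen_inputMemory_le G k) hsim'' ha
  refine ⟨by rwa [← hT] at h1, ?_⟩
  refine le_trans ?_ (h2 (fun m => |(outputValue m : ℝ) -
    target c.difference x y G| ≤ ε * |target c.difference x y G|) (fun st => |weighted (estimand c x y T G) st -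
    G.defect (1 / y) ((x - 1) * (y - 1))| ≤
          |G.defect (1 / y) ((x - 1) * (y - 1))| / (4 * k)) fun m st hm hst => ?_)
  · rw [show (3 / 4 : ENNReal) = ENNReal.ofReal (3 / 4) by
      rw [ENNReal.ofReal_div_of_pos (by norm_num)]; norm_num]
    exact ENNReal.ofReal_le_ofReal h
  · have h3 := abs_output_sub_target_le hf hy hn hu hk hT hm.2 hF hst
    have h4 : (outputValue m : ℝ) = c.numerator x y T st / c.denominator y T st := by
      rw [outputValue, hm.1.1, hm.1.2]; push_cast; rfl
    rw [h4]
    refine h3.trans ?_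
    rw [div_eq_inv_mul]
    refine mul_le_mul_of_nonneg_right ?_ (abs_nonneg _)
    rwa [inv_le_comm₀ hk0 hε, ← one_div]

theorem cost_bound {n m k T a b S f d : ℕ} {ε : ℝ} (hε : 0 < ε) (hn : 1 ≤ n) (hk : k = ⌈1 / ε⌉₊)
    (hT : T = n + m + k) (hS : S ≤ f * T ^ 4) {o : ℕ}
    (ho : o ≤ a * (b * S ^ d) * (T + 1 + a * (b * S ^ d) + 1)) :
    (o : ℝ) ≤ ((a * b * f ^ d * (3 + a * b * f ^ d) * 2 ^ (8 * d + 1) : ℕ) : ℝ) *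
      ((n : ℝ) + m + 1 / ε) ^ (8 * d + 1) := by
  have hT1 : 1 ≤ T := by omega
  have hε' : 0 < 1 / ε := by positivity
  set K := a * b * f ^ d
  have h1 : a * (b * S ^ d) ≤ K * T ^ (4 * d) := by
    calc a * (b * S ^ d) ≤ a * (b * (f * T ^ 4) ^ d) := by gcongr
      _ = _ := by rw [mul_pow, ← pow_mul]; ring
  have h2 : o ≤ K * (3 + K) * T ^ (8 * d + 1) := by
    have h3 : 1 ≤ T ^ (4 * d) := Nat.one_le_pow _ _ hT1
    have h4 : T + 1 + a * (b * S ^ d) + 1 ≤ (3 + K) * T ^ (4 * d + 1) := by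
      rw [pow_succ]
      have h5 : K * T ^ (4 * d) ≤ K * T ^ (4 * d) * T := Nat.le_mul_of_pos_right _ hT1
      have h6 : T ≤ T ^ (4 * d) * T := Nat.le_mul_of_pos_left _ h3
      calc T + 1 + a * (b * S ^ d) + 1 ≤ 3 * (T ^ (4 * d) * T) + K * T ^ (4 * d) * T := by omega
        _ = _ := by ring
    calc o ≤ _ := ho
      _ ≤ (K * T ^ (4 * d)) * ((3 + K) * T ^ (4 * d + 1)) := Nat.mul_le_mul h1 h4
      _ = K * (3 + K) * T ^ (8 * d + 1) := by ring
  -- Rounding up 1/ε adds less than 1 ≤ n.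
  have h7 : (T : ℝ) ≤ 2 * ((n : ℝ) + m + 1 / ε) := by
    have h8 := Nat.ceil_lt_add_one hε'.le
    have h9 : (1 : ℝ) ≤ n := by exact_mod_cast hn
    rw [hT, hk]; push_cast
    linarith [(Nat.cast_nonneg m : (0 : ℝ) ≤ m)]
  calc (o : ℝ) ≤ (K * (3 + K) * T ^ (8 * d + 1) : ℕ) := by exact_mod_cast h2
    _ = (K * (3 + K) : ℕ) * (T : ℝ) ^ (8 * d + 1) := by push_cast; ring
    _ ≤ (K * (3 + K) : ℕ) * (2 * ((n : ℝ) + m + 1 / ε)) ^ (8 * d + 1) := by gcongr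
    _ = _ := by rw [mul_pow]; push_cast; ring

theorem defect_eq_zero (q : ℝ) {Q : ℝ} (h : ∀ A : Finset (Fin G.m), gap Q A = 0) :
    G.defect q Q = 0 := by
  rw [defect, show gap (G := G) Q = fun _ => 0 from funext h, perc_const]

-- The degenerate cases Q = 1 and n = 1: the defect is 0, so the estimate has to be exactly 0, and
-- it is because the estimand vanishes identically.
open Classical in
theorem exp_close_of_gap_eq_zero {q Q : ℝ} (h : ∀ A : Finset (Fin G.m), gap Q A = 0) {T k : ℕ}
    (h' : ∀ A : Finset (Fin G.m), estimand c x y T G A = 0)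
    (t : CoinTree (List (Finset (Fin G.m)) × ℕ)) :
    3 / 4 ≤ t.exp fun st =>
        if |weighted (estimand c x y T G) st - G.defect q Q| ≤ |G.defect q Q| / (4 * k)
          then 1 else 0 := by
  have h1 : ∀ st, weighted (estimand c x y T G) st = 0 := fun st => by
    rw [show estimand c x y T G = fun _ => 0 from funext h', weighted, popSum]
    simp
  simp only [h1, defect_eq_zero q h]
  norm_num

theorem numComponents_univ_of_connected {C : ℝ} (hC : 0 < C) (hn : 1 ≤ G.n)
    (hG : G.EdgeConnectivityGT (C * Real.log G.n)) : G.numComponents Finset.univ = 1 := by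
  have hlog : 0 ≤ C * Real.log G.n :=
    mul_nonneg hC.le (Real.log_nonneg (by exact_mod_cast hn))
  refine numComponents_univ hn one_pos fun S hS hS' => ?_
  have := hlog.trans_lt (hG S hS hS')
  exact_mod_cast this

/-- A minimum cut. -/
theorem exists_min_cut (hn : 2 ≤ G.n) : ∃ S : Finset (Fin G.n), S.Nonempty ∧ S ≠ Finset.univ ∧
    ∀ S' : Finset (Fin G.n), S'.Nonempty → S' ≠ Finset.univ → G.cutValue S ≤ G.cutValue S' := by
  classical
  obtain ⟨S, hS, h⟩ := Finset.exists_min_image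
    ((Finset.univ : Finset (Finset (Fin G.n))).filter fun S => S.Nonempty ∧ S ≠ Finset.univ)
    G.cutValue ⟨{⟨0, by omega⟩}, by
      simp only [Finset.mem_filter, Finset.mem_univ, true_and, Finset.singleton_nonempty]
      intro h
      have := congrArg Finset.card h
      simp at this
      omega⟩
  simp only [Finset.mem_filter, Finset.mem_univ, true_and] at hS h
  exact ⟨S, hS.1, hS.2, fun S' h1 h2 => h S' ⟨h1, h2⟩⟩

open Classical in
/-- The estimator is accurate on all graphs of the class. -/
theorem exp_close_of_connected (hy : 1 < y) (x : ℝ) (r : ℕ)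
    (hr : |(x - 1) * (y - 1)| + 1 ≤ 2 ^ r) : ∃ C : ℝ, 0 < C ∧
    ∀ (c : Settings), c.Fits x y r → ∀ G ∈ logConnected C,
      |G.defect (1 / y) ((x - 1) * (y - 1))| ≤ 1 / 2 ∧
      ∀ k T : ℕ, 1 ≤ k → T = G.n + G.m + k →
        3 / 4 ≤ (CoinTree.iter (level (c.places T) (c.popSize T)) (c.numLevels y T)
          (([∅], 1) : List (Finset (Fin G.m)) × ℕ)).exp fun st =>
            if |weighted (estimand c x y T G) st - G.defect (1 / y) ((x - 1) * (y - 1))| ≤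
              |G.defect (1 / y) ((x - 1) * (y - 1))| / (4 * k) then 1 else 0 := by
  by_cases hQ1 : (x - 1) * (y - 1) = 1
  · refine ⟨1, one_pos, fun c hf G _ => ?_⟩
    have h : ∀ A : Finset (Fin G.m), gap ((x - 1) * (y - 1)) A = 0 := fun A => by
      rw [gap, hQ1, one_pow, sub_self]
    refine ⟨by rw [defect_eq_zero _ h]; norm_num, fun k T hk hT => ?_⟩
    refine exp_close_of_gap_eq_zero h (fun A => ?_) _
    have : c.roundedQ x y T = 1 := by
      rw [Settings.roundedQ, Settings.scaledQ, if_pos (hf.trivial_iff.2 hQ1), Settings.scale]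
      push_cast
      exact div_self (by positivity)
    rw [estimand, truncatedGap, gap, this, one_pow, sub_self, ite_self]
  · set Q := (x - 1) * (y - 1)
    set R : ℝ := 2 ^ r
    have hR0 : 0 < R := by positivity
    have ha : 0 < |1 - Q| / 2 := half_pos (abs_pos.2 (sub_ne_zero.2 (Ne.symm hQ1)))
    have hR1 : 1 ≤ R := one_le_pow₀ one_le_two
    -- The first bound makes n R q^(c/2) at most 1/4, the second makes third-order terms at most
    -- half of the main term.
    obtain ⟨C, hC, hconn⟩ := exists_connectivity hy (η := min (1 / (4 * R)) (|1 - Q| / 2 / (4 * R ^ 3)))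
      (by positivity)
    refine ⟨C, hC, fun c hf G hG => ?_⟩
    obtain ⟨hn, hG⟩ := hG
    rcases Nat.lt_or_ge G.n 2 with hn2 | hn2
    -- A single vertex has no proper cut and log 1 = 0, so the connectivity assumption is empty
    -- here.
    · have h2 : ∀ A : Finset (Fin G.m), G.numComponents A < 2 := fun A =>
        (numComponents_le A).trans_lt hn2
      have h : ∀ A : Finset (Fin G.m), gap Q A = 0 := fun A => gap_eq_zero Q (h2 A)
      refine ⟨by rw [defect_eq_zero _ h]; norm_num, fun k T hk hT => ?_⟩
      exact exp_close_of_gap_eq_zero h (fun A => estimand_eq_zero _ _ _ _ _ (h2 A)) _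
    · obtain ⟨S, hS, hS', hmin⟩ := exists_min_cut hn2
      have hz := hconn G.n (G.cutValue S) hn2 (hG S hS hS')
      have hq0 : 0 < 1 / y := by positivity
      have hq1 : 1 / y < 1 := (div_lt_one (by linarith)).2 hy
      have hz0 : 0 ≤ (1 / y) ^ ((G.cutValue S : ℝ) / 2) := Real.rpow_nonneg hq0.le _
      set z := (1 / y) ^ ((G.cutValue S : ℝ) / 2) with hzdef
      rw [le_min_iff, le_div_iff₀ (by positivity), le_div_iff₀ (by positivity)] at hz
      have hn1 : (1 : ℝ) ≤ G.n := by exact_mod_cast hn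
      have hz1 : G.n * R * z ≤ 1 / 4 := by
        have h1 : (G.n : ℝ) ≤ G.n ^ 3 := le_self_pow₀ hn1 (by norm_num)
        have h2 : G.n * R * z ≤ G.n ^ 3 * R * z := by gcongr
        linarith [hz.1]
      have hz3 : 4 * (G.n * R) ^ 3 * z ≤ |1 - Q| / 2 := by
        calc _ = G.n ^ 3 * z * (4 * R ^ 3) := by ring
          _ ≤ _ := hz.2
      have hQR : |Q| ≤ R := by linarith
      constructor
      · have h1 := abs_defect_le (G := G) hmin hq0 hq1 hR1 hQR (hz1.trans (by norm_num))
        have h2 : 0 ≤ G.n * R * z := by positivity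
        have h3 : (G.n * R * z) ^ 2 ≤ (1 / 4) ^ 2 := by gcongr
        refine h1.trans ?_
        rw [← hzdef]
        linarith
      · intro k T hk hT
        exact exp_close hf hy hQ1 hn2 hmin hS hS' rfl (hz1.trans (by norm_num)) hz3 hk hT

end Multigraph

/-! ### The two approximation schemes. -/

namespace Multigraph

/-- `C` depends only on x and y and is fixed before the settings, so both schemes work on the same
class. They differ only in the flag `difference`. -/
theorem hasFPRAS_target {x y : ℝ} (hy : 1 < y) : ∃ C : ℝ, 0 < C ∧
    ∀ b : Bool, HasFPRAS x y (logConnected C) (target b x y) := by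
  obtain ⟨r, hr⟩ := pow_unbounded_of_one_lt (|(x - 1) * (y - 1)| + 1) one_lt_two
  obtain ⟨C, hC, h⟩ := exp_close_of_connected hy x r hr.le
  refine ⟨C, hC, fun b => ?_⟩
  obtain ⟨c, hf, hb⟩ := Settings.exists_fits hr.le b
  set a := (Prog.scheme c).coef + (⌈|x|⌉₊ + ⌈|y|⌉₊ + 2)
  set f := (9 * (c.scaleExponent + c.sizeExponent) + 223) * c.loopFactor r ^ 4
  set d := (2 * r + 3) * 4
  set K := a * f * (2 * c.scaleFactor) ^ d
  refine ⟨Prog.scheme c, K * (3 + K) * 2 ^ (8 * d + 1), 8 * d + 1, fun G hG ε hε => ?_⟩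
  have hk : 1 ≤ ⌈1 / ε⌉₊ := Nat.one_le_ceil_iff.2 (by positivity)
  obtain ⟨hF, hclose⟩ := h c hf G hG
  obtain ⟨h1, h2⟩ := approximates hf hy hG.1 (numComponents_univ_of_connected hC hG.1 hG.2) hF hε rfl
    (hclose _ _ hk rfl) le_rfl
  rw [hb] at h2
  refine ⟨fun o ho => ?_, h2⟩
  refine cost_bound hε hG.1 rfl rfl (hf.scale_le (by omega)) ((h1 o ho).trans_eq ?_)
  rw [mul_pow, ← pow_mul, ← mul_assoc (_ + 223)]

end Multigraph

theorem mainTheorem10 (x y : ℝ) (hy : 1 < y) :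
    ∃ C : ℝ, 0 < C ∧
      HasFPRAS x y (logConnected C) (fun G => G.deltaTutte x y) ∧
      HasFPRAS x y (logConnected C) (fun G => G.tutte x y) := by
  obtain ⟨C, hC, h⟩ := Multigraph.hasFPRAS_target (x := x) hy
  exact ⟨C, hC, h true, h false⟩
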